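/- **Conventions.** Let $(M,g)$ be a Riemannian manifold and $U\subset M$ open. A smooth function $\varphi:U\to\mathbb R$ is a *limiting Carleman weight* (LCW) on $U$ if $d\varphi\neq0$ everywhere on $U$ and $\{\overline{p_\varphi},p_\varphi\}=0$ at every point of $T^*U$ where $p_\varphi=0$. Here $\{\cdot,\cdot\}$ is the canonical Poisson bracket and $$p_\varphi(x,\xi)=|\xi|_g^2-|d\varphi|_g^2+2i\langle\xi,d\varphi\rangle_g$$ is the semiclassical principal symbol of $e^{\varphi/h}(-h^2\Delta_g)e^{-\varphi/h}$. A compact surface $(M_0,g_0)$ with boundary is *simple* if its boundary is strictly convex and, for each $x\in M_0$, $\exp_x$ is a diffeomorphism from its maximal domain onto $M_0$. A $3$-manifold $(M,g)$ is *locally admissible* if every point has an open neighbourhood $U$ with a smooth open embedding $\Phi:U\to\mathbb R\times\operatorname{int}M_0$ and a positive smooth function $c$ such that $(M_0,g_0)$ is simple and $g=c\,\Phi^*(dt^2\oplus g_0)$ on $U$. (Then every compact domain with smooth boundary in $U$ is admissible.) In dimension $3$ let $S=\mathrm{Ric}-\frac s4g$ be the Schouten tensor, $C_{ijk}=(\nabla_iS)_{jk}-(\nabla_jS)_{ik}$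 the Cotton tensor, and $$CY_{ij}=\tfrac12\,C_{kli}\,g_{jm}\,\frac{\epsilon^{klm}}{\sqrt{\det g}}$$ the Cotton–York tensor. **Theorem.** Consider the eight Thurston geometries. 1. Each of the six geometries $S^3$, $\mathbb E^3$, $\mathbb H^3$, $S^2\times\mathbb R$, $\mathbb H^2\times\mathbb R$ (with their standard metrics) and $\mathrm{Sol}=(\mathbb R^3,\ e^{2z}dx^2+e^{-2z}dy^2+dz^2)$ admits limiting Carleman weights locally: every point has an open neighbourhood carrying an LCW. Moreover each of them is locally admissible. 2. On $\mathrm{Nil}=(\mathbb R^3,\ dx^2+dy^2+(dz-x\,dy)^2)$ the Cotton–York tensor satisfies $\det CY\neq0$ at every point, and no nonempty open subset carries an LCW. 3. The same two conclusions hold on the universal cover $\widetilde{\mathrm{SL}_2(\mathbb R)}$ with either of the following left-invariant metrics. Put $e_1=\begin{pmatrix}0&1\\-1&0\end{pmatrix}$, $e_2=\begin{pmatrix}\frac12&0\\0&-\frac12\end{pmatrix}$, $e_3=\begin{pmatrix}0&1\\0&0\end{pmatrix}$. - The metric for which $e_1,e_2,e_3$ are orthonormal. - For any $c>0$, the metric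 for which $\frac12e_1,\ e_2,\ e_3-\frac12e_1$ are orthogonal with squared lengths $c,1,1$. Up to homothety, these are the metrics invariant under the four-dimensional isometry group of the geometry; $c=1$ gives the unit tangent bundle of $\mathbb H^2$. -/

import Mathlib

open scoped Manifold ContDiff Matrix
open Metric

noncomputable section

namespace Carleman

/-! ### Riemannian metrics on manifolds and their coordinate expressions -/

section Manifold

variable {E H M ι : Type} [NormedAddCommGroup E] [NormedSpace ℝ E] [TopologicalSpace H]
  [TopologicalSpace M] [ChartedSpace H M] [Fintype ι] [DecidableEq ι]

/-- A field of (bilinear) forms `g_x(v, w)` on the tangent spaces of a manifold. The ones used below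
are explicit smooth Riemannian metrics. -/
abbrev MetricField (I : ModelWithCorners ℝ E H) (M : Type) [TopologicalSpace M]
    [ChartedSpace H M] : Type :=
  ∀ x : M, TangentSpace I x → TangentSpace I x → ℝ

variable (b : Module.Basis ι ℝ E) (I : ModelWithCorners ℝ E H)

/-- The matrix `g_ij(u)` of the metric `g` in the chart centred at `p`. Coordinates in the model
vector space `E` are taken with respect to the basis `b`; here `u : E` is a point of the target of
the chart. -/
def chartGram (g : MetricField I M) (p : M) (u : E) : Matrix ι ι ℝ :=
  Matrix.of fun i j =>
    g ((extChartAt I p).symm u)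
      (mfderiv 𝓘(ℝ, E) I (extChartAt I p).symm u (b i))
      (mfderiv 𝓘(ℝ, E) I (extChartAt I p).symm u (b j))

/-- The semiclassical principal symbol, in the chart centred at `p`, of the conjugated
Laplace-Beltrami operator `e^{φ/h} (-h² Δ_g) e^{-φ/h}`:
`⟨ξ + i dφ, ξ + i dφ⟩_g = |ξ|²_g - |dφ|²_g + 2 i ⟨ξ, dφ⟩_g`
(complex bilinear extension of the inner product of covectors). -/
def symbol (g : MetricField I M) (φ : M → ℝ) (p : M) (u : E) (ξ : ι → ℝ) : ℂ :=
  let dφ : ι → ℝ := fun i => fderiv ℝ (φ ∘ (extChartAt I p).symm) u (b i)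
  ∑ i, ∑ j, (((chartGram b I g p u)⁻¹ i j : ℝ) : ℂ) *
    ((ξ i : ℂ) + Complex.I * (dφ i : ℂ)) * ((ξ j : ℂ) + Complex.I * (dφ j : ℂ))

/-- The canonical Poisson bracket
`{a₁, a₂} = ∑ᵢ (∂a₁/∂ξᵢ ∂a₂/∂xᵢ - ∂a₁/∂xᵢ ∂a₂/∂ξᵢ)` of two complex valued functions of
position and momentum. -/
def poissonBracket (a₁ a₂ : E → (ι → ℝ) → ℂ) (u : E) (ξ : ι → ℝ) : ℂ :=
  ∑ i,
    (fderiv ℝ (fun η => a₁ u η) ξ (Pi.single i 1) * fderiv ℝ (fun y => a₂ y ξ) u (b i)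
      - fderiv ℝ (fun y => a₁ y ξ) u (b i) * fderiv ℝ (fun η => a₂ u η) ξ (Pi.single i 1))

/-- `φ` is a limiting Carleman weight on the open subset `U` of `(M, g)`: it is smooth with nowhere
vanishing differential on `U`, and at every point of the cotangent bundle over `U` where
`p_φ = 0` one has `{conj p_φ, p_φ} = 0`, `p_φ` being the principal symbol above. (The bracket on
the cotangent bundle does not depend on coordinates; at `p` the chart centred at `p` is used.) -/
structure IsLCWOn (g : MetricField I M) (U : Set M) (φ : M → ℝ) : Prop where
  smooth : ContMDiffOn I 𝓘(ℝ, ℝ) ∞ φ U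
  diff_ne_zero : ∀ p ∈ U, mfderiv I 𝓘(ℝ, ℝ) φ p ≠ 0
  bracket_eq_zero : ∀ p ∈ U, ∀ ξ : ι → ℝ,
    symbol b I g φ p (extChartAt I p p) ξ = 0 →
      poissonBracket b (fun y η => (starRingEnd ℂ) (symbol b I g φ p y η))
        (symbol b I g φ p) (extChartAt I p p) ξ = 0

/-- Every point has an open neighbourhood carrying a limiting Carleman weight. -/
def LocallyAdmitsLCW (g : MetricField I M) : Prop :=
  ∀ p : M, ∃ U : Set M, IsOpen U ∧ p ∈ U ∧ ∃ φ : M → ℝ, IsLCWOn b I g U φ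

/-- No nonempty open subset carries a limiting Carleman weight. -/
def NowhereAdmitsLCW (g : MetricField I M) : Prop :=
  ∀ U : Set M, IsOpen U → U.Nonempty → ¬ ∃ φ : M → ℝ, IsLCWOn b I g U φ

end Manifold

/-! ### Tensor calculus in coordinates -/

section Coordinates

variable {n : ℕ}

/-- The point space of the coordinates `x^0, …, x^(n-1)`. -/
abbrev R (n : ℕ) : Type := EuclideanSpace ℝ (Fin n)

/-- The coordinate vector field `∂_i`. -/
def e (i : Fin n) : R n := EuclideanSpace.single i 1

/-- The partial derivative `∂_i f`. -/
def pd (i : Fin n) (f : R n → ℝ) (x : R n) : ℝ := fderiv ℝ f x (e i)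

/-- The Christoffel symbol `Γ^k_ij` of the metric `G`. -/
def christoffel (G : R n → Matrix (Fin n) (Fin n) ℝ) (k i j : Fin n) (x : R n) : ℝ :=
  1 / 2 * ∑ l, (G x)⁻¹ k l *
    (pd i (fun y => G y j l) x + pd j (fun y => G y i l) x - pd l (fun y => G y i j) x)

/-- The Ricci tensor `Ric_jk`. -/
def ricci (G : R n → Matrix (Fin n) (Fin n) ℝ) (j k : Fin n) (x : R n) : ℝ :=
  ∑ i, (pd i (christoffel G i j k) x - pd j (christoffel G i i k) x
    + ∑ l, (christoffel G i i l x * christoffel G l j k x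
      - christoffel G i j l x * christoffel G l i k x))

/-- The scalar curvature. -/
def scalarCurv (G : R n → Matrix (Fin n) (Fin n) ℝ) (x : R n) : ℝ :=
  ∑ j, ∑ k, (G x)⁻¹ j k * ricci G j k x

/-- The Schouten tensor `S = (Ric - s g / (2 (n - 1))) / (n - 2)` in dimension `n = 3`. -/
def schouten (G : R 3 → Matrix (Fin 3) (Fin 3) ℝ) (j k : Fin 3) (x : R 3) : ℝ :=
  ricci G j k x - scalarCurv G x / 4 * G x j k

/-- The covariant derivative `(∇_k S)_li` of the Schouten tensor. -/
def nablaSchouten (G : R 3 → Matrix (Fin 3) (Fin 3) ℝ) (k l i : Fin 3) (x : R 3) : ℝ :=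
  pd k (schouten G l i) x
    - ∑ m, christoffel G m k l x * schouten G m i x
    - ∑ m, christoffel G m k i x * schouten G l m x

/-- The Levi-Civita symbol `ε^{klm}`, i.e. the sign of `(k, l, m)` as a permutation, or zero. -/
def leviCivita (k l m : Fin 3) : ℝ :=
  (Matrix.of ![Pi.single k (1 : ℝ), Pi.single l 1, Pi.single m 1] : Matrix (Fin 3) (Fin 3) ℝ).det

/-- The Cotton-York tensor as a `(0,2)`-tensor,
`CY_ij = ½ g_jm C_kli ε^{klm} / √(det g)`, with the Cotton tensor
`C_kli = (∇_k S)_li - (∇_l S)_ki`. -/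
def cottonYork (G : R 3 → Matrix (Fin 3) (Fin 3) ℝ) (x : R 3) : Matrix (Fin 3) (Fin 3) ℝ :=
  Matrix.of fun i j =>
    1 / 2 * ∑ k, ∑ l, ∑ m, G x j m * (nablaSchouten G k l i x - nablaSchouten G l k i x) *
      (leviCivita k l m / √(G x).det)

/-- The coefficients `g(∂_i, ∂_j)` of a metric on `ℝⁿ` in the standard coordinates. -/
def coeffs (g : MetricField (𝓡 n) (R n)) (x : R n) : Matrix (Fin n) (Fin n) ℝ :=
  Matrix.of fun i j => g x (e i) (e j)

/-- `γ : [0,1] → ℝⁿ` is a geodesic of `G`, with velocity `w`, that stays in the closed unit ball. -/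
structure IsGeodesicInBall (G : R n → Matrix (Fin n) (Fin n) ℝ) (γ w : ℝ → R n) : Prop where
  mem : ∀ t ∈ Set.Icc (0 : ℝ) 1, γ t ∈ closedBall (0 : R n) 1
  velocity : ∀ t ∈ Set.Icc (0 : ℝ) 1, HasDerivWithinAt γ (w t) (Set.Icc 0 1) t
  geodesic : ∀ t ∈ Set.Icc (0 : ℝ) 1, ∀ k, HasDerivWithinAt (fun s => w s k)
    (-∑ i, ∑ j, christoffel G k i j (γ t) * w t i * w t j) (Set.Icc 0 1) t

/-- `exp_x v = y` in the closed unit ball with metric `G`: the geodesic issuing from `x` with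
velocity `v` stays in the ball up to time `1`, and then it is at `y`. -/
def ExpEq (G : R n → Matrix (Fin n) (Fin n) ℝ) (x v y : R n) : Prop :=
  ∃ γ w : ℝ → R n, IsGeodesicInBall G γ w ∧ γ 0 = x ∧ w 0 = v ∧ γ 1 = y

/-- The maximal domain of `exp_x` in the closed unit ball with metric `G`. -/
def expDomain (G : R n → Matrix (Fin n) (Fin n) ℝ) (x : R n) : Set (R n) :=
  {v | ∃ y, ExpEq G x v y}

/-- The closed unit disc, with the smooth Riemannian metric `G`, is a simple surface: its boundary
is strictly convex, and for each of its points `x` the map `exp_x` is a diffeomorphism of its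
maximal domain onto the disc. -/
structure IsSimpleDisc (G : R 2 → Matrix (Fin 2) (Fin 2) ℝ) : Prop where
  /-- `G` is the restriction of a smooth Riemannian metric on a neighbourhood of the disc. -/
  metric : ∃ W : Set (R 2), IsOpen W ∧ closedBall 0 1 ⊆ W ∧
    (∀ i j, ContDiffOn ℝ ∞ (fun x => G x i j) W) ∧ ∀ x ∈ W, (G x).PosDef
  /-- Positivity, on the nonzero vectors tangent to the boundary, of the Hessian of the defining
  function `|x|²/2`. -/
  strictlyConvex : ∀ x v : R 2, ‖x‖ = 1 → v ≠ 0 → inner ℝ x v = 0 →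
    0 < ∑ i, ∑ j, ((if i = j then 1 else 0) - ∑ k, x k * christoffel G k i j x) * v i * v j
  exp_diffeo : ∀ x ∈ closedBall (0 : R 2) 1, ∃ F L : R 2 → R 2,
    (∀ v ∈ expDomain G x, ExpEq G x v (F v)) ∧
    Set.InvOn L F (expDomain G x) (closedBall 0 1) ∧
    Set.MapsTo L (closedBall 0 1) (expDomain G x) ∧
    ContDiffOn ℝ ∞ F (expDomain G x) ∧ ContDiffOn ℝ ∞ L (closedBall 0 1)

end Coordinates

section Admissible

variable {E H M : Type} [NormedAddCommGroup E] [NormedSpace ℝ E] [TopologicalSpace H]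
  [TopologicalSpace M] [ChartedSpace H M] (I : ModelWithCorners ℝ E H)

/-- Every point of the three-dimensional `(M, g)` has an open neighbourhood `U` that embeds
smoothly, by `x ↦ (τ x, σ x)`, in `ℝ × int M₀` for a simple surface `(M₀, G)`, such that
`g = c (dτ² + σ^* G)` on `U` for a positive smooth function `c`. So every compact domain with
smooth boundary in `U` is admissible, i.e. conformal to a domain in the interior of
`(ℝ × M₀, e ⊕ G)`. (A simple surface is diffeomorphic to the closed disc.) -/
def LocallyAdmissible (g : MetricField I M) : Prop :=
  ∀ p : M, ∃ U : Set M, IsOpen U ∧ p ∈ U ∧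
    ∃ (G : R 2 → Matrix (Fin 2) (Fin 2) ℝ) (τ : M → ℝ) (σ : M → R 2) (c : M → ℝ),
      IsSimpleDisc G ∧
      ContMDiffOn I 𝓘(ℝ, ℝ) ∞ τ U ∧ ContMDiffOn I (𝓡 2) ∞ σ U ∧ ContMDiffOn I 𝓘(ℝ, ℝ) ∞ c U ∧
      Set.MapsTo σ U (ball 0 1) ∧ Set.InjOn (fun x => (τ x, σ x)) U ∧ (∀ x ∈ U, 0 < c x) ∧
      ∀ x ∈ U, ∀ v w : TangentSpace I x,
        g x v w =
          c x * ((show ℝ from mfderiv I 𝓘(ℝ, ℝ) τ x v) * (show ℝ from mfderiv I 𝓘(ℝ, ℝ) τ x w)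
            + ∑ i, ∑ j, G (σ x) i j * (show R 2 from mfderiv I (𝓡 2) σ x v) i
                * (show R 2 from mfderiv I (𝓡 2) σ x w) j)

end Admissible

/-! ### The eight geometries -/

/-- The standard basis of `ℝⁿ`. -/
abbrev stdBasis (n : ℕ) : Module.Basis (Fin n) ℝ (R n) :=
  (EuclideanSpace.basisFun (Fin n) ℝ).toBasis

/-- The unit sphere `Sⁿ` in `ℝⁿ⁺¹`. -/
abbrev Sphere (n : ℕ) : Type := sphere (0 : R (n + 1)) 1

/-- The round metric, induced by the Euclidean metric of `ℝⁿ⁺¹`. -/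
def sphereMetric (n : ℕ) : MetricField (𝓡 n) (Sphere n) := fun x v w =>
  inner ℝ (show R (n + 1) from mfderiv (𝓡 n) 𝓘(ℝ, R (n + 1)) (Subtype.val : Sphere n → R (n + 1)) x v)
    (show R (n + 1) from mfderiv (𝓡 n) 𝓘(ℝ, R (n + 1)) (Subtype.val : Sphere n → R (n + 1)) x w)

/-- The Euclidean metric of `ℝⁿ`. -/
def euclideanMetric (n : ℕ) : MetricField (𝓡 n) (R n) := fun _ v w =>
  inner ℝ (show R n from v) (show R n from w)

/-- The open upper half space of `ℝⁿ⁺¹`, where the last coordinate is positive. -/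
def upperHalf (n : ℕ) : TopologicalSpace.Opens (R (n + 1)) where
  carrier := {x | 0 < x (Fin.last n)}
  is_open' := isOpen_lt continuous_const (by fun_prop)

/-- Hyperbolic space of dimension `n + 1`, as the upper half space. -/
abbrev Hyperbolic (n : ℕ) : Type := upperHalf n

/-- The hyperbolic metric `(dx_0² + ⋯ + dx_n²) / x_n²`. -/
def hyperbolicMetric (n : ℕ) : MetricField (𝓡 (n + 1)) (Hyperbolic n) := fun x v w =>
  inner ℝ
    (show R (n + 1) from
      mfderiv (𝓡 (n + 1)) (𝓡 (n + 1)) (Subtype.val : Hyperbolic n → R (n + 1)) x v)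
    (show R (n + 1) from
      mfderiv (𝓡 (n + 1)) (𝓡 (n + 1)) (Subtype.val : Hyperbolic n → R (n + 1)) x w)
    / (x.1 (Fin.last n)) ^ 2

/-- The Riemannian product of `(N, g)` and the real line. -/
def prodLine {n : ℕ} {N : Type} [TopologicalSpace N] [ChartedSpace (R n) N]
    (g : MetricField (𝓡 n) N) : MetricField ((𝓡 n).prod 𝓘(ℝ, ℝ)) (N × ℝ) := fun x v w =>
  g x.1 (show R n × ℝ from v).1 (show R n × ℝ from w).1
    + (show R n × ℝ from v).2 * (show R n × ℝ from w).2

/-- The standard basis of `ℝⁿ × ℝ`. -/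
abbrev prodBasis (n : ℕ) : Module.Basis (Fin n ⊕ Unit) ℝ (R n × ℝ) :=
  (stdBasis n).prod (Module.Basis.singleton Unit ℝ)

/-- `Sol`: the metric `e^{2z} dx² + e^{-2z} dy² + dz²` on `ℝ³`. -/
def solMetric : MetricField (𝓡 3) (R 3) := fun p v w =>
  let v : R 3 := v
  let w : R 3 := w
  Real.exp (2 * p 2) * (v 0 * w 0) + Real.exp (-(2 * p 2)) * (v 1 * w 1) + v 2 * w 2

/-- `Nil`: the metric `dx² + dy² + (dz - x dy)²` on `ℝ³`. -/
def nilMetric : MetricField (𝓡 3) (R 3) := fun p v w =>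
  let v : R 3 := v
  let w : R 3 := w
  v 0 * w 0 + v 1 * w 1 + (v 2 - p 0 * v 1) * (w 2 - p 0 * w 1)

/-- The rotation generator, in the Lie algebra of `SL(2, ℝ)`. -/
def sl₁ : Matrix (Fin 2) (Fin 2) ℝ := !![0, 1; -1, 0]
/-- The diagonal generator, in the Lie algebra of `SL(2, ℝ)`. -/
def sl₂ : Matrix (Fin 2) (Fin 2) ℝ := !![1 / 2, 0; 0, -1 / 2]
/-- The unipotent generator, in the Lie algebra of `SL(2, ℝ)`. -/
def sl₃ : Matrix (Fin 2) (Fin 2) ℝ := !![0, 1; 0, 0]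

/-- The covering map `ℝ³ → SL(2, ℝ)`, in the coordinates `(θ, t, s)` of the Iwasawa
decomposition. It identifies the universal cover of `SL(2, ℝ)` with `ℝ³`. -/
def iwasawa (p : R 3) : Matrix (Fin 2) (Fin 2) ℝ :=
  !![Real.cos (p 0), Real.sin (p 0); -Real.sin (p 0), Real.cos (p 0)] *
    !![Real.exp (p 1 / 2), 0; 0, Real.exp (-(p 1 / 2))] * !![1, p 2; 0, 1]

/-- The coordinates, with respect to `sl₁, sl₂, sl₃`, of the Maurer-Cartan form `A⁻¹ dA` of
`SL(2, ℝ)`, in the coordinates `(θ, t, s)` of the universal cover. They form the left-invariant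
coframe dual to the left-invariant fields with values `sl₁, sl₂, sl₃` at the identity. -/
def slCoframe (p v : R 3) : Fin 3 → ℝ :=
  ![Real.exp (p 1) * v 0,
    2 * p 2 * Real.exp (p 1) * v 0 + v 1,
    ((p 2 ^ 2 - 1) * Real.exp (p 1) + Real.exp (-p 1)) * v 0 + p 2 * v 1 + v 2]

/-- `dA = A (ω₁ sl₁ + ω₂ sl₂ + ω₃ sl₃)` for the coframe `ω`. -/
theorem iwasawa_hasDerivAt (p v : R 3) (i j : Fin 2) :
    HasDerivAt (fun r : ℝ => iwasawa (p + r • v) i j)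
      ((iwasawa p * (slCoframe p v 0 • sl₁ + slCoframe p v 1 • sl₂ + slCoframe p v 2 • sl₃)) i j)
      0 := by
  have hl : ∀ k : Fin 3, HasDerivAt (fun r : ℝ => (p + r • v) k) (v k) 0 := fun k => by
    simpa using ((hasDerivAt_id (0 : ℝ)).mul_const (v k)).const_add (p k)
  have hE : ∀ q : R 3, iwasawa q =
      !![Real.cos (q 0) * Real.exp (q 1 / 2),
          Real.cos (q 0) * Real.exp (q 1 / 2) * q 2 + Real.sin (q 0) * Real.exp (-(q 1 / 2));
        -Real.sin (q 0) * Real.exp (q 1 / 2),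
          -Real.sin (q 0) * Real.exp (q 1 / 2) * q 2 + Real.cos (q 0) * Real.exp (-(q 1 / 2))] := by
    intro q
    simp [iwasawa]
  have h2 := hl 2
  have hc := (hl 0).cos
  have hs := (hl 0).sin
  have he := ((hl 1).div_const 2).exp
  have hm := ((hl 1).div_const 2).fun_neg.exp
  have e1 : Real.exp (p 1) = Real.exp (p 1 / 2) ^ 2 := by
    rw [← Real.exp_nat_mul]; ring_nf
  have e2 : Real.exp (-p 1) = Real.exp (-(p 1 / 2)) ^ 2 := by
    rw [← Real.exp_nat_mul]; ring_nf
  have e3 : Real.exp (p 1 / 2) * Real.exp (-(p 1 / 2)) = 1 := by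
    rw [← Real.exp_add]; simp
  have k00 := hc.fun_mul he
  have k01 := (k00.fun_mul h2).fun_add (hs.fun_mul hm)
  have k10 := hs.fun_neg.fun_mul he
  have k11 := (k10.fun_mul h2).fun_add (hc.fun_mul hm)
  simp only [hE]
  simp only [zero_smul, add_zero] at k00 k01 k10 k11
  set a := Real.exp (p 1 / 2)
  set d := Real.exp (-(p 1 / 2))
  fin_cases i <;> fin_cases j
  · refine k00.congr_deriv ?_
    simp [slCoframe, sl₁, sl₂, sl₃, Matrix.mul_apply, Fin.sum_univ_two, e1, e2]
    linear_combination (Real.sin (p 0) * v 0 * a) * e3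
  · refine k01.congr_deriv ?_
    simp [slCoframe, sl₁, sl₂, sl₃, Matrix.mul_apply, Fin.sum_univ_two, e1, e2]
    linear_combination (Real.sin (p 0) * v 0 * a * p 2 - v 0 * Real.cos (p 0) * d) * e3
  · refine k10.congr_deriv ?_
    simp [slCoframe, sl₁, sl₂, sl₃, Matrix.mul_apply, Fin.sum_univ_two, e1, e2]
    linear_combination (Real.cos (p 0) * v 0 * a) * e3
  · refine k11.congr_deriv ?_
    simp [slCoframe, sl₁, sl₂, sl₃, Matrix.mul_apply, Fin.sum_univ_two, e1, e2]
    linear_combination (Real.cos (p 0) * v 0 * a * p 2 + v 0 * Real.sin (p 0) * d) * e3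

/-- The left-invariant metric on the universal cover of `SL(2, ℝ)` for which the left-invariant
fields given by `sl₁, sl₂, sl₃` are orthonormal. -/
def slMetric : MetricField (𝓡 3) (R 3) := fun p v w =>
  slCoframe p v 0 * slCoframe p w 0 + slCoframe p v 1 * slCoframe p w 1
    + slCoframe p v 2 * slCoframe p w 2

/-- The left-invariant metric on the universal cover of `SL(2, ℝ)` for which the left-invariant
fields given by `sl₁ / 2`, `sl₂` and `sl₃ - sl₁ / 2` are orthogonal, of squared lengths `c, 1, 1`.
These metrics are also invariant under right translations by rotations (the one-parameter group
of `sl₁`). Up to homothety, they are the metrics invariant under the full (four-dimensional)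
group of the geometry; for `c = 1` it is the metric of the unit tangent bundle of the
hyperbolic plane. -/
def slMetricOfFiber (c : ℝ) : MetricField (𝓡 3) (R 3) := fun p v w =>
  c * ((2 * slCoframe p v 0 + slCoframe p v 2) * (2 * slCoframe p w 0 + slCoframe p w 2))
    + slCoframe p v 1 * slCoframe p w 1 + slCoframe p v 2 * slCoframe p w 2

end Carleman

end

namespace Carleman

/-! ### The Poisson bracket of the symbol in coordinates -/

section Bracket

variable {E ι : Type} [NormedAddCommGroup E] [NormedSpace ℝ E] [Fintype ι] [DecidableEq ι]

/-! Positive half. Suppose `g = c (dτ² + G)` with `G` a metric in two variables `σ`. Let `Z` be the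
complex vector dual to the covector `ξ + i dτ`. On the zero set of the symbol one finds `c dτ(Z) =
i`, while `dσ(Z)` is real, and these two facts make the bracket vanish
(`poissonBracket_eq_zero_of_product`). Hence `τ` is a limiting Carleman weight, and local
admissibility implies the local existence of weights (`LocallyAdmissible.locallyAdmitsLCW`).

Five of the six geometries are conformally flat through explicit maps into `ℝ³`, and the flat disc
is simple. For Sol one factors out `e^{2z}` and puts `1 + a = e^{-z}`, which leaves `dx² + da² + (1
+ a)⁴ dy²`. What has to be shown is that a small disc of the surface `da² + (1 + a)⁴ db²` is simple
(`exists_isSimpleDisc_solDisc`). The geodesic equation is read as an equation in `C([0,1])` for the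
acceleration and solved by the implicit function theorem, once with initial position and velocity as
data, once with the two endpoints. An a priori bound on the speed of arcs in the disc puts every
such arc in the range where the solution is unique, and convexity of `a² + b²` along geodesics keeps
the constructed arcs inside the disc.

Negative half. The bracket condition says that `Hess φ = α dφ + dφ α - ⟨α, dφ⟩ g` with `α = d log
|dφ|`, that is, that `dφ` is parallel for the conformal metric `|dφ|² g`, which is therefore locally
the product of a line and a surface. For such a product the Cotton-York tensor is a symmetric
product of two covectors, so it is degenerate; as the Cotton tensor is conformally invariant in
dimension three, `det CY = 0` for `g` too. Invertibility of `CY` thus excludes weights on every open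
set (`IsCoframe.nowhereAdmitsLCW`).

The proof does not change the metric. In a left-invariant orthonormal frame it commutes derivatives
three times: on `φ` for the symmetry of the Hessian; on the components of `dφ`, which determines
`∇α` up to one function `μ` (`traceForm_eq`); and on the components of `α`, which expresses the
Cotton tensor through `dφ` and `dμ` (`det_frameCottonYork_eq_zero`). The structure constants being
constant, curvature in the frame is polynomial algebra. `IsCoframe.cottonYork_eq` compares the frame
tensor with the coordinate one, and explicit determinants finish Nil and the metrics on the cover of
`SL(2, ℝ)`. -/

theorem differentiableAt_matrix_det {A : E → Matrix ι ι ℝ} {u : E}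
    (hA : ∀ i j, DifferentiableAt ℝ (fun y => A y i j) u) :
    DifferentiableAt ℝ (fun y => (A y).det) u := by
  simp only [Matrix.det_apply]
  refine DifferentiableAt.fun_sum fun σ _ => ?_
  refine DifferentiableAt.const_smul ?_ _
  have := (HasFDerivAt.finsetProd (𝕜 := ℝ) (u := Finset.univ) (g := fun i y => A y (σ i) i)
    (fun i _ => (hA (σ i) i).hasFDerivAt)).differentiableAt
  exact this.congr_of_eventuallyEq (.of_forall fun y => by simp)

theorem differentiableAt_matrix_inv {A : E → Matrix ι ι ℝ} {u : E}
    (hA : ∀ i j, DifferentiableAt ℝ (fun y => A y i j) u) (hdet : (A u).det ≠ 0) (i j : ι) :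
    DifferentiableAt ℝ (fun y => (A y)⁻¹ i j) u := by
  simp only [Matrix.inv_def, Matrix.smul_apply, smul_eq_mul, Ring.inverse_eq_inv',
    Matrix.adjugate_apply]
  refine ((differentiableAt_matrix_det hA).inv hdet).mul (differentiableAt_matrix_det fun k l => ?_)
  by_cases h : k = j
  · subst h; simp
  · simpa [Matrix.updateRow_ne h] using hA k l

/-- `∂(A⁻¹) = -A⁻¹ ∂A A⁻¹`. -/
theorem fderiv_matrix_inv {A : E → Matrix ι ι ℝ} {u : E}
    (hA : ∀ i j, DifferentiableAt ℝ (fun y => A y i j) u) (hdet : (A u).det ≠ 0) (v : E) (i j : ι) :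
    fderiv ℝ (fun y => (A y)⁻¹ i j) u v =
      -∑ k, ∑ l, (A u)⁻¹ i k * fderiv ℝ (fun y => A y k l) u v * (A u)⁻¹ l j := by
  have hev : ∀ᶠ y in nhds u, (A y).det ≠ 0 :=
    (differentiableAt_matrix_det hA).continuousAt.eventually_ne hdet
  have hI := differentiableAt_matrix_inv hA hdet
  -- Differentiate `A⁻¹ A = 1`, which holds near `u` because the determinant stays nonzero there.
  have key : ∀ l, ∑ k, ((A u)⁻¹ i k * fderiv ℝ (fun y => A y k l) u v
      + fderiv ℝ (fun y => (A y)⁻¹ i k) u v * A u k l) = 0 := by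
    intro l
    have h1 : (fun y => ∑ k, (A y)⁻¹ i k * A y k l) =ᶠ[nhds u] fun _ => (1 : Matrix ι ι ℝ) i l := by
      filter_upwards [hev] with y hy
      rw [← Matrix.nonsing_inv_mul (A y) (isUnit_iff_ne_zero.2 hy), Matrix.mul_apply]
    have h2 := congrArg (fun L : E →L[ℝ] ℝ => L v) (h1.fderiv_eq (𝕜 := ℝ))
    simp only [fderiv_fun_const, Pi.zero_apply, _root_.zero_apply] at h2
    rw [(HasFDerivAt.fun_sum (u := Finset.univ)
      fun k _ => ((hI i k).fun_mul (hA k l)).hasFDerivAt).fderiv, _root_.sum_apply] at h2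
    rw [← h2]
    refine Finset.sum_congr rfl fun k _ => ?_
    rw [fderiv_fun_mul (hI i k) (hA k l)]
    simp [mul_comm]
  have hM : (Matrix.of fun a b => fderiv ℝ (fun y => (A y)⁻¹ a b) u v) i ᵥ* (A u) =
      -((A u)⁻¹ i ᵥ* (Matrix.of fun a b => fderiv ℝ (fun y => A y a b) u v)) := by
    ext l
    have := key l
    rw [Finset.sum_add_distrib] at this
    simp only [Matrix.vecMul, dotProduct, Matrix.of_apply, Pi.neg_apply]
    linarith
  have h3 := congrArg (fun w => w ᵥ* (A u)⁻¹) hM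
  simp only [Matrix.vecMul_vecMul] at h3
  rw [Matrix.mul_nonsing_inv _ (isUnit_iff_ne_zero.2 hdet), Matrix.vecMul_one] at h3
  have h4 := congrFun h3 j
  simp only [Matrix.of_apply] at h4
  rw [h4]
  simp only [Pi.neg_apply, Matrix.vecMul, dotProduct, Matrix.of_apply, neg_mul,
    Finset.sum_neg_distrib, Finset.sum_mul]
  rw [Finset.sum_comm]

/-- The symbol attached to a field of Gram matrices and a weight in coordinates. -/
noncomputable def coordSymbol (b : Module.Basis ι ℝ E) (A : E → Matrix ι ι ℝ) (ψ : E → ℝ) (u : E) (ξ : ι → ℝ) :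
    ℂ :=
  ∑ i, ∑ j, (((A u)⁻¹ i j : ℝ) : ℂ) *
    ((ξ i : ℂ) + Complex.I * (fderiv ℝ ψ u (b i) : ℂ)) *
      ((ξ j : ℂ) + Complex.I * (fderiv ℝ ψ u (b j) : ℂ))

theorem symbol_eq_coordSymbol {H M : Type} [TopologicalSpace H] [TopologicalSpace M]
    [ChartedSpace H M] (b : Module.Basis ι ℝ E) (I : ModelWithCorners ℝ E H) (g : MetricField I M)
    (φ : M → ℝ) (p : M) :
    symbol b I g φ p = coordSymbol b (chartGram b I g p) (φ ∘ (extChartAt I p).symm) := rfl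

/-- Raising the index of `ζ = ξ + i dψ` to `Z = A⁻¹ ζ` makes the fibre derivative of the symbol `2
Z`. Its base derivative is `P`, where the derivative of the inverse matrix has become `-∂A(Z, Z)`.
Only derivatives of the metric itself then occur in the bracket. -/
theorem poissonBracket_coordSymbol {b : Module.Basis ι ℝ E} {A : E → Matrix ι ι ℝ} {ψ : E → ℝ}
    {u : E} (hA : ∀ i j, DifferentiableAt ℝ (fun y => A y i j) u) (hsymm : (A u).IsSymm)
    (hdet : (A u).det ≠ 0) (hψ : ∀ i, DifferentiableAt ℝ (fun y => fderiv ℝ ψ y (b i)) u)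
    (ξ : ι → ℝ) (Z P : ι → ℂ)
    (hZ : ∀ i, Z i = ∑ j, (((A u)⁻¹ i j : ℝ) : ℂ) * ((ξ j : ℂ) + Complex.I * fderiv ℝ ψ u (b j)))
    (hP : ∀ k, P k = -(∑ i, ∑ j, (fderiv ℝ (fun y => A y i j) u (b k) : ℂ) * Z i * Z j)
      + 2 * Complex.I * ∑ j, Z j * (fderiv ℝ (fun y => fderiv ℝ ψ y (b j)) u (b k) : ℂ)) :
    poissonBracket b (fun y η => (starRingEnd ℂ) (coordSymbol b A ψ y η)) (coordSymbol b A ψ) u ξ =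
      4 * Complex.I * (∑ k, (starRingEnd ℂ) (Z k) * P k).im := by
  have hinvs : ∀ i j, (A u)⁻¹ i j = (A u)⁻¹ j i := fun i j => by
    have : ((A u)⁻¹)ᵀ = (A u)⁻¹ := by rw [Matrix.transpose_nonsing_inv, hsymm.eq]
    exact congrFun (congrFun this j) i
  have hI := differentiableAt_matrix_inv hA hdet
  set ζ : ι → ℂ := fun i => (ξ i : ℂ) + Complex.I * fderiv ℝ ψ u (b i) with hζ
  -- derivative in the fibre
  have dξ : HasFDerivAt (fun η => coordSymbol b A ψ u η)
      (∑ i, ∑ j, (((A u)⁻¹ i j : ℝ) : ℂ) •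
        (ζ i • (Complex.ofRealCLM.comp (ContinuousLinearMap.proj j : (ι → ℝ) →L[ℝ] ℝ))
        + ζ j • (Complex.ofRealCLM.comp (ContinuousLinearMap.proj i : (ι → ℝ) →L[ℝ] ℝ)))) ξ := by
    unfold coordSymbol
    refine HasFDerivAt.fun_sum fun i _ => HasFDerivAt.fun_sum fun j _ => ?_
    have hl : ∀ i, HasFDerivAt (fun η : ι → ℝ => (η i : ℂ) + Complex.I * fderiv ℝ ψ u (b i))
        (Complex.ofRealCLM.comp (ContinuousLinearMap.proj i : (ι → ℝ) →L[ℝ] ℝ)) ξ := fun i =>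
      (Complex.ofRealCLM.comp
        (ContinuousLinearMap.proj i : (ι → ℝ) →L[ℝ] ℝ)).hasFDerivAt.add_const _
    have := ((hl i).mul (hl j)).const_mul (((A u)⁻¹ i j : ℝ) : ℂ)
    simp only [mul_assoc]
    exact this
  have dξ' : ∀ k, fderiv ℝ (fun η => coordSymbol b A ψ u η) ξ (Pi.single k 1) = 2 * Z k := by
    intro k
    rw [dξ.fderiv, hZ k]
    simp only [_root_.sum_apply, _root_.smul_apply,
      _root_.add_apply, ContinuousLinearMap.comp_apply, ContinuousLinearMap.proj_apply,
      Complex.ofRealCLM_apply, smul_eq_mul, Pi.single_apply]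
    simp only [mul_add, Finset.sum_add_distrib]
    have h1 : ∑ x, ∑ y, (((A u)⁻¹ x y : ℝ) : ℂ) * (ζ x * ((if y = k then (1:ℝ) else 0 : ℝ) : ℂ))
        = ∑ x, (((A u)⁻¹ k x : ℝ) : ℂ) * ζ x := by
      refine Finset.sum_congr rfl fun x _ => ?_
      rw [Finset.sum_eq_single k (by intro y _ hy; simp [hy]) (by simp)]
      simp [hinvs x k]
    have h2 : ∑ x, ∑ y, (((A u)⁻¹ x y : ℝ) : ℂ) * (ζ y * ((if x = k then (1:ℝ) else 0 : ℝ) : ℂ))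
        = ∑ x, (((A u)⁻¹ k x : ℝ) : ℂ) * ζ x := by
      rw [Finset.sum_eq_single k (by intro y _ hy; simp [hy]) (by simp)]
      simp
    rw [h1, h2]
    simp only [hζ, mul_add, Finset.sum_add_distrib]
    ring
  -- derivative in the base
  have du : HasFDerivAt (fun y => coordSymbol b A ψ y ξ)
      (∑ i, ∑ j, ((((A u)⁻¹ i j : ℝ) : ℂ) • (ζ i • (Complex.I •
          (Complex.ofRealCLM.comp (fderiv ℝ (fun y => fderiv ℝ ψ y (b j)) u))))
        + ζ j • ((((A u)⁻¹ i j : ℝ) : ℂ) • (Complex.I •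
          (Complex.ofRealCLM.comp (fderiv ℝ (fun y => fderiv ℝ ψ y (b i)) u)))
        + ζ i • (Complex.ofRealCLM.comp (fderiv ℝ (fun y => (A y)⁻¹ i j) u))))) u := by
    unfold coordSymbol
    refine HasFDerivAt.fun_sum fun i _ => HasFDerivAt.fun_sum fun j _ => ?_
    have hl : ∀ i, HasFDerivAt (fun y => (ξ i : ℂ) + Complex.I * (fderiv ℝ ψ y (b i) : ℂ))
        (Complex.I • (Complex.ofRealCLM.comp (fderiv ℝ (fun y => fderiv ℝ ψ y (b i)) u))) u :=
      fun i => ((Complex.ofRealCLM.hasFDerivAt.comp u (hψ i).hasFDerivAt).const_mul _).const_add _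
    have h0 : HasFDerivAt (fun y => (((A y)⁻¹ i j : ℝ) : ℂ))
        (Complex.ofRealCLM.comp (fderiv ℝ (fun y => (A y)⁻¹ i j) u)) u :=
      Complex.ofRealCLM.hasFDerivAt.comp u (hI i j).hasFDerivAt
    have h3 := (h0.fun_mul (hl i)).fun_mul (hl j)
    refine h3.congr_fderiv ?_
    rw [mul_smul]
  have du' : ∀ k, fderiv ℝ (fun y => coordSymbol b A ψ y ξ) u (b k) = P k := by
    intro k
    rw [du.fderiv]
    simp only [_root_.sum_apply, _root_.smul_apply,
      _root_.add_apply, ContinuousLinearMap.comp_apply,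
      Complex.ofRealCLM_apply, smul_eq_mul, fderiv_matrix_inv hA hdet]
    have hZ' : ∀ i, Z i = ∑ j, (((A u)⁻¹ i j : ℝ) : ℂ) * ζ j := hZ
    set Q : ι → ℂ := fun j => (fderiv ℝ (fun y => fderiv ℝ ψ y (b j)) u (b k) : ℂ) with hQ
    set D : ι → ι → ℂ := fun i j => (fderiv ℝ (fun y => A y i j) u (b k) : ℂ) with hD
    set B : ι → ι → ℂ := fun i j => (((A u)⁻¹ i j : ℝ) : ℂ) with hB
    have e1 : ∀ i j, B i j = B j i := fun i j => by simp only [hB, hinvs i j]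
    have e2 : ∑ i, ∑ j, B i j * (ζ i * (Complex.I * Q j)) = Complex.I * ∑ j, Z j * Q j := by
      rw [Finset.sum_comm]
      simp only [hZ', Finset.sum_mul, Finset.mul_sum]
      refine Finset.sum_congr rfl fun i _ => Finset.sum_congr rfl fun j _ => ?_
      rw [e1 j i]; simp only [hB]; ring
    have e3 : ∑ i, ∑ j, ζ j * (B i j * (Complex.I * Q i)) = Complex.I * ∑ j, Z j * Q j := by
      simp only [hZ', Finset.sum_mul, Finset.mul_sum]
      refine Finset.sum_congr rfl fun i _ => Finset.sum_congr rfl fun j _ => ?_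
      simp only [hB]; ring
    have e4 : ∑ i, ∑ j, ζ j * (ζ i * ((-∑ k_1, ∑ l, (A u)⁻¹ i k_1 *
        fderiv ℝ (fun y => A y k_1 l) u (b k) * (A u)⁻¹ l j : ℝ) : ℂ)) =
        -∑ i, ∑ j, D i j * Z i * Z j := by
      have : ∀ i j, ((-∑ k_1, ∑ l, (A u)⁻¹ i k_1 *
        fderiv ℝ (fun y => A y k_1 l) u (b k) * (A u)⁻¹ l j : ℝ) : ℂ) =
          - ∑ m, ∑ l, B i m * D m l * B l j := by
        intro i j; push_cast; rfl
      simp only [this]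
      simp only [hZ', Finset.mul_sum, Finset.sum_mul, mul_neg, Finset.sum_neg_distrib]
      congr 1
      have r1 : ∀ i, ∑ j, ∑ m, ∑ l, ζ j * (ζ i * (B i m * D m l * B l j)) =
          ∑ m, ∑ l, ∑ j, ζ j * (ζ i * (B i m * D m l * B l j)) := fun i => by
        rw [Finset.sum_comm]
        exact Finset.sum_congr rfl fun m _ => Finset.sum_comm
      simp only [r1]
      rw [Finset.sum_comm]
      refine Finset.sum_congr rfl fun m _ => ?_
      rw [Finset.sum_comm]
      refine Finset.sum_congr rfl fun l _ => ?_
      rw [Finset.sum_comm]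
      refine Finset.sum_congr rfl fun j _ => Finset.sum_congr rfl fun i _ => ?_
      rw [e1 i m]; ring
    simp only [mul_add, Finset.sum_add_distrib]
    rw [e2, e3, e4, hP k]
    ring
  have hcξ : ∀ k, fderiv ℝ (fun η => (starRingEnd ℂ) (coordSymbol b A ψ u η)) ξ (Pi.single k 1)
      = (starRingEnd ℂ) (2 * Z k) := fun k => by
    rw [← dξ' k, dξ.fderiv]
    have := (Complex.conjCLE.toContinuousLinearMap.hasFDerivAt.comp ξ dξ).fderiv
    exact congrArg (fun L => L (Pi.single k 1)) this
  have hcu : ∀ k, fderiv ℝ (fun y => (starRingEnd ℂ) (coordSymbol b A ψ y ξ)) u (b k)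
      = (starRingEnd ℂ) (P k) := fun k => by
    rw [← du' k, du.fderiv]
    have := (Complex.conjCLE.toContinuousLinearMap.hasFDerivAt.comp u du).fderiv
    exact congrArg (fun L => L (b k)) this
  -- Each summand has the form `w - conj w` with `w = 2 conj(Z_k) P_k`.
  unfold poissonBracket
  simp only [hcξ, hcu, dξ', du']
  rw [Complex.im_eq_sub_conj, map_sum, ← Finset.sum_sub_distrib, mul_div_assoc', eq_div_iff
    (by simp), Finset.sum_mul, Finset.mul_sum]
  refine Finset.sum_congr rfl fun k _ => ?_
  simp only [map_mul, Complex.conj_conj, Complex.conj_ofNat]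
  ring

end Bracket

end Carleman

namespace Carleman

/-! ### The weight `τ` of a metric `c (dτ² + G)` -/

section Product

variable {E ι : Type} [NormedAddCommGroup E] [NormedSpace ℝ E] [Fintype ι]

/-- Conjugation exchanges the two indices, so a real symmetric form is real on `(conj Z, Z)`. It is
applied to the matrices of second derivatives of `σ₀` and `σ₁`. -/
theorem im_sum_sum_conj_mul_eq_zero (Z : ι → ℂ) (S : ι → ι → ℝ) (hS : ∀ i j, S i j = S j i) :
    (∑ k, ∑ i, (starRingEnd ℂ) (Z k) * (S k i : ℂ) * Z i).im = 0 := by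
  rw [← Complex.conj_eq_iff_im, map_sum]
  simp only [map_sum, map_mul, Complex.conj_conj, Complex.conj_ofReal]
  rw [Finset.sum_comm]
  refine Finset.sum_congr rfl fun i _ => Finset.sum_congr rfl fun k _ => ?_
  rw [hS k i]; ring

variable [DecidableEq ι]

/-- Three covectors that make up a nondegenerate form on a three-dimensional space are linearly
independent, and the inner form is nondegenerate as well. -/
theorem inner_eq_of_product_form (hι : Fintype.card ι = 3) {A : Matrix ι ι ℝ} (hdet : A.det ≠ 0)
    {c g₀ g₁ g₂ : ℝ} {t s₀ s₁ : ι → ℝ}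
    (hA : ∀ i j, A i j = c * (t i * t j + g₀ * s₀ i * s₀ j + g₁ * (s₀ i * s₁ j + s₁ i * s₀ j)
      + g₂ * s₁ i * s₁ j)) {y : ι → ℝ} (hy : ∀ i, ∑ j, A i j * y j = t i) :
    c * ∑ j, t j * y j = 1 ∧ ∑ j, s₀ j * y j = 0 ∧ ∑ j, s₁ j * y j = 0 := by
  classical
  let e : ι ≃ Fin 3 := Fintype.equivFinOfCardEq hι
  let J : Matrix (Fin 3) (Fin 3) ℝ := Matrix.of ![t ∘ e.symm, s₀ ∘ e.symm, s₁ ∘ e.symm]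
  let N : Matrix (Fin 3) (Fin 3) ℝ := c • !![1, 0, 0; 0, g₀, g₁; 0, g₁, g₂]
  -- The rows of `J` are the three covectors and `N` is the form they are combined by. Since `A = Jᵀ
  -- N J` is invertible, so are `J` and `N`, and `A y = t` reduces to `N (J y) = (1, 0, 0)`.
  have hfac : A.submatrix e.symm e.symm = Jᵀ * (N * J) := by
    ext i j
    simp only [Matrix.submatrix_apply, hA, Matrix.mul_apply, Fin.sum_univ_three,
      Matrix.transpose_apply, J, N, Matrix.of_apply, Matrix.smul_apply, smul_eq_mul]
    simp
    ring
  have hd : (Jᵀ * (N * J)).det ≠ 0 := by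
    rw [← hfac, Matrix.det_submatrix_equiv_self]; exact hdet
  rw [Matrix.det_mul, Matrix.det_mul, Matrix.det_transpose] at hd
  have hJ : J.det ≠ 0 := fun h => hd (by rw [h]; ring)
  have hN : N.det ≠ 0 := fun h => hd (by rw [h]; ring)
  let z : Fin 3 → ℝ := y ∘ e.symm
  have h1 : Jᵀ *ᵥ (N *ᵥ (J *ᵥ z)) = Jᵀ *ᵥ ![1, 0, 0] := by
    rw [Matrix.mulVec_mulVec, Matrix.mulVec_mulVec, Matrix.mul_assoc, ← hfac]
    ext i
    have h2 := hy (e.symm i)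
    rw [← e.symm.sum_comp] at h2
    simpa [Matrix.mulVec, dotProduct, z, Fin.sum_univ_three, J] using h2
  have h2 : N *ᵥ (J *ᵥ z) = ![1, 0, 0] :=
    Matrix.mulVec_injective_of_isUnit
      ((Matrix.isUnit_iff_isUnit_det _).2 (by simpa using hJ)) h1
  have hsum : ∀ f : ι → ℝ, ∑ j, f j * y j = ∑ k, f (e.symm k) * z k := fun f => by
    rw [← e.symm.sum_comp]; rfl
  have hJz : J *ᵥ z = ![∑ j, t j * y j, ∑ j, s₀ j * y j, ∑ j, s₁ j * y j] := by
    simp only [hsum]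
    ext i
    fin_cases i <;> simp [Matrix.mulVec, dotProduct, J]
  rw [hJz] at h2
  set a := ∑ j, t j * y j
  set p := ∑ j, s₀ j * y j
  set q := ∑ j, s₁ j * y j
  have e0 := congrFun h2 0
  have e1 := congrFun h2 1
  have e2 := congrFun h2 2
  simp [N, Matrix.mulVec, dotProduct, Fin.sum_univ_three] at e0 e1 e2
  have hNd : N.det = c ^ 3 * (g₀ * g₂ - g₁ * g₁) := by
    simp [N, Matrix.det_fin_three]
    ring
  rw [hNd] at hN
  have hc : c ≠ 0 := fun h => hN (by rw [h]; ring)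
  have hg : g₀ * g₂ - g₁ * g₁ ≠ 0 := fun h => hN (by rw [h]; ring)
  refine ⟨e0, ?_, ?_⟩
  · have : c * (g₀ * g₂ - g₁ * g₁) * p = 0 := by linear_combination g₂ * e1 - g₁ * e2
    simpa [hc, hg] using this
  · have : c * (g₀ * g₂ - g₁ * g₁) * q = 0 := by linear_combination g₀ * e2 - g₁ * e1
    simpa [hc, hg] using this

/-- The function `τ` is a limiting Carleman weight for `c (dτ² + G)`, where `G` is a metric in the
two variables `σ₀, σ₁`. -/
theorem poissonBracket_eq_zero_of_product (hι : Fintype.card ι = 3) {b : Module.Basis ι ℝ E}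
    {A : E → Matrix ι ι ℝ} {u : E} (hdet : (A u).det ≠ 0) {τ σ₀ σ₁ c g₀ g₁ g₂ : E → ℝ}
    (hτ : ContDiffAt ℝ 2 τ u) (hσ₀ : ContDiffAt ℝ 2 σ₀ u) (hσ₁ : ContDiffAt ℝ 2 σ₁ u)
    (hc : DifferentiableAt ℝ c u) (hg₀ : DifferentiableAt ℝ g₀ u) (hg₁ : DifferentiableAt ℝ g₁ u)
    (hg₂ : DifferentiableAt ℝ g₂ u)
    (hA : ∀ᶠ y in nhds u, ∀ i j, A y i j = c y * (fderiv ℝ τ y (b i) * fderiv ℝ τ y (b j)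
      + g₀ y * fderiv ℝ σ₀ y (b i) * fderiv ℝ σ₀ y (b j)
      + g₁ y * (fderiv ℝ σ₀ y (b i) * fderiv ℝ σ₁ y (b j)
        + fderiv ℝ σ₁ y (b i) * fderiv ℝ σ₀ y (b j))
      + g₂ y * fderiv ℝ σ₁ y (b i) * fderiv ℝ σ₁ y (b j)))
    (hd₀ : ∃ a₀ a₁ : ℝ, ∀ v, fderiv ℝ g₀ u v = a₀ * fderiv ℝ σ₀ u v + a₁ * fderiv ℝ σ₁ u v)
    (hd₁ : ∃ a₀ a₁ : ℝ, ∀ v, fderiv ℝ g₁ u v = a₀ * fderiv ℝ σ₀ u v + a₁ * fderiv ℝ σ₁ u v)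
    (hd₂ : ∃ a₀ a₁ : ℝ, ∀ v, fderiv ℝ g₂ u v = a₀ * fderiv ℝ σ₀ u v + a₁ * fderiv ℝ σ₁ u v)
    {ξ : ι → ℝ} (hξ : coordSymbol b A τ u ξ = 0) :
    poissonBracket b (fun y η => (starRingEnd ℂ) (coordSymbol b A τ y η)) (coordSymbol b A τ) u ξ
      = 0 := by
  have hdf : ∀ {f : E → ℝ}, ContDiffAt ℝ 2 f u → DifferentiableAt ℝ (fderiv ℝ f) u := fun hf =>
    (hf.fderiv_right (m := 1) (by norm_num)).differentiableAt (by norm_num)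
  have hD : ∀ {f : E → ℝ}, ContDiffAt ℝ 2 f u →
      ∀ i, DifferentiableAt ℝ (fun y => fderiv ℝ f y (b i)) u := fun hf i =>
    (hdf hf).clm_apply (differentiableAt_const _)
  have hsymmD : ∀ {f : E → ℝ}, ContDiffAt ℝ 2 f u → ∀ i j,
      fderiv ℝ (fun y => fderiv ℝ f y (b j)) u (b i) =
        fderiv ℝ (fun y => fderiv ℝ f y (b i)) u (b j) := by
    intro f hf i j
    have h1 : ∀ k, fderiv ℝ (fun y => fderiv ℝ f y (b k)) u =
        (ContinuousLinearMap.apply ℝ ℝ (b k)).comp (fderiv ℝ (fderiv ℝ f) u) := fun k =>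
      ((ContinuousLinearMap.apply ℝ ℝ (b k)).hasFDerivAt.comp u (hdf hf).hasFDerivAt).fderiv
    rw [h1, h1]
    exact hf.isSymmSndFDerivAt (by simp) (b i) (b j)
  have hA0 := hA.self_of_nhds
  have dA : ∀ i j, HasFDerivAt (fun y => A y i j) _ u := fun i j =>
    (hc.hasFDerivAt.fun_mul ((((hD hτ i).hasFDerivAt.fun_mul (hD hτ j).hasFDerivAt).fun_add
      ((hg₀.hasFDerivAt.fun_mul (hD hσ₀ i).hasFDerivAt).fun_mul (hD hσ₀ j).hasFDerivAt)).fun_add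
      (hg₁.hasFDerivAt.fun_mul (((hD hσ₀ i).hasFDerivAt.fun_mul (hD hσ₁ j).hasFDerivAt).fun_add
        ((hD hσ₁ i).hasFDerivAt.fun_mul (hD hσ₀ j).hasFDerivAt)))|>.fun_add
      ((hg₂.hasFDerivAt.fun_mul (hD hσ₁ i).hasFDerivAt).fun_mul
        (hD hσ₁ j).hasFDerivAt))).congr_of_eventuallyEq (by
          filter_upwards [hA] with y hy using hy i j)
  have hsymm : (A u).IsSymm := by
    ext i j; simp only [Matrix.transpose_apply, hA0]; ring
  set Z : ι → ℂ := fun i => ∑ j, (((A u)⁻¹ i j : ℝ) : ℂ) *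
    ((ξ j : ℂ) + Complex.I * fderiv ℝ τ u (b j)) with hZ
  rw [poissonBracket_coordSymbol (fun i j => (dA i j).differentiableAt) hsymm hdet (hD hτ) ξ Z _
    (fun _ => rfl) (fun _ => rfl)]
  set t : ι → ℝ := fun i => fderiv ℝ τ u (b i) with ht
  set s₀ : ι → ℝ := fun i => fderiv ℝ σ₀ u (b i) with hs₀
  set s₁ : ι → ℝ := fun i => fderiv ℝ σ₁ u (b i) with hs₁
  have hAZ : ∀ i, ∑ j, (A u i j : ℂ) * Z j = (ξ i : ℂ) + Complex.I * t i := by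
    intro i
    have h1 : ∀ j, ∑ k, (A u i k : ℂ) * (((A u)⁻¹ k j : ℝ) : ℂ) = (1 : Matrix ι ι ℂ) i j := by
      intro j
      have := congrFun (congrFun (Matrix.mul_nonsing_inv (A u) (isUnit_iff_ne_zero.2 hdet)) i) j
      rw [Matrix.mul_apply] at this
      rw [show (1 : Matrix ι ι ℂ) i j = (((1 : Matrix ι ι ℝ) i j : ℝ) : ℂ) by
        simp only [Matrix.one_apply]; split_ifs <;> simp, ← this]
      push_cast; rfl
    simp only [hZ, Finset.mul_sum]
    rw [Finset.sum_comm]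
    simp only [← mul_assoc, ← Finset.sum_mul, h1, Matrix.one_apply]
    simp [ht]
  -- The imaginary part of `Z` is the gradient of `τ`: it is annihilated by `dσ₀` and `dσ₁`, and
  -- `dτ` takes the value `1 / c` on it.
  have him : ∀ i, ∑ j, A u i j * (Z j).im = t i := fun i => by
    have := congrArg Complex.im (hAZ i)
    simpa [Complex.im_sum] using this
  obtain ⟨k0, k1, k2⟩ := inner_eq_of_product_form hι hdet
    (t := t) (s₀ := s₀) (s₁ := s₁) (fun i j => hA0 i j) him
  set W : ℂ := ∑ j, (t j : ℂ) * Z j with hW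
  set w₀ : ℂ := ∑ j, (s₀ j : ℂ) * Z j with hw₀
  set w₁ : ℂ := ∑ j, (s₁ j : ℂ) * Z j with hw₁
  have imW : c u * W.im = 1 := by rw [← k0, hW, Complex.im_sum]; simp
  have im0 : w₀.im = 0 := by rw [← k1, hw₀, Complex.im_sum]; simp
  have im1 : w₁.im = 0 := by rw [← k2, hw₁, Complex.im_sum]; simp
  have hζ : ∀ i, (ξ i : ℂ) + Complex.I * t i = c u * (t i * W + g₀ u * s₀ i * w₀
      + g₁ u * (s₀ i * w₁ + s₁ i * w₀) + g₂ u * s₁ i * w₁) := by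
    intro i
    rw [← hAZ i]
    simp only [hA0, hW, hw₀, hw₁]
    push_cast
    simp only [Finset.mul_sum, ← Finset.sum_add_distrib]
    refine Finset.sum_congr rfl fun j _ => ?_
    simp only [ht, hs₀, hs₁]
    ring
  have hp : (c u : ℂ) * (W * W + g₀ u * w₀ * w₀ + 2 * g₁ u * w₀ * w₁ + g₂ u * w₁ * w₁) = 0 := by
    have h1 : ∑ i, ((ξ i : ℂ) + Complex.I * t i) * Z i = 0 := by
      rw [← hξ]
      unfold coordSymbol
      refine Finset.sum_congr rfl fun i _ => ?_
      simp only [hZ, Finset.mul_sum, ht]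
      refine Finset.sum_congr rfl fun j _ => ?_
      ring
    rw [← h1]
    simp only [hζ]
    have : ∀ i, (c u : ℂ) * (t i * W + g₀ u * s₀ i * w₀
      + g₁ u * (s₀ i * w₁ + s₁ i * w₀) + g₂ u * s₁ i * w₁) * Z i =
      c u * W * (t i * Z i) + c u * (g₀ u * w₀ + g₁ u * w₁) * (s₀ i * Z i)
        + c u * (g₁ u * w₀ + g₂ u * w₁) * (s₁ i * Z i) := fun i => by ring
    simp only [this, Finset.sum_add_distrib, ← Finset.mul_sum]
    rw [← hW, ← hw₀, ← hw₁]
    ring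
  have hc0 : c u ≠ 0 := fun h => by simp [h] at imW
  -- As `w₀` and `w₁` are real, the imaginary part of the equation `p = 0` is `2 Re W Im W = 0`, and
  -- `Im W = 1 / c` does not vanish.
  have hreW : W.re = 0 := by
    have h1 := (mul_eq_zero.1 hp).resolve_left (by exact_mod_cast hc0)
    have h2 := congrArg Complex.im h1
    simp [im0, im1] at h2
    have h3 : W.im ≠ 0 := fun h => by simp [h] at imW
    have h4 : W.re * W.im = 0 := by linarith
    exact (mul_eq_zero.1 h4).resolve_right h3
  have hWI : (c u : ℂ) * W = Complex.I := by
    apply Complex.ext <;> simp [hreW, imW]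
  have hw₀r : w₀ = (w₀.re : ℂ) := by apply Complex.ext <;> simp [im0]
  have hw₁r : w₁ = (w₁.re : ℂ) := by apply Complex.ext <;> simp [im1]
  set r₀ := w₀.re
  set r₁ := w₁.re
  obtain ⟨a₀, a₀', ha₀⟩ := hd₀
  obtain ⟨a₁, a₁', ha₁⟩ := hd₁
  obtain ⟨a₂, a₂', ha₂⟩ := hd₂
  set T : ι → ι → ℝ := fun k i => fderiv ℝ (fun y => fderiv ℝ τ y (b i)) u (b k) with hT
  set S₀ : ι → ι → ℝ := fun k i => fderiv ℝ (fun y => fderiv ℝ σ₀ y (b i)) u (b k) with hS₀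
  set S₁ : ι → ι → ℝ := fun k i => fderiv ℝ (fun y => fderiv ℝ σ₁ y (b i)) u (b k) with hS₁
  -- Two cancellations on the zero set: the derivative of `c` multiplies the symbol and disappears,
  -- and the second derivatives of `τ` coming from `∂A` carry the factor `2 c W = 2 i`, which
  -- offsets those coming from the weight. The coefficients that remain are real.
  have hPk : ∀ k, -(∑ i, ∑ j, (fderiv ℝ (fun y => A y i j) u (b k) : ℂ) * Z i * Z j)
      + 2 * Complex.I * ∑ j, Z j * (fderiv ℝ (fun y => fderiv ℝ τ y (b j)) u (b k) : ℂ) =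
      -(c u : ℂ) * ((a₀ * r₀ * r₀ + 2 * a₁ * r₀ * r₁ + a₂ * r₁ * r₁ : ℝ) * s₀ k
        + (a₀' * r₀ * r₀ + 2 * a₁' * r₀ * r₁ + a₂' * r₁ * r₁ : ℝ) * s₁ k
        + 2 * (g₀ u * r₀ + g₁ u * r₁ : ℝ) * ∑ i, (S₀ k i : ℂ) * Z i
        + 2 * (g₁ u * r₀ + g₂ u * r₁ : ℝ) * ∑ i, (S₁ k i : ℂ) * Z i) := by
    intro k
    have hdA : ∀ i j, fderiv ℝ (fun y => A y i j) u (b k) =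
        fderiv ℝ c u (b k) * (t i * t j + g₀ u * s₀ i * s₀ j + g₁ u * (s₀ i * s₁ j + s₁ i * s₀ j)
          + g₂ u * s₁ i * s₁ j)
        + c u * (T k i * t j + t i * T k j + fderiv ℝ g₀ u (b k) * s₀ i * s₀ j
          + fderiv ℝ g₁ u (b k) * (s₀ i * s₁ j + s₁ i * s₀ j) + fderiv ℝ g₂ u (b k) * s₁ i * s₁ j
          + g₀ u * (S₀ k i * s₀ j + s₀ i * S₀ k j)
          + g₁ u * (S₀ k i * s₁ j + s₀ i * S₁ k j + S₁ k i * s₀ j + s₁ i * S₀ k j)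
          + g₂ u * (S₁ k i * s₁ j + s₁ i * S₁ k j)) := by
      intro i j
      rw [(dA i j).fderiv]
      simp only [_root_.add_apply, _root_.smul_apply, smul_eq_mul, hT, hS₀, hS₁, ht, hs₀, hs₁]
      ring
    set t' : ℂ := ∑ i, (T k i : ℂ) * Z i with ht'
    set s₀' : ℂ := ∑ i, (S₀ k i : ℂ) * Z i with hs₀'
    set s₁' : ℂ := ∑ i, (S₁ k i : ℂ) * Z i with hs₁'
    have hsum : ∑ i, ∑ j, (fderiv ℝ (fun y => A y i j) u (b k) : ℂ) * Z i * Z j =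
        fderiv ℝ c u (b k) * (W * W + g₀ u * w₀ * w₀ + 2 * g₁ u * w₀ * w₁ + g₂ u * w₁ * w₁)
        + c u * (2 * t' * W + fderiv ℝ g₀ u (b k) * w₀ * w₀ + 2 * fderiv ℝ g₁ u (b k) * w₀ * w₁
          + fderiv ℝ g₂ u (b k) * w₁ * w₁ + 2 * g₀ u * s₀' * w₀ + 2 * g₁ u * (s₀' * w₁ + s₁' * w₀)
          + 2 * g₂ u * s₁' * w₁) := by
      have h1 : ∀ i j, (fderiv ℝ (fun y => A y i j) u (b k) : ℂ) * Z i * Z j =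
        fderiv ℝ c u (b k) * ((t i * Z i) * (t j * Z j)) +
        (fderiv ℝ c u (b k) * g₀ u + c u * fderiv ℝ g₀ u (b k)) * ((s₀ i * Z i) * (s₀ j * Z j)) +
        (fderiv ℝ c u (b k) * g₁ u + c u * fderiv ℝ g₁ u (b k)) * ((s₀ i * Z i) * (s₁ j * Z j)) +
        (fderiv ℝ c u (b k) * g₁ u + c u * fderiv ℝ g₁ u (b k)) * ((s₁ i * Z i) * (s₀ j * Z j)) +
        (fderiv ℝ c u (b k) * g₂ u + c u * fderiv ℝ g₂ u (b k)) * ((s₁ i * Z i) * (s₁ j * Z j)) +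
        c u * ((T k i * Z i) * (t j * Z j)) + c u * ((t i * Z i) * (T k j * Z j)) +
        c u * g₀ u * ((S₀ k i * Z i) * (s₀ j * Z j)) +
        c u * g₀ u * ((s₀ i * Z i) * (S₀ k j * Z j)) +
        c u * g₁ u * ((S₀ k i * Z i) * (s₁ j * Z j)) +
        c u * g₁ u * ((s₀ i * Z i) * (S₁ k j * Z j)) +
        c u * g₁ u * ((S₁ k i * Z i) * (s₀ j * Z j)) +
        c u * g₁ u * ((s₁ i * Z i) * (S₀ k j * Z j)) +
        c u * g₂ u * ((S₁ k i * Z i) * (s₁ j * Z j)) +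
        c u * g₂ u * ((s₁ i * Z i) * (S₁ k j * Z j)) := by
        intro i j
        rw [hdA]; push_cast; ring
      simp only [h1, Finset.sum_add_distrib, ← Finset.mul_sum, ← Finset.sum_mul]
      rw [← hW, ← hw₀, ← hw₁, ← ht', ← hs₀', ← hs₁']
      ring
    have ht'' : ∑ j, Z j * (fderiv ℝ (fun y => fderiv ℝ τ y (b j)) u (b k) : ℂ) = t' := by
      rw [ht']; exact Finset.sum_congr rfl fun j _ => mul_comm _ _
    have hp' := (mul_eq_zero.1 hp).resolve_left (by exact_mod_cast hc0)
    rw [hsum, ht'', hp', ha₀, ha₁, ha₂, hw₀r, hw₁r, ← hWI]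
    push_cast
    simp only [hs₀, hs₁]
    ring
  simp only [hPk]
  have hconj : ∀ f : ι → ℝ, ∑ k, (starRingEnd ℂ) (Z k) * (f k : ℂ) =
      (starRingEnd ℂ) (∑ k, (f k : ℂ) * Z k) := fun f => by
    rw [map_sum]; refine Finset.sum_congr rfl fun k _ => ?_
    simp [mul_comm]
  -- Second derivatives are symmetric, so their contractions with `conj Z` and `Z` are real; with
  -- `w₀` and `w₁` real, the whole sum is real.
  have hreal : ∀ S : ι → ι → ℝ, (∀ i j, S i j = S j i) →
      ∃ r : ℝ, ∑ k, (starRingEnd ℂ) (Z k) * ∑ i, (S k i : ℂ) * Z i = r := by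
    intro S hS
    refine ⟨(∑ k, (starRingEnd ℂ) (Z k) * ∑ i, (S k i : ℂ) * Z i).re, ?_⟩
    apply Complex.ext
    · simp
    · rw [Complex.ofReal_im, ← im_sum_sum_conj_mul_eq_zero Z S hS]
      simp only [Finset.mul_sum, mul_assoc]
  obtain ⟨q₀, hq₀⟩ := hreal S₀ (fun i j => hsymmD hσ₀ i j)
  obtain ⟨q₁, hq₁⟩ := hreal S₁ (fun i j => hsymmD hσ₁ i j)
  set m₀ := a₀ * r₀ * r₀ + 2 * a₁ * r₀ * r₁ + a₂ * r₁ * r₁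
  set m₁ := a₀' * r₀ * r₀ + 2 * a₁' * r₀ * r₁ + a₂' * r₁ * r₁
  set n₀ := g₀ u * r₀ + g₁ u * r₁
  set n₁ := g₁ u * r₀ + g₂ u * r₁
  have hfin : ∑ k, (starRingEnd ℂ) (Z k) * (-(c u : ℂ) * ((m₀ : ℂ) * s₀ k + (m₁ : ℂ) * s₁ k
        + 2 * (n₀ : ℂ) * ∑ i, (S₀ k i : ℂ) * Z i + 2 * (n₁ : ℂ) * ∑ i, (S₁ k i : ℂ) * Z i)) =
      ((-(c u) * (m₀ * r₀ + m₁ * r₁ + 2 * n₀ * q₀ + 2 * n₁ * q₁) : ℝ) : ℂ) := by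
    have h1 : ∀ k, (starRingEnd ℂ) (Z k) * (-(c u : ℂ) * ((m₀ : ℂ) * s₀ k + (m₁ : ℂ) * s₁ k
        + 2 * (n₀ : ℂ) * ∑ i, (S₀ k i : ℂ) * Z i + 2 * (n₁ : ℂ) * ∑ i, (S₁ k i : ℂ) * Z i)) =
        -(c u : ℂ) * m₀ * ((starRingEnd ℂ) (Z k) * s₀ k)
        + -(c u : ℂ) * m₁ * ((starRingEnd ℂ) (Z k) * s₁ k)
        + -(c u : ℂ) * (2 * n₀) * ((starRingEnd ℂ) (Z k) * ∑ i, (S₀ k i : ℂ) * Z i)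
        + -(c u : ℂ) * (2 * n₁) * ((starRingEnd ℂ) (Z k) * ∑ i, (S₁ k i : ℂ) * Z i) :=
      fun k => by ring
    simp only [h1, Finset.sum_add_distrib, ← Finset.mul_sum, hconj, hq₀, hq₁]
    rw [← hw₀, ← hw₁, hw₀r, hw₁r]
    simp only [Complex.conj_ofReal]
    push_cast
    ring
  rw [hfin, Complex.ofReal_im]
  simp

end Product

end Carleman

namespace Carleman

/-! ### From local admissibility to limiting Carleman weights -/

section Charts

variable {E H M ι : Type} [NormedAddCommGroup E] [NormedSpace ℝ E] [TopologicalSpace H]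
  [TopologicalSpace M] [ChartedSpace H M] [Fintype ι] [DecidableEq ι]

/-- The weight is `τ`. The absence of null vectors is used twice. If `dτ` vanished at a point, a
nonzero vector in the kernel of `dσ`, which exists as `3 > 2`, would be null. And a vector in the
kernel of the Gram matrix of a chart would give a null tangent vector, so that matrix is invertible.
-/
theorem LocallyAdmissible.locallyAdmitsLCW {b : Module.Basis ι ℝ E} (hι : Fintype.card ι = 3)
    {I : ModelWithCorners ℝ E H} [I.Boundaryless] [IsManifold I ∞ M] {g : MetricField I M}
    (hpos : ∀ (x : M) (v : TangentSpace I x), v ≠ 0 → g x v v ≠ 0) (hg : LocallyAdmissible I g) :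
    LocallyAdmitsLCW b I g := by
  intro p₀
  obtain ⟨U, hUo, hpU, G, τ, σ, c, hG, hτ, hσ, hc, hmaps, -, hcpos, hform⟩ := hg p₀
  obtain ⟨W, hWo, hBW, hGs, hGpos⟩ := hG.metric
  have hGsymm : ∀ y ∈ ball (0 : R 2) 1, G y 0 1 = G y 1 0 := fun y hy => by
    simpa using (hGpos y (hBW (ball_subset_closedBall hy))).1.apply 1 0
  have hform' : ∀ x ∈ U, ∀ v w : TangentSpace I x,
        g x v w =
          c x * ((show ℝ from mfderiv I 𝓘(ℝ, ℝ) τ x v) * (show ℝ from mfderiv I 𝓘(ℝ, ℝ) τ x w)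
            + G (σ x) 0 0 * (show R 2 from mfderiv I (𝓡 2) σ x v) 0
                * (show R 2 from mfderiv I (𝓡 2) σ x w) 0
            + G (σ x) 0 1 * ((show R 2 from mfderiv I (𝓡 2) σ x v) 0
                * (show R 2 from mfderiv I (𝓡 2) σ x w) 1
                + (show R 2 from mfderiv I (𝓡 2) σ x v) 1
                * (show R 2 from mfderiv I (𝓡 2) σ x w) 0)
            + G (σ x) 1 1 * (show R 2 from mfderiv I (𝓡 2) σ x v) 1
                * (show R 2 from mfderiv I (𝓡 2) σ x w) 1) := by
    intro x hx v w
    rw [hform x hx]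
    simp only [Fin.sum_univ_two]
    rw [← hGsymm _ (hmaps hx)]
    ring
  refine ⟨U, hUo, hpU, τ, ⟨hτ, ?_, ?_⟩⟩
  · intro p hp h0
    have key : ∀ v : TangentSpace I p, (show R 2 from mfderiv I (𝓡 2) σ p v) = 0 → g p v v = 0 := by
      intro v hv
      have h0' : (show ℝ from mfderiv I 𝓘(ℝ, ℝ) τ p v) = 0 := by rw [h0]; rfl
      rw [hform p hp, h0', hv]
      simp
    have := b.finiteDimensional_of_finite
    have hlt : Module.finrank ℝ (R 2) < Module.finrank ℝ E := by
      rw [Module.finrank_eq_card_basis b, hι]; simp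
    obtain ⟨v, hv, hv0⟩ := (Submodule.ne_bot_iff _).1 (LinearMap.ker_ne_bot_of_finrank_lt
      (f := ((show E →L[ℝ] R 2 from mfderiv I (𝓡 2) σ p) : E →ₗ[ℝ] R 2)) hlt)
    exact hpos p v hv0 (key v hv)
  · intro p hp ξ hξ
    set e := extChartAt I p with he
    set u := e p with hu
    have hep : e.symm u = p := extChartAt_to_inv p
    have htgt : e.target ∈ nhds u := extChartAt_target_mem_nhds p
    have hsymm : ContMDiffOn 𝓘(ℝ, E) I ∞ e.symm e.target := contMDiffOn_extChartAt_symm p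
    have hsymmAt : ∀ y ∈ e.target, ContMDiffAt 𝓘(ℝ, E) I ∞ e.symm y := fun y hy =>
      hsymm.contMDiffAt (extChartAt_target_mem_nhds' hy)
    have hev : ∀ᶠ y in nhds u, y ∈ e.target ∧ e.symm y ∈ U := by
      refine Filter.Eventually.and htgt ?_
      refine (hsymmAt u (mem_extChartAt_target p)).continuousAt.eventually_mem ?_
      rw [hep]; exact hUo.mem_nhds hp
    have cd : ∀ {F : Type} [NormedAddCommGroup F] [NormedSpace ℝ F] {f : M → F},
        ContMDiffOn I 𝓘(ℝ, F) ∞ f U → ∀ y, y ∈ e.target ∧ e.symm y ∈ U →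
          ContDiffAt ℝ ∞ (f ∘ e.symm) y := by
      intro F _ _ f hf y hy
      rw [← contMDiffAt_iff_contDiffAt]
      exact ContMDiffAt.comp y (I' := I) (hf.contMDiffAt (hUo.mem_nhds hy.2)) (hsymmAt y hy.1)
    have chain : ∀ {F : Type} [NormedAddCommGroup F] [NormedSpace ℝ F] {f : M → F},
        ContMDiffOn I 𝓘(ℝ, F) ∞ f U → ∀ y, y ∈ e.target ∧ e.symm y ∈ U → ∀ v : E,
        (show F from mfderiv I 𝓘(ℝ, F) f (e.symm y) (mfderiv 𝓘(ℝ, E) I e.symm y v)) =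
          fderiv ℝ (f ∘ e.symm) y v := by
      intro F _ _ f hf y hy v
      have h1 := mfderiv_comp y (I := 𝓘(ℝ, E)) (I' := I) (I'' := 𝓘(ℝ, F)) (g := f) (f := e.symm)
        ((hf.contMDiffAt (hUo.mem_nhds hy.2)).mdifferentiableAt (by simp))
        ((hsymmAt y hy.1).mdifferentiableAt (by simp))
      rw [mfderiv_eq_fderiv] at h1
      rw [h1]
      rfl
    have hu2 := hev.self_of_nhds
    have hdσ : ∀ y, y ∈ e.target ∧ e.symm y ∈ U → ∀ (k : Fin 2),
        HasFDerivAt (fun y => (σ (e.symm y)) k)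
          ((EuclideanSpace.proj k).comp (fderiv ℝ (σ ∘ e.symm) y)) y := fun y hy k =>
      (EuclideanSpace.proj k : R 2 →L[ℝ] ℝ).hasFDerivAt.comp y
        ((cd hσ y hy).differentiableAt (by simp)).hasFDerivAt
    have hdσ' : ∀ y, y ∈ e.target ∧ e.symm y ∈ U → ∀ (k : Fin 2) (v : E),
        (show R 2 from mfderiv I (𝓡 2) σ (e.symm y) (mfderiv 𝓘(ℝ, E) I e.symm y v)) k =
          fderiv ℝ (fun y => (σ (e.symm y)) k) y v := by
      intro y hy k v
      rw [(hdσ y hy k).fderiv, chain hσ y hy v]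
      rfl
    have hσk : ∀ k, ContDiffAt ℝ 2 (fun y => (σ (e.symm y)) k) u := fun k =>
      ((EuclideanSpace.proj k : R 2 →L[ℝ] ℝ).contDiff.contDiffAt.comp u
        (cd hσ u hu2)).of_le (WithTop.coe_le_coe.2 le_top)
    have hGd : ∀ i j, DifferentiableAt ℝ (fun x => G x i j) (σ (e.symm u)) := fun i j =>
      ((hGs i j).contDiffAt (hWo.mem_nhds (hBW (ball_subset_closedBall (hmaps hu2.2))))).differentiableAt
        (by simp)
    have hgd : ∀ i j, HasFDerivAt (fun y => G (σ (e.symm y)) i j)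
        ((fderiv ℝ (fun x => G x i j) (σ (e.symm u))).comp (fderiv ℝ (σ ∘ e.symm) u)) u :=
      fun i j => HasFDerivAt.comp (g := fun x => G x i j) (f := σ ∘ e.symm) u
        (hGd i j).hasFDerivAt ((cd hσ u hu2).differentiableAt (by simp)).hasFDerivAt
    -- By the chain rule the coefficients of `G ∘ σ` have differentials in the span of `dσ₀` and
    -- `dσ₁`; here the independence of the inner metric from `τ` enters.
    have hga : ∀ i j, ∃ a₀ a₁ : ℝ, ∀ v, fderiv ℝ (fun y => G (σ (e.symm y)) i j) u v =
        a₀ * fderiv ℝ (fun y => (σ (e.symm y)) 0) u v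
          + a₁ * fderiv ℝ (fun y => (σ (e.symm y)) 1) u v := by
      intro i j
      refine ⟨fderiv ℝ (fun x => G x i j) (σ (e.symm u)) (Carleman.e 0),
        fderiv ℝ (fun x => G x i j) (σ (e.symm u)) (Carleman.e 1), fun v => ?_⟩
      rw [(hgd i j).fderiv, (hdσ u hu2 0).fderiv, (hdσ u hu2 1).fderiv]
      have h1 : fderiv ℝ (σ ∘ e.symm) u v = (fderiv ℝ (σ ∘ e.symm) u v) 0 • Carleman.e 0
          + (fderiv ℝ (σ ∘ e.symm) u v) 1 • Carleman.e 1 := by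
        ext k; fin_cases k <;> simp [Carleman.e]
      simp only [ContinuousLinearMap.comp_apply]
      conv_lhs => rw [h1]
      rw [map_add, map_smul, map_smul]
      exact congrArg₂ (· + ·) (mul_comm _ _) (mul_comm _ _)
    have hA : ∀ y, y ∈ e.target ∧ e.symm y ∈ U → ∀ v w : E,
        g (e.symm y) (mfderiv 𝓘(ℝ, E) I e.symm y v) (mfderiv 𝓘(ℝ, E) I e.symm y w) =
        (c ∘ e.symm) y * (fderiv ℝ (τ ∘ e.symm) y v * fderiv ℝ (τ ∘ e.symm) y w
        + G (σ (e.symm y)) 0 0 * fderiv ℝ (fun y => (σ (e.symm y)) 0) y v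
          * fderiv ℝ (fun y => (σ (e.symm y)) 0) y w
        + G (σ (e.symm y)) 0 1 * (fderiv ℝ (fun y => (σ (e.symm y)) 0) y v
          * fderiv ℝ (fun y => (σ (e.symm y)) 1) y w
          + fderiv ℝ (fun y => (σ (e.symm y)) 1) y v
            * fderiv ℝ (fun y => (σ (e.symm y)) 0) y w)
        + G (σ (e.symm y)) 1 1 * fderiv ℝ (fun y => (σ (e.symm y)) 1) y v
          * fderiv ℝ (fun y => (σ (e.symm y)) 1) y w) := by
      intro y hy v w
      rw [hform' _ hy.2, hdσ' y hy 0, hdσ' y hy 1, hdσ' y hy 0, hdσ' y hy 1, chain hτ y hy,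
        chain hτ y hy]
      rfl
    have hdet : (chartGram b I g p u).det ≠ 0 := by
      intro h0
      obtain ⟨v, hv0, hv⟩ := Matrix.exists_mulVec_eq_zero_iff.2 h0
      have hinv : (mfderiv 𝓘(ℝ, E) I e.symm u).IsInvertible := by
        have := isInvertible_mfderivWithin_extChartAt_symm (I := I) (x := p) hu2.1
        rwa [I.range_eq_univ, mfderivWithin_univ] at this
      set w : E := ∑ i, v i • b i with hw
      have hw0 : w ≠ 0 := by
        intro h
        apply hv0
        have := (Fintype.linearIndependent_iff.1 b.linearIndependent) v h
        exact funext this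
      refine hpos (e.symm u) (mfderiv 𝓘(ℝ, E) I e.symm u w) ?_ ?_
      · intro h
        apply hw0
        apply hinv.injective
        rw [h]; exact (map_zero _).symm
      · have h1 : ∑ i, v i * ∑ j, chartGram b I g p u i j * v j = 0 :=
          Finset.sum_eq_zero fun i _ => by
            have : ∑ j, chartGram b I g p u i j * v j = 0 := congrFun hv i
            rw [this, mul_zero]
        rw [← h1, hA u hu2]
        have h2 : ∀ i j, chartGram b I g p u i j = _ := fun i j => hA u hu2 (b i) (b j)
        simp only [h2]
        set cu := (c ∘ e.symm) u
        set T := fderiv ℝ (τ ∘ e.symm) u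
        set S₀ := fderiv ℝ (fun y => (σ (e.symm y)) 0) u
        set S₁ := fderiv ℝ (fun y => (σ (e.symm y)) 1) u
        set G₀ := G (σ (e.symm u)) 0 0
        set G₁ := G (σ (e.symm u)) 0 1
        set G₂ := G (σ (e.symm u)) 1 1
        have hlin : ∀ L : E →L[ℝ] ℝ, L w = ∑ i, v i * L (b i) := fun L => by
          rw [hw, map_sum]; simp
        have hin : ∀ i, ∑ j, cu * (T (b i) * T (b j) + G₀ * S₀ (b i) * S₀ (b j)
            + G₁ * (S₀ (b i) * S₁ (b j) + S₁ (b i) * S₀ (b j)) + G₂ * S₁ (b i) * S₁ (b j)) * v j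
            = cu * (T (b i) * T w + G₀ * S₀ (b i) * S₀ w
            + G₁ * (S₀ (b i) * S₁ w + S₁ (b i) * S₀ w) + G₂ * S₁ (b i) * S₁ w) := fun i => by
          rw [hlin T, hlin S₀, hlin S₁]
          simp only [Finset.mul_sum, ← Finset.sum_add_distrib]
          exact Finset.sum_congr rfl fun j _ => by ring
        simp only [hin]
        have hout : ∀ i, v i * (cu * (T (b i) * T w + G₀ * S₀ (b i) * S₀ w
            + G₁ * (S₀ (b i) * S₁ w + S₁ (b i) * S₀ w) + G₂ * S₁ (b i) * S₁ w)) =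
            cu * T w * (v i * T (b i)) + cu * (G₀ * S₀ w + G₁ * S₁ w) * (v i * S₀ (b i))
              + cu * (G₁ * S₀ w + G₂ * S₁ w) * (v i * S₁ (b i)) := fun i => by ring
        simp only [hout, Finset.sum_add_distrib, ← Finset.mul_sum, ← hlin]
        ring
    rw [symbol_eq_coordSymbol] at hξ ⊢
    exact poissonBracket_eq_zero_of_product hι hdet
      ((cd hτ u hu2).of_le (WithTop.coe_le_coe.2 le_top)) (hσk 0) (hσk 1)
      ((cd hc u hu2).differentiableAt (by simp))
      (hgd 0 0).differentiableAt (hgd 0 1).differentiableAt (hgd 1 1).differentiableAt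
      (by filter_upwards [hev] with y hy i j using hA y hy (b i) (b j))
      (hga 0 0) (hga 0 1) (hga 1 1) hξ

end Charts

end Carleman

namespace Carleman

/-! ### The flat disc -/

section FlatDisc

theorem christoffel_const {n : ℕ} (A : Matrix (Fin n) (Fin n) ℝ) (k i j : Fin n) (x : R n) :
    christoffel (fun _ => A) k i j x = 0 := by
  simp [christoffel, pd]

theorem eq_of_hasDerivWithinAt_zero {F : Type} [NormedAddCommGroup F] [NormedSpace ℝ F]
    {f : ℝ → F} (hf : ∀ t ∈ Set.Icc (0 : ℝ) 1, HasDerivWithinAt f 0 (Set.Icc 0 1) t) :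
    ∀ t ∈ Set.Icc (0 : ℝ) 1, f t = f 0 :=
  constant_of_has_deriv_right_zero (fun t ht => (hf t ht).continuousWithinAt) fun t ht =>
    ((hf t ⟨ht.1, ht.2.le⟩).mono_of_mem_nhdsWithin
      (Icc_mem_nhdsGE_of_mem ⟨ht.1, ht.2⟩))

/-- With constant coefficients the Christoffel symbols vanish and geodesics are affine; by convexity
of the ball a segment stays inside as soon as its endpoints do. So `exp_x` is a translation and its
maximal domain is the translated ball. -/
theorem expEq_const_iff {n : ℕ} {A : Matrix (Fin n) (Fin n) ℝ} {x v y : R n}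
    (hx : x ∈ closedBall (0 : R n) 1) :
    ExpEq (fun _ => A) x v y ↔ y = x + v ∧ y ∈ closedBall (0 : R n) 1 := by
  constructor
  · rintro ⟨γ, w, h, h0, hw, h1⟩
    have hwc : ∀ t ∈ Set.Icc (0 : ℝ) 1, w t = v := by
      intro t ht
      ext k
      have := eq_of_hasDerivWithinAt_zero (f := fun s => w s k) (fun t ht => by
        simpa [christoffel_const] using h.geodesic t ht k) t ht
      rw [this, hw]
    have hγ : ∀ t ∈ Set.Icc (0 : ℝ) 1, γ t - t • v = γ 0 - (0 : ℝ) • v :=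
      eq_of_hasDerivWithinAt_zero (f := fun t => γ t - t • v) fun t ht => by
        have h2 := (h.velocity t ht).sub ((hasDerivWithinAt_id t (Set.Icc 0 1)).smul_const v)
        simp only [hwc t ht, one_smul, sub_self] at h2
        exact h2
    have h2 := hγ 1 (by simp)
    refine ⟨?_, h1 ▸ h.mem 1 (by simp)⟩
    rw [← h1, ← h0]
    simpa [sub_eq_iff_eq_add] using h2
  · rintro ⟨rfl, hy⟩
    refine ⟨fun t => x + t • v, fun _ => v, ⟨?_, ?_, ?_⟩, by simp, rfl, by simp⟩
    · intro t ht
      exact (convex_closedBall (0 : R n) 1).add_smul_mem hx hy ht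
    · intro t _
      simpa using ((hasDerivAt_id t).smul_const v).const_add x |>.hasDerivWithinAt
    · intro t _ k
      simpa [christoffel_const] using hasDerivWithinAt_const t (Set.Icc (0:ℝ) 1) (v k)

/-- The flat unit disc is simple. -/
theorem isSimpleDisc_one : IsSimpleDisc (fun _ => (1 : Matrix (Fin 2) (Fin 2) ℝ)) where
  metric := ⟨Set.univ, isOpen_univ, Set.subset_univ _, fun _ _ => contDiffOn_const,
    fun _ _ => Matrix.PosDef.one⟩
  strictlyConvex := by
    intro x v _ hv _
    simp only [christoffel_const, mul_zero, Finset.sum_const_zero, sub_zero, Fin.sum_univ_two]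
    have : 0 < ‖v‖ ^ 2 := by positivity
    rw [EuclideanSpace.real_norm_sq_eq, Fin.sum_univ_two] at this
    simp
    nlinarith
  exp_diffeo := by
    intro x hx
    refine ⟨fun v => x + v, fun y => y - x, ?_, ⟨?_, ?_⟩, ?_, ?_, ?_⟩
    · rintro v ⟨y, hy⟩
      rw [expEq_const_iff hx] at hy ⊢
      exact ⟨rfl, by simpa [hy.1] using hy.2⟩
    · intro v _; simp
    · intro y _; simp
    · intro y hy
      exact ⟨y, (expEq_const_iff hx).2 ⟨by simp, hy⟩⟩
    · fun_prop
    · fun_prop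

end FlatDisc

/-! ### Conformally flat metrics -/

section ConformallyFlat

variable {E H M : Type} [NormedAddCommGroup E] [NormedSpace ℝ E] [TopologicalSpace H]
  [TopologicalSpace M] [ChartedSpace H M] {I : ModelWithCorners ℝ E H}

/-- A locally conformally flat three-manifold is locally admissible. -/
theorem locallyAdmissible_of_conformallyFlat {g : MetricField I M}
    (h : ∀ p : M, ∃ U : Set M, IsOpen U ∧ p ∈ U ∧ ∃ (f : M → R 3) (c : M → ℝ),
      ContMDiffOn I 𝓘(ℝ, R 3) ∞ f U ∧ ContMDiffOn I 𝓘(ℝ, ℝ) ∞ c U ∧ Set.InjOn f U ∧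
      (∀ x ∈ U, 0 < c x) ∧ ∀ x ∈ U, ∀ v w : TangentSpace I x,
        g x v w = c x * inner ℝ (show R 3 from mfderiv I 𝓘(ℝ, R 3) f x v)
          (show R 3 from mfderiv I 𝓘(ℝ, R 3) f x w)) :
    LocallyAdmissible I g := by
  intro p
  obtain ⟨U, hUo, hpU, f, c, hf, hc, hinj, hcpos, hform⟩ := h p
  let L : R 3 →L[ℝ] R 2 := (EuclideanSpace.equiv (Fin 2) ℝ).symm.toContinuousLinearMap.comp
    (ContinuousLinearMap.pi ![EuclideanSpace.proj 1, EuclideanSpace.proj 2])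
  have hL0 : ∀ y, L y 0 = y 1 := fun y => rfl
  have hL1 : ∀ y, L y 1 = y 2 := fun y => rfl
  let P : R 3 →L[ℝ] ℝ := EuclideanSpace.proj 0
  have hP : ∀ y, P y = y 0 := fun y => rfl
  -- The first coordinate of the flat chart plays the role of the line; the other two, recentred at
  -- the base point and cut down to the unit ball, give the map into the disc.
  let Q : R 3 → R 2 := fun y => L y - L (f p)
  have hQ : ContDiff ℝ ∞ Q := by fun_prop
  have hQf : ContMDiffOn I (𝓡 2) ∞ (Q ∘ f) U := hQ.contMDiff.comp_contMDiffOn hf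
  have hPf : ContMDiffOn I 𝓘(ℝ, ℝ) ∞ (P ∘ f) U := P.contDiff.contMDiff.comp_contMDiffOn hf
  have hUo' : IsOpen (U ∩ (Q ∘ f) ⁻¹' ball 0 1) :=
    hQf.continuousOn.isOpen_inter_preimage hUo isOpen_ball
  refine ⟨U ∩ (Q ∘ f) ⁻¹' ball 0 1, hUo', ⟨hpU, by simp [Q]⟩, fun _ => 1, P ∘ f, Q ∘ f, c,
    isSimpleDisc_one, hPf.mono Set.inter_subset_left, hQf.mono Set.inter_subset_left,
    hc.mono Set.inter_subset_left, fun x hx => hx.2, ?_, fun x hx => hcpos x hx.1, ?_⟩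
  · intro x hx y hy hxy
    refine hinj hx.1 hy.1 ?_
    simp only [Prod.mk.injEq, Function.comp_apply, Q, hP, sub_left_inj] at hxy
    have h1 := congrArg (fun z : R 2 => z 0) hxy.2
    have h2 := congrArg (fun z : R 2 => z 1) hxy.2
    simp only [hL0, hL1] at h1 h2
    ext k
    fin_cases k
    exacts [hxy.1, h1, h2]
  · intro x hx v w
    have hfx := ((hf.contMDiffAt (hUo.mem_nhds hx.1)).mdifferentiableAt (by simp)).hasMFDerivAt
    have hQ' : HasMFDerivAt 𝓘(ℝ, R 3) (𝓡 2) Q (f x) L :=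
      (L.hasFDerivAt.sub_const _).hasMFDerivAt
    have hP' : HasMFDerivAt 𝓘(ℝ, R 3) 𝓘(ℝ, ℝ) P (f x) P := P.hasFDerivAt.hasMFDerivAt
    rw [hform x hx.1, (hQ'.comp x hfx).mfderiv, (hP'.comp x hfx).mfderiv]
    set a : R 3 := mfderiv I 𝓘(ℝ, R 3) f x v with ha
    set b : R 3 := mfderiv I 𝓘(ℝ, R 3) f x w with hb
    change c x * inner ℝ a b = c x * (a 0 * b 0 + ∑ i, ∑ j, (1 : Matrix (Fin 2) (Fin 2) ℝ) i j *
      (L a) i * (L b) j)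
    congr 1
    simp only [Fin.sum_univ_two, hL0, hL1, PiLp.inner_apply, Fin.sum_univ_three]
    simp
    ring

end ConformallyFlat

/-! ### The constant curvature geometries and the two products -/

section Geometries

theorem euclidean_locallyAdmissible : LocallyAdmissible (𝓡 3) (euclideanMetric 3) := by
  refine locallyAdmissible_of_conformallyFlat fun p => ⟨Set.univ, isOpen_univ, trivial, id,
    fun _ => 1, contMDiffOn_id, contMDiffOn_const, Set.injOn_id _, fun _ _ => one_pos, ?_⟩
  intro x _ v w
  rw [mfderiv_id]
  simp [euclideanMetric]

theorem euclidean_locallyAdmitsLCW :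
    LocallyAdmitsLCW (stdBasis 3) (𝓡 3) (euclideanMetric 3) :=
  euclidean_locallyAdmissible.locallyAdmitsLCW (by simp) fun _ v hv =>
    inner_self_ne_zero.2 hv

/-- The differential of the inclusion of an open subset is injective. -/
theorem mfderiv_val_injective {n : ℕ} (x : Hyperbolic n) :
    Function.Injective (mfderiv (𝓡 (n + 1)) (𝓡 (n + 1)) (Subtype.val : Hyperbolic n → R (n + 1)) x) := by
  have h := isInvertible_mfderiv_extChartAt (I := 𝓡 (n + 1)) (mem_extChartAt_source x)
  exact h.injective

theorem hyperbolicMetric_self_pos {n : ℕ} (x : Hyperbolic n)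
    (v : TangentSpace (𝓡 (n + 1)) x) (hv : v ≠ 0) : 0 < hyperbolicMetric n x v v := by
  have hx : 0 < x.1 (Fin.last n) := x.2
  refine div_pos ?_ (by positivity)
  rw [real_inner_self_eq_norm_sq]
  have : mfderiv (𝓡 (n + 1)) (𝓡 (n + 1)) (Subtype.val : Hyperbolic n → R (n + 1)) x v ≠ 0 :=
    fun h => hv (mfderiv_val_injective x (by rw [h]; exact (map_zero _).symm))
  have := norm_pos_iff.2 (show (show R (n + 1) from _) ≠ 0 from this)
  positivity

theorem sphereMetric_self_pos {n : ℕ} (x : Sphere n)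
    (v : TangentSpace (𝓡 n) x) (hv : v ≠ 0) : 0 < sphereMetric n x v v := by
  unfold sphereMetric
  rw [real_inner_self_eq_norm_sq]
  have := Fact.mk (@finrank_euclideanSpace_fin ℝ _ (n + 1))
  have : mfderiv (𝓡 n) 𝓘(ℝ, R (n + 1)) (Subtype.val : Sphere n → R (n + 1)) x v ≠ 0 :=
    fun h => hv (mfderiv_coe_sphere_injective (E := R (n + 1)) x
      (by rw [h]; exact (map_zero _).symm))
  have := norm_pos_iff.2 (show (show R (n + 1) from _) ≠ 0 from this)
  positivity

/-- The value at the zero vector is a separate hypothesis because bilinearity is not part of the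
type `MetricField`. -/
theorem prodLine_self_ne_zero {n : ℕ} {N : Type} [TopologicalSpace N] [ChartedSpace (R n) N]
    {g : MetricField (𝓡 n) N} (h0 : ∀ x, g x 0 0 = 0)
    (hg : ∀ (x : N) (v : TangentSpace (𝓡 n) x), v ≠ 0 → 0 < g x v v) (x : N × ℝ)
    (v : TangentSpace ((𝓡 n).prod 𝓘(ℝ, ℝ)) x) (hv : v ≠ 0) : prodLine g x v v ≠ 0 := by
  obtain ⟨a, s⟩ := v
  change g x.1 a a + s * s ≠ 0
  by_cases ha : a = 0
  · have hs : s ≠ 0 := fun hs => hv (by rw [ha, hs]; rfl)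
    have := mul_self_pos.2 hs
    rw [ha]
    refine ne_of_gt (this.trans_eq ?_)
    exact ((congrArg (· + s * s) (h0 x.1)).trans (zero_add _)).symm
  · have := hg x.1 a ha
    have := mul_self_nonneg s
    positivity

theorem hasMFDerivAt_val_hyperbolic {n : ℕ} (x : Hyperbolic n) :
    HasMFDerivAt (𝓡 (n + 1)) 𝓘(ℝ, R (n + 1)) (Subtype.val : Hyperbolic n → R (n + 1)) x
      (mfderiv (𝓡 (n + 1)) (𝓡 (n + 1)) (Subtype.val : Hyperbolic n → R (n + 1)) x) :=
  ((contMDiff_subtype_val (n := ∞) x).mdifferentiableAt (by simp)).hasMFDerivAt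

theorem hyperbolic_locallyAdmissible : LocallyAdmissible (𝓡 3) (hyperbolicMetric 2) := by
  have hsm : ContMDiff (𝓡 3) (𝓡 3) ∞ (Subtype.val : Hyperbolic 2 → R 3) := contMDiff_subtype_val
  refine locallyAdmissible_of_conformallyFlat fun p => ⟨Set.univ, isOpen_univ, trivial,
    Subtype.val, (fun y : R 3 => (y 2 ^ 2)⁻¹) ∘ Subtype.val, hsm.contMDiffOn, ?_,
    Subtype.val_injective.injOn, ?_, ?_⟩
  · intro x _
    refine ContMDiffAt.contMDiffWithinAt (ContMDiffAt.comp x (I' := 𝓘(ℝ, R 3)) ?_ (hsm x))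
    have hx : x.1 2 ≠ 0 := ne_of_gt x.2
    exact ContDiffAt.contMDiffAt (ContDiffAt.inv (by fun_prop) (by positivity))
  · intro x _
    have hx : 0 < x.1 2 := x.2
    simp only [Function.comp_apply]
    positivity
  · intro x _ v w
    exact div_eq_inv_mul _ _

theorem hyperbolic_locallyAdmitsLCW :
    LocallyAdmitsLCW (stdBasis 3) (𝓡 3) (hyperbolicMetric 2) :=
  hyperbolic_locallyAdmissible.locallyAdmitsLCW (by simp) fun x v hv =>
    (hyperbolicMetric_self_pos x v hv).ne'

theorem hasMFDerivAt_prodMk_space {E H M F F' : Type} [NormedAddCommGroup E] [NormedSpace ℝ E]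
    [TopologicalSpace H] [TopologicalSpace M] [ChartedSpace H M] {I : ModelWithCorners ℝ E H}
    [NormedAddCommGroup F] [NormedSpace ℝ F] [NormedAddCommGroup F'] [NormedSpace ℝ F']
    {f : M → F} {g : M → F'} {x : M} {f' : TangentSpace I x →L[ℝ] F} {g' : TangentSpace I x →L[ℝ] F'}
    (hf : HasMFDerivAt I 𝓘(ℝ, F) f x f') (hg : HasMFDerivAt I 𝓘(ℝ, F') g x g') :
    HasMFDerivAt I 𝓘(ℝ, F × F') (fun y => (f y, g y)) x (f'.prod g') :=
  ⟨hf.1.prodMk hg.1, hf.2.prodMk hg.2⟩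

/-- Cylindrical coordinates about the boundary line of the half plane: `(x, y, t) ↦ (x, y cos t, y
sin t)` pulls the Euclidean metric back to `dx² + dy² + y² dt²`, which is `y²` times the product
metric. -/
theorem prodHyperbolic_locallyAdmissible :
    LocallyAdmissible ((𝓡 2).prod 𝓘(ℝ, ℝ)) (prodLine (hyperbolicMetric 1)) := by
  refine locallyAdmissible_of_conformallyFlat fun p => ?_
  have hsm : ContMDiff (𝓡 2) (𝓡 2) ∞ (Subtype.val : Hyperbolic 1 → R 2) := contMDiff_subtype_val
  have hk : ContMDiff ((𝓡 2).prod 𝓘(ℝ, ℝ)) 𝓘(ℝ, R 2 × ℝ) ∞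
      (fun q : Hyperbolic 1 × ℝ => (q.1.1, q.2)) :=
    (hsm.comp contMDiff_fst).prodMk_space contMDiff_snd
  let F : R 2 × ℝ → R 3 := fun q => !₂[q.1 0, q.1 1 * Real.cos q.2, q.1 1 * Real.sin q.2]
  have hF : ContDiff ℝ ∞ F := by
    refine contDiff_euclidean.2 fun i => ?_
    fin_cases i <;> simp [F] <;> fun_prop
  have hdF : ∀ (q : R 2 × ℝ) (k : Fin 3), HasFDerivAt (fun q => F q k)
      ((EuclideanSpace.proj k : R 3 →L[ℝ] ℝ).comp (fderiv ℝ F q)) q := fun q k =>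
    (EuclideanSpace.proj k : R 3 →L[ℝ] ℝ).hasFDerivAt.comp q
      (hF.differentiable (by simp) q).hasFDerivAt
  have hpr : ∀ (q : R 2 × ℝ) (k : Fin 2), HasFDerivAt (fun q : R 2 × ℝ => q.1 k)
      ((EuclideanSpace.proj k : R 2 →L[ℝ] ℝ).comp (ContinuousLinearMap.fst ℝ (R 2) ℝ)) q :=
    fun q k => ((EuclideanSpace.proj k : R 2 →L[ℝ] ℝ).comp
      (ContinuousLinearMap.fst ℝ (R 2) ℝ)).hasFDerivAt
  have hd0 : ∀ q V : R 2 × ℝ, fderiv ℝ F q V 0 = V.1 0 := fun q V =>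
    congrArg (fun L : R 2 × ℝ →L[ℝ] ℝ => L V) ((hdF q 0).unique (hpr q 0))
  have hd1 : ∀ q V : R 2 × ℝ, fderiv ℝ F q V 1 =
      V.1 1 * Real.cos q.2 - q.1 1 * Real.sin q.2 * V.2 := fun q V => by
    have h := congrArg (fun L : R 2 × ℝ →L[ℝ] ℝ => L V)
      ((hdF q 1).unique ((hpr q 1).fun_mul (hasFDerivAt_snd (p := q)).cos))
    refine Eq.trans h ?_
    simp
    ring
  have hd2 : ∀ q V : R 2 × ℝ, fderiv ℝ F q V 2 =
      V.1 1 * Real.sin q.2 + q.1 1 * Real.cos q.2 * V.2 := fun q V => by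
    have h := congrArg (fun L : R 2 × ℝ →L[ℝ] ℝ => L V)
      ((hdF q 2).unique ((hpr q 1).fun_mul (hasFDerivAt_snd (p := q)).sin))
    refine Eq.trans h ?_
    simp
    ring
  -- Two angles in this neighbourhood differ by less than `2 < π`, so the angular coordinate is
  -- injective on it.
  refine ⟨{q | |q.2 - p.2| < 1}, isOpen_lt (by fun_prop) continuous_const, by simp,
    fun q => F (q.1.1, q.2), fun q => (q.1.1 1 ^ 2)⁻¹,
    (hF.contMDiff.comp hk).contMDiffOn, ?_, ?_, ?_, ?_⟩
  · intro q _
    refine ContMDiffAt.contMDiffWithinAt (ContMDiffAt.comp q (I' := 𝓘(ℝ, R 2 × ℝ))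
      (g := fun y : R 2 × ℝ => (y.1 1 ^ 2)⁻¹) ?_ (hk q))
    have hx : q.1.1 1 ≠ 0 := ne_of_gt q.1.2
    exact ContDiffAt.contMDiffAt (ContDiffAt.inv (by fun_prop) (by positivity))
  · rintro ⟨x, t⟩ ht ⟨y, s⟩ hs h
    have h0 := congrArg (fun z : R 3 => z 0) h
    have h1 := congrArg (fun z : R 3 => z 1) h
    have h2 := congrArg (fun z : R 3 => z 2) h
    simp [F] at h0 h1 h2
    have hx : 0 < x.1 1 := x.2
    have hy : 0 < y.1 1 := y.2
    have hxy : x.1 1 = y.1 1 := by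
      have : x.1 1 ^ 2 = y.1 1 ^ 2 := by
        have e1 := Real.sin_sq_add_cos_sq t
        have e2 := Real.sin_sq_add_cos_sq s
        calc x.1 1 ^ 2 = (x.1 1 * Real.cos t) ^ 2 + (x.1 1 * Real.sin t) ^ 2 := by
              linear_combination -(x.1 1) ^ 2 * e1
          _ = y.1 1 ^ 2 := by rw [h1, h2]; linear_combination (y.1 1) ^ 2 * e2
      exact (sq_eq_sq₀ hx.le hy.le).1 this
    rw [hxy] at h1 h2
    have hc := mul_left_cancel₀ hy.ne' h1
    have hs' := mul_left_cancel₀ hy.ne' h2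
    have hsin : Real.sin (t - s) = 0 := by rw [Real.sin_sub, hc, hs']; ring
    have hts : t - s = 0 := by
      simp only [Set.mem_ofPred_eq, abs_lt] at ht hs
      have hpi := Real.pi_gt_three
      exact (Real.sin_eq_zero_iff_of_lt_of_lt (by linarith) (by linarith)).1 hsin
    refine Prod.ext (Subtype.ext ?_) (by simpa [sub_eq_zero] using hts)
    ext k
    fin_cases k
    exacts [h0, hxy]
  · intro q _
    have hx : 0 < q.1.1 1 := q.1.2
    positivity
  · rintro ⟨x, t⟩ _ ⟨a, r⟩ ⟨b, s⟩
    have hx : 0 < x.1 1 := x.2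
    have hk' := hasMFDerivAt_prodMk_space
      ((hasMFDerivAt_val_hyperbolic x).comp (x, t)
        (hasMFDerivAt_fst (I := 𝓡 2) (I' := 𝓘(ℝ, ℝ)) (x, t)))
      (hasMFDerivAt_snd (I := 𝓡 2) (I' := 𝓘(ℝ, ℝ)) (x, t))
    have hm := HasMFDerivAt.comp (g := F) (x, t)
      (hF.differentiable (by simp) (x.1, t)).hasFDerivAt.hasMFDerivAt hk'
    have hm' := hm.mfderiv
    simp only [Function.comp_def] at hm'
    rw [hm']
    set V : R 2 := mfderiv (𝓡 2) (𝓡 2) (Subtype.val : Hyperbolic 1 → R 2) x a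
    set W : R 2 := mfderiv (𝓡 2) (𝓡 2) (Subtype.val : Hyperbolic 1 → R 2) x b
    change inner ℝ V W / x.1 1 ^ 2 + r * s = (x.1 1 ^ 2)⁻¹ *
      inner ℝ (fderiv ℝ F (x.1, t) (V, r)) (fderiv ℝ F (x.1, t) (W, s))
    simp only [PiLp.inner_apply, Fin.sum_univ_three, Fin.sum_univ_two, hd0, hd1, hd2]
    simp only [RCLike.inner_apply, conj_trivial]
    field_simp
    have e1 := Real.sin_sq_add_cos_sq t
    linear_combination (-(V 1 * W 1) - x.1 1 ^ 2 * r * s) * e1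

theorem prodHyperbolic_locallyAdmitsLCW :
    LocallyAdmitsLCW (prodBasis 2) ((𝓡 2).prod 𝓘(ℝ, ℝ)) (prodLine (hyperbolicMetric 1)) :=
  prodHyperbolic_locallyAdmissible.locallyAdmitsLCW (by simp)
    (prodLine_self_ne_zero (fun x => by
      have h : (show R 2 from mfderiv (𝓡 2) (𝓡 2) (Subtype.val : Hyperbolic 1 → R 2) x 0) = 0 :=
        map_zero _
      unfold hyperbolicMetric
      rw [h]; simp) hyperbolicMetric_self_pos)

theorem contMDiff_val_sphere {n : ℕ} :
    ContMDiff (𝓡 n) 𝓘(ℝ, R (n + 1)) ∞ (Subtype.val : Sphere n → R (n + 1)) :=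
  have := Fact.mk (@finrank_euclideanSpace_fin ℝ _ (n + 1))
  contMDiff_coe_sphere (E := R (n + 1))

theorem hasMFDerivAt_coe_sphere {n : ℕ} (x : Sphere n) :
    HasMFDerivAt (𝓡 n) 𝓘(ℝ, R (n + 1)) (Subtype.val : Sphere n → R (n + 1)) x
      (mfderiv (𝓡 n) 𝓘(ℝ, R (n + 1)) (Subtype.val : Sphere n → R (n + 1)) x) :=
  ((contMDiff_val_sphere x).mdifferentiableAt (by simp)).hasMFDerivAt

theorem inner_mfderiv_coe_sphere {n : ℕ} (x : Sphere n) (v : TangentSpace (𝓡 n) x) :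
    inner ℝ x.1 (show R (n + 1) from
      mfderiv (𝓡 n) 𝓘(ℝ, R (n + 1)) (Subtype.val : Sphere n → R (n + 1)) x v) = 0 := by
  have := Fact.mk (@finrank_euclideanSpace_fin ℝ _ (n + 1))
  have h := range_mfderiv_coe_sphere (E := R (n + 1)) (n := n) x
  have h1 : (show R (n + 1) from
      mfderiv (𝓡 n) 𝓘(ℝ, R (n + 1)) (Subtype.val : Sphere n → R (n + 1)) x v) ∈ (Submodule.span ℝ {x.1})ᗮ := by
    rw [← h]; exact ⟨v, rfl⟩
  exact Submodule.mem_orthogonal_singleton_iff_inner_right.1 h1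

/-- Stereographic projection `y ↦ (y₀, y₁, y₂) / (1 + ε y₃)` is conformal on the sphere. In checking
this, tangent vectors enter only through their orthogonality to the position vector. -/
theorem sphere_locallyAdmissible : LocallyAdmissible (𝓡 3) (sphereMetric 3) := by
  refine locallyAdmissible_of_conformallyFlat fun p => ?_
  -- The sign `ε` picks the centre of projection `(0, 0, 0, -ε)`, one of the two poles, in the
  -- hemisphere away from `p`.
  obtain ⟨ε, hε, hp⟩ : ∃ ε : ℝ, ε * ε = 1 ∧ 0 < 1 + ε * p.1 3 := by
    rcases le_total 0 (p.1 3) with h | h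
    · exact ⟨1, by norm_num, by linarith⟩
    · exact ⟨-1, by norm_num, by linarith⟩
  let π : R 4 →L[ℝ] R 3 := (EuclideanSpace.equiv (Fin 3) ℝ).symm.toContinuousLinearMap.comp
    (ContinuousLinearMap.pi ![EuclideanSpace.proj 0, EuclideanSpace.proj 1, EuclideanSpace.proj 2])
  have hπ : ∀ y, π y 0 = y 0 ∧ π y 1 = y 1 ∧ π y 2 = y 2 := fun y => ⟨rfl, rfl, rfl⟩
  let F : R 4 → R 3 := fun y => (1 + ε * y 3)⁻¹ • π y
  have hden : ContDiff ℝ ∞ fun y : R 4 => 1 + ε * y 3 := by fun_prop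
  have hF : ∀ y : R 4, 1 + ε * y 3 ≠ 0 → ContDiffAt ℝ ∞ F y := fun y hy =>
    (hden.contDiffAt.inv hy).smul π.contDiff.contDiffAt
  have hdF : ∀ y : R 4, 1 + ε * y 3 ≠ 0 → ∀ V, fderiv ℝ F y V =
      (1 + ε * y 3)⁻¹ • π V - (ε * V 3 * ((1 + ε * y 3) ^ 2)⁻¹) • π y := by
    intro y hy V
    have h3 : HasFDerivAt (fun y : R 4 => 1 + ε * y 3)
        (ε • (EuclideanSpace.proj 3 : R 4 →L[ℝ] ℝ)) y :=
      ((EuclideanSpace.proj 3 : R 4 →L[ℝ] ℝ).hasFDerivAt.const_mul ε).const_add 1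
    have h4 := ((hasDerivAt_inv hy).comp_hasFDerivAt y h3).smul (π.hasFDerivAt (x := y))
    refine (congrArg (fun L : R 4 →L[ℝ] R 3 => L V) h4.fderiv).trans ?_
    simp [sub_eq_add_neg, ← neg_smul]
    congr 2
    ring
  have hnorm : ∀ x : Sphere 3, x.1 0 ^ 2 + x.1 1 ^ 2 + x.1 2 ^ 2 + x.1 3 ^ 2 = 1 := fun x => by
    have h1 : ‖x.1‖ ^ 2 = 1 := by rw [norm_eq_of_mem_sphere x]; norm_num
    rw [EuclideanSpace.real_norm_sq_eq, Fin.sum_univ_four] at h1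
    exact h1
  have hcont : Continuous fun x : Sphere 3 => 1 + ε * x.1 3 := by fun_prop
  refine ⟨{x | 0 < 1 + ε * x.1 3}, isOpen_lt continuous_const hcont, hp, F ∘ Subtype.val,
    fun x => (1 + ε * x.1 3) ^ 2, ?_, ?_, ?_, ?_, ?_⟩
  · intro x hx
    exact ((hF x.1 (ne_of_gt hx)).contMDiffAt.comp x (contMDiff_val_sphere x)).contMDiffWithinAt
  · have : ContDiff ℝ ∞ fun y : R 4 => (1 + ε * y 3) ^ 2 := by fun_prop
    exact (this.contMDiff.comp contMDiff_val_sphere).contMDiffOn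
  · intro x hx y hy hxy
    have hx' : 0 < 1 + ε * x.1 3 := hx
    have hy' : 0 < 1 + ε * y.1 3 := hy
    have h0 : (1 + ε * x.1 3)⁻¹ * x.1 0 = (1 + ε * y.1 3)⁻¹ * y.1 0 :=
      congrArg (fun z : R 3 => z 0) hxy
    have h1 : (1 + ε * x.1 3)⁻¹ * x.1 1 = (1 + ε * y.1 3)⁻¹ * y.1 1 :=
      congrArg (fun z : R 3 => z 1) hxy
    have h2 : (1 + ε * x.1 3)⁻¹ * x.1 2 = (1 + ε * y.1 3)⁻¹ * y.1 2 :=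
      congrArg (fun z : R 3 => z 2) hxy
    -- The squared norm of the projected point determines the height `z₃`, and then the other
    -- coordinates follow: this is injectivity.
    have key : ∀ z : Sphere 3, 0 < 1 + ε * z.1 3 → ((1 + ε * z.1 3)⁻¹ * z.1 0) ^ 2
        + ((1 + ε * z.1 3)⁻¹ * z.1 1) ^ 2 + ((1 + ε * z.1 3)⁻¹ * z.1 2) ^ 2
        = 2 * (1 + ε * z.1 3)⁻¹ - 1 := by
      intro z hz
      field_simp
      linear_combination hnorm z + z.1 3 ^ 2 * hε
    have hs : (1 + ε * x.1 3)⁻¹ = (1 + ε * y.1 3)⁻¹ := by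
      have e1 := key x hx'
      rw [h0, h1, h2, key y hy'] at e1
      linarith
    rw [hs] at h0 h1 h2
    have hne : (1 + ε * y.1 3)⁻¹ ≠ 0 := inv_ne_zero hy'.ne'
    have h3 : x.1 3 = y.1 3 := by
      have e1 := inv_injective hs
      linear_combination ε * e1 - (x.1 3 - y.1 3) * hε
    refine Subtype.ext ?_
    ext k
    fin_cases k
    exacts [mul_left_cancel₀ hne h0, mul_left_cancel₀ hne h1, mul_left_cancel₀ hne h2, h3]
  · intro x hx
    have hx' : 0 < 1 + ε * x.1 3 := hx
    positivity
  · intro x hx v w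
    have hx' : 0 < 1 + ε * x.1 3 := hx
    have hm := HasMFDerivAt.comp (g := F) x
      ((hF x.1 hx'.ne').differentiableAt (by simp)).hasFDerivAt.hasMFDerivAt
      (hasMFDerivAt_coe_sphere x)
    rw [hm.mfderiv]
    have hV := inner_mfderiv_coe_sphere x v
    have hW := inner_mfderiv_coe_sphere x w
    change inner ℝ (show R 4 from mfderiv (𝓡 3) 𝓘(ℝ, R 4) (Subtype.val : Sphere 3 → R 4) x v)
      (show R 4 from mfderiv (𝓡 3) 𝓘(ℝ, R 4) (Subtype.val : Sphere 3 → R 4) x w) =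
      (1 + ε * x.1 3) ^ 2 *
      inner ℝ (fderiv ℝ F x.1 (show R 4 from
          mfderiv (𝓡 3) 𝓘(ℝ, R 4) (Subtype.val : Sphere 3 → R 4) x v))
        (fderiv ℝ F x.1 (show R 4 from
          mfderiv (𝓡 3) 𝓘(ℝ, R 4) (Subtype.val : Sphere 3 → R 4) x w))
    set V : R 4 := mfderiv (𝓡 3) 𝓘(ℝ, R 4) (Subtype.val : Sphere 3 → R 4) x v
    set W : R 4 := mfderiv (𝓡 3) 𝓘(ℝ, R 4) (Subtype.val : Sphere 3 → R 4) x w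
    change inner ℝ x.1 V = 0 at hV
    change inner ℝ x.1 W = 0 at hW
    have hn := hnorm x
    rw [hdF x.1 hx'.ne', hdF x.1 hx'.ne']
    simp only [PiLp.inner_apply, Fin.sum_univ_three, Fin.sum_univ_four, RCLike.inner_apply,
      conj_trivial, PiLp.sub_apply, PiLp.smul_apply, smul_eq_mul, hπ] at hV hW ⊢
    have hV' := (Fin.sum_univ_four fun i => V i * x.1 i).symm.trans hV
    have hW' := (Fin.sum_univ_four fun i => W i * x.1 i).symm.trans hW
    set s := 1 + ε * x.1 3 with hs
    have hs0 : s ≠ 0 := hx'.ne'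
    have e1 : s ^ 2 * (s⁻¹ ^ 2 * (V 0 * W 0 + V 1 * W 1 + V 2 * W 2)
        + 2 * ε * s⁻¹ ^ 3 * x.1 3 * V 3 * W 3 + V 3 * W 3 * s⁻¹ ^ 4 * (1 - x.1 3 ^ 2)) =
        V 0 * W 0 + V 1 * W 1 + V 2 * W 2 + V 3 * W 3 := by
      field_simp
      rw [hs]
      linear_combination V 3 * W 3 * x.1 3 ^ 2 * hε
    rw [← inv_pow]
    linear_combination -e1 + s ^ 2 * ε * s⁻¹ ^ 3 * (V 3 * hW' + W 3 * hV')
      - s ^ 2 * s⁻¹ ^ 4 * V 3 * W 3 * (ε ^ 2 * hn + (1 - x.1 3 ^ 2) * hε)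

theorem sphere_locallyAdmitsLCW : LocallyAdmitsLCW (stdBasis 3) (𝓡 3) (sphereMetric 3) :=
  sphere_locallyAdmissible.locallyAdmitsLCW (by simp) fun x v hv =>
    (sphereMetric_self_pos x v hv).ne'

/-- Polar coordinates with logarithmic radius: `(x, t) ↦ e^t x` pulls the Euclidean metric of `ℝ³`
back to `e^{2t}` times the product metric, and it is injective on the whole product. -/
theorem prodSphere_locallyAdmissible :
    LocallyAdmissible ((𝓡 2).prod 𝓘(ℝ, ℝ)) (prodLine (sphereMetric 2)) := by
  refine locallyAdmissible_of_conformallyFlat fun p => ?_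
  have hk : ContMDiff ((𝓡 2).prod 𝓘(ℝ, ℝ)) 𝓘(ℝ, R 3 × ℝ) ∞
      (fun q : Sphere 2 × ℝ => (q.1.1, q.2)) :=
    (contMDiff_val_sphere.comp contMDiff_fst).prodMk_space contMDiff_snd
  let F : R 3 × ℝ → R 3 := fun q => Real.exp q.2 • q.1
  have hF : ContDiff ℝ ∞ F := by fun_prop
  have hdF : ∀ q V : R 3 × ℝ, fderiv ℝ F q V = Real.exp q.2 • V.1 + (Real.exp q.2 * V.2) • q.1 := by
    intro q V
    have h4 := (hasFDerivAt_snd (𝕜 := ℝ) (p := q)).exp.smul (hasFDerivAt_fst (𝕜 := ℝ) (p := q))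
    refine (congrArg (fun L : R 3 × ℝ →L[ℝ] R 3 => L V) h4.fderiv).trans ?_
    simp
  have hnorm : ∀ x : Sphere 2, ‖x.1‖ = 1 := fun x => norm_eq_of_mem_sphere x
  refine ⟨Set.univ, isOpen_univ, trivial, fun q => F (q.1.1, q.2), fun q => Real.exp (-2 * q.2),
    (hF.contMDiff.comp hk).contMDiffOn, ?_, ?_, ?_, ?_⟩
  · have : ContDiff ℝ ∞ fun t : ℝ => Real.exp (-2 * t) := by fun_prop
    exact (this.contMDiff.comp contMDiff_snd).contMDiffOn
  · rintro ⟨x, t⟩ _ ⟨y, s⟩ _ h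
    have h' : Real.exp t • x.1 = Real.exp s • y.1 := h
    have h1 := congrArg norm h'
    rw [norm_smul, norm_smul, hnorm, hnorm, mul_one, mul_one, Real.norm_eq_abs, Real.norm_eq_abs,
      Real.abs_exp, Real.abs_exp] at h1
    have hts := Real.exp_injective h1
    subst hts
    have := smul_right_injective (R 3) (Real.exp_ne_zero t) h'
    rw [Subtype.ext this]
  · intro q _
    positivity
  · rintro ⟨x, t⟩ _ ⟨a, r⟩ ⟨b, s⟩
    have hk' := hasMFDerivAt_prodMk_space
      ((hasMFDerivAt_coe_sphere x).comp (x, t)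
        (hasMFDerivAt_fst (I := 𝓡 2) (I' := 𝓘(ℝ, ℝ)) (x, t)))
      (hasMFDerivAt_snd (I := 𝓡 2) (I' := 𝓘(ℝ, ℝ)) (x, t))
    have hm := HasMFDerivAt.comp (g := F) (x, t)
      (hF.differentiable (by simp) (x.1, t)).hasFDerivAt.hasMFDerivAt hk'
    have hm' := hm.mfderiv
    simp only [Function.comp_def] at hm'
    rw [hm']
    have hV := inner_mfderiv_coe_sphere x a
    have hW := inner_mfderiv_coe_sphere x b
    set V : R 3 := mfderiv (𝓡 2) 𝓘(ℝ, R 3) (Subtype.val : Sphere 2 → R 3) x a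
    set W : R 3 := mfderiv (𝓡 2) 𝓘(ℝ, R 3) (Subtype.val : Sphere 2 → R 3) x b
    change inner ℝ x.1 V = 0 at hV
    change inner ℝ x.1 W = 0 at hW
    change inner ℝ V W + r * s = Real.exp (-2 * t) *
      inner ℝ (fderiv ℝ F (x.1, t) (V, r)) (fderiv ℝ F (x.1, t) (W, s))
    rw [hdF, hdF]
    simp only [inner_add_left, inner_add_right, real_inner_smul_left, real_inner_smul_right, hW,
      real_inner_comm x.1 V, hV, real_inner_self_eq_norm_sq, hnorm]
    have he : Real.exp (-2 * t) * (Real.exp t * Real.exp t) = 1 := by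
      rw [← Real.exp_add, ← Real.exp_add]; ring_nf; simp
    linear_combination (-inner ℝ V W - r * s) * he

theorem prodSphere_locallyAdmitsLCW :
    LocallyAdmitsLCW (prodBasis 2) ((𝓡 2).prod 𝓘(ℝ, ℝ)) (prodLine (sphereMetric 2)) :=
  prodSphere_locallyAdmissible.locallyAdmitsLCW (by simp)
    (prodLine_self_ne_zero (fun x => by
      have h : (show R 3 from mfderiv (𝓡 2) 𝓘(ℝ, R 3) (Subtype.val : Sphere 2 → R 3) x 0) = 0 :=
        map_zero _
      unfold sphereMetric
      rw [h]; simp) sphereMetric_self_pos)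

end Geometries

end Carleman

namespace Carleman

/-! ### An implicit function theorem near the origin -/

section ImplicitFunction

/-- The implicit function theorem at the origin, for an equation that is a perturbation of second
order of `y = 0`. -/
theorem exists_implicit_of_hasFDerivAt_snd {Θ Y : Type} [NormedAddCommGroup Θ] [NormedSpace ℝ Θ]
    [CompleteSpace Θ] [NormedAddCommGroup Y] [NormedSpace ℝ Y] [CompleteSpace Y] {f : Θ × Y → Y}
    (hf : ContDiff ℝ ω f) (h0 : f 0 = 0)
    (hd : HasFDerivAt f (ContinuousLinearMap.snd ℝ Θ Y) 0) :
    ∃ (H : Θ → Y) (ρ : ℝ), 0 < ρ ∧ H 0 = 0 ∧ ContDiffOn ℝ ∞ H (ball 0 ρ) ∧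
      (∀ θ ∈ ball (0 : Θ) ρ, f (θ, H θ) = 0) ∧
      ∀ θ ∈ ball (0 : Θ) ρ, ∀ y ∈ ball (0 : Y) ρ, f (θ, y) = 0 → H θ = y := by
  have cdf : ContDiffAt ℝ ω f 0 := hf.contDiffAt
  have hinv : (fderiv ℝ f 0 ∘L .inr ℝ Θ Y).IsInvertible := by
    rw [hd.fderiv]
    exact ContinuousLinearMap.IsInvertible.of_inverse (g := ContinuousLinearMap.id ℝ Y)
      (by ext; simp) (by ext; simp)
  set H := cdf.implicitFunction (by simp) hinv with hH
  have h1 : ∀ᶠ θ in nhds (0 : Θ), ContDiffAt ℝ ω H θ :=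
    (cdf.contDiffAt_implicitFunction (by simp) hinv).eventually (by simp)
  have h2 : ∀ᶠ θ in nhds (0 : Θ), f (θ, H θ) = f 0 :=
    cdf.eventually_apply_implicitFunction (by simp) hinv
  have h3 : ∀ᶠ q in nhds (0 : Θ × Y), f q = f 0 ↔ H q.1 = q.2 :=
    cdf.eventually_apply_eq_iff_implicitFunction (by simp) hinv
  obtain ⟨ρ₁, hρ₁, hb₁⟩ := Metric.eventually_nhds_iff_ball.1 (h1.and h2)
  obtain ⟨ρ₂, hρ₂, hb₂⟩ := Metric.eventually_nhds_iff_ball.1 h3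
  refine ⟨H, min ρ₁ ρ₂, lt_min hρ₁ hρ₂, cdf.implicitFunction_apply_self (by simp) hinv, ?_, ?_, ?_⟩
  · intro θ hθ
    exact ((hb₁ θ (ball_subset_ball (min_le_left _ _) hθ)).1.of_le le_top).contDiffWithinAt
  · intro θ hθ
    rw [(hb₁ θ (ball_subset_ball (min_le_left _ _) hθ)).2, h0]
  · intro θ hθ y hy h
    refine (hb₂ (θ, y) ?_).1 (h.trans h0.symm)
    rw [show (0 : Θ × Y) = (0, 0) from rfl, ← ball_prod_same]
    exact ⟨ball_subset_ball (min_le_right _ _) hθ, ball_subset_ball (min_le_right _ _) hy⟩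

end ImplicitFunction

/-! ### Primitives of continuous functions on the unit interval -/

section Primitive

/-- The Banach algebra of continuous functions on the unit interval. -/
abbrev CI : Type := C(Set.Icc (0 : ℝ) 1, ℝ)

/-- The primitive that vanishes at `0` of a continuous function on the unit interval, extended by
constants to the real line. -/
noncomputable def prim (h : CI) (t : ℝ) : ℝ := ∫ s in (0 : ℝ)..t, Set.IccExtend zero_le_one h s

theorem hasDerivAt_prim (h : CI) (t : ℝ) :
    HasDerivAt (prim h) (Set.IccExtend zero_le_one h t) t :=
  have hc : Continuous (Set.IccExtend zero_le_one h) := h.continuous.Icc_extend'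
  intervalIntegral.integral_hasDerivAt_right (hc.intervalIntegrable _ _)
    (hc.stronglyMeasurableAtFilter _ _) hc.continuousAt

theorem prim_zero (h : CI) : prim h 0 = 0 := by simp [prim]

theorem continuous_prim (h : CI) : Continuous (prim h) :=
  continuous_iff_continuousAt.2 fun t => (hasDerivAt_prim h t).continuousAt

theorem abs_prim_le (h : CI) {t : ℝ} (ht : t ∈ Set.Icc (0 : ℝ) 1) : |prim h t| ≤ ‖h‖ := by
  have h1 := intervalIntegral.norm_integral_le_of_norm_le_const (a := 0) (b := t) (C := ‖h‖)
    (f := Set.IccExtend zero_le_one h) (fun s _ => by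
      rw [Set.IccExtend, Function.comp_apply]; exact h.norm_coe_le_norm _)
  rw [Real.norm_eq_abs, sub_zero, abs_of_nonneg ht.1] at h1
  exact h1.trans (mul_le_of_le_one_right (norm_nonneg _) ht.2)

/-- The operator that takes a continuous function on the unit interval to its primitive. -/
noncomputable def primL : CI →L[ℝ] CI :=
  LinearMap.mkContinuous
    { toFun := fun h => ⟨fun t => prim h t, (continuous_prim h).comp continuous_subtype_val⟩
      map_add' := fun f g => by
        ext t
        have hc : ∀ h : CI, Continuous (Set.IccExtend zero_le_one h) :=
          fun h => h.continuous.Icc_extend'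
        exact intervalIntegral.integral_add ((hc f).intervalIntegrable _ _)
          ((hc g).intervalIntegrable _ _)
      map_smul' := fun c f => by
        ext t
        exact intervalIntegral.integral_const_mul c _ } 1 fun h => by
      rw [one_mul]
      exact (ContinuousMap.norm_le _ (norm_nonneg _)).2 fun t => abs_prim_le h t.2

theorem primL_apply (h : CI) (t : Set.Icc (0 : ℝ) 1) : primL h t = prim h t := rfl

theorem norm_primL_le (h : CI) : ‖primL h‖ ≤ ‖h‖ :=
  (ContinuousMap.norm_le _ (norm_nonneg _)).2 fun t => abs_prim_le h t.2

/-- A function on the unit interval is the primitive of its derivative. -/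
theorem eq_add_prim {f : ℝ → ℝ} {h : CI} (hf : ∀ t (ht : t ∈ Set.Icc (0 : ℝ) 1),
    HasDerivWithinAt f (h ⟨t, ht⟩) (Set.Icc 0 1) t) {t : ℝ} (ht : t ∈ Set.Icc (0 : ℝ) 1) :
    f t = f 0 + prim h t := by
  have := eq_of_hasDerivWithinAt_zero (f := fun s => f s - prim h s) (fun s hs => by
    have h1 := (hf s hs).sub (hasDerivAt_prim h s).hasDerivWithinAt
    rw [Set.IccExtend_of_mem _ _ hs, sub_self] at h1
    exact h1) t ht
  simp only [prim_zero, sub_zero] at this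
  linarith

end Primitive

/-! ### The geodesic equation of `da² + (1 + a)⁴ db²` as an equation in `C([0,1])` -/

section SolGeodesics

/-- The coordinate function of the unit interval. -/
noncomputable def coordI : CI := ⟨Subtype.val, continuous_subtype_val⟩

/-- The position at time `t`, for given initial position, initial velocity and acceleration. -/
noncomputable def posI (x v : ℝ) (h : CI) : CI := x • 1 + v • coordI + primL (primL h)

/-- The velocity, for given initial velocity and acceleration. -/
noncomputable def velI (v : ℝ) (h : CI) : CI := v • 1 + primL h

/-- The space of data: two points, or a point and a velocity. -/
abbrev Data : Type := (ℝ × ℝ) × (ℝ × ℝ)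

/-- The geodesic equation of `da² + (1 + a)⁴ db²`, as an equation for the acceleration, given the
initial position and velocity. -/
noncomputable def geodEqn (q : Data × (CI × CI)) : CI × CI :=
  (q.2.1 - 2 * (1 + posI q.1.1.1 q.1.2.1 q.2.1) ^ 3 * velI q.1.2.2 q.2.2 ^ 2,
    (1 + posI q.1.1.1 q.1.2.1 q.2.1) * q.2.2 + 4 * velI q.1.2.1 q.2.1 * velI q.1.2.2 q.2.2)

theorem contDiff_geodEqn : ContDiff ℝ ω geodEqn := by
  unfold geodEqn posI velI
  fun_prop

theorem geodEqn_zero : geodEqn 0 = 0 := by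
  simp [geodEqn, posI, velI]

/-- At the origin position, velocity and acceleration all vanish, and apart from the accelerations
themselves every term is a product with at least two such factors. So the linearization is the
projection to the acceleration, as the implicit function theorem above requires. -/
theorem hasFDerivAt_geodEqn :
    HasFDerivAt geodEqn (ContinuousLinearMap.snd ℝ Data (CI × CI)) 0 := by
  have hp : DifferentiableAt ℝ (fun q : Data × (CI × CI) => posI q.1.1.1 q.1.2.1 q.2.1) 0 := by
    unfold posI; fun_prop
  have hv : ∀ k : Data × (CI × CI) → ℝ, ∀ l : Data × (CI × CI) → CI, DifferentiableAt ℝ k 0 →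
      DifferentiableAt ℝ l 0 → DifferentiableAt ℝ (fun q => velI (k q) (l q)) 0 := by
    intro k l hk hl
    unfold velI; fun_prop
  have hp0 : posI 0 0 0 = 0 := by simp [posI]
  have hv0 : velI 0 0 = 0 := by simp [velI]
  have h1 := (hp.const_add 1).hasFDerivAt
  have h2 := (hv (fun q => q.1.2.1) (fun q => q.2.1) (by fun_prop) (by fun_prop)).hasFDerivAt
  have h3 := (hv (fun q => q.1.2.2) (fun q => q.2.2) (by fun_prop) (by fun_prop)).hasFDerivAt
  have ha : HasFDerivAt (fun q : Data × (CI × CI) => q.2.1)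
      ((ContinuousLinearMap.fst ℝ CI CI).comp (ContinuousLinearMap.snd ℝ Data (CI × CI))) 0 :=
    ((ContinuousLinearMap.fst ℝ CI CI).comp
      (ContinuousLinearMap.snd ℝ Data (CI × CI))).hasFDerivAt
  have hb : HasFDerivAt (fun q : Data × (CI × CI) => q.2.2)
      ((ContinuousLinearMap.snd ℝ CI CI).comp (ContinuousLinearMap.snd ℝ Data (CI × CI))) 0 :=
    ((ContinuousLinearMap.snd ℝ CI CI).comp
      (ContinuousLinearMap.snd ℝ Data (CI × CI))).hasFDerivAt
  have hcube : DifferentiableAt ℝ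
      (fun q : Data × (CI × CI) => 2 * (1 + posI q.1.1.1 q.1.2.1 q.2.1) ^ 3) 0 := by
    fun_prop
  have k1 := ha.fun_sub (hcube.hasFDerivAt.fun_mul (h3.fun_mul h3))
  have k2 := (h1.fun_mul hb).fun_add ((h2.const_mul 4).fun_mul h3)
  have k3 := k1.prodMk k2
  simp only [Prod.fst_zero, Prod.snd_zero, hp0, hv0] at k3
  have e : geodEqn = fun q : Data × (CI × CI) =>
      (q.2.1 - 2 * (1 + posI q.1.1.1 q.1.2.1 q.2.1) ^ 3 * (velI q.1.2.2 q.2.2 * velI q.1.2.2 q.2.2),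
      (1 + posI q.1.1.1 q.1.2.1 q.2.1) * q.2.2 + 4 * velI q.1.2.1 q.2.1 * velI q.1.2.2 q.2.2) := by
    funext q; simp only [geodEqn, pow_two (velI _ _)]
  rw [e]
  refine k3.congr_fderiv ?_
  ext q <;> simp

/-- A solution of the geodesic equation of `da² + (1 + a)⁴ db²` on the unit interval. -/
structure IsSolGeodesic (A B P Q : ℝ → ℝ) : Prop where
  derivA : ∀ t ∈ Set.Icc (0 : ℝ) 1, HasDerivWithinAt A (P t) (Set.Icc 0 1) t
  derivB : ∀ t ∈ Set.Icc (0 : ℝ) 1, HasDerivWithinAt B (Q t) (Set.Icc 0 1) t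
  derivP : ∀ t ∈ Set.Icc (0 : ℝ) 1,
    HasDerivWithinAt P (2 * (1 + A t) ^ 3 * Q t ^ 2) (Set.Icc 0 1) t
  derivQ : ∀ t ∈ Set.Icc (0 : ℝ) 1,
    HasDerivWithinAt Q (-(4 * P t * Q t / (1 + A t))) (Set.Icc 0 1) t

theorem exists_deriv_eq_sub {f f' : ℝ → ℝ}
    (hf : ∀ t ∈ Set.Icc (0 : ℝ) 1, HasDerivWithinAt f (f' t) (Set.Icc 0 1) t) :
    ∃ t ∈ Set.Icc (0 : ℝ) 1, f' t = f 1 - f 0 := by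
  obtain ⟨t, ht, h⟩ := exists_hasDerivAt_eq_slope f f' zero_lt_one
    (fun t ht => (hf t ht).continuousWithinAt)
    fun t ht => (hf t ⟨ht.1.le, ht.2.le⟩).hasDerivAt (Icc_mem_nhds ht.1 ht.2)
  exact ⟨t, ⟨ht.1.le, ht.2.le⟩, by simpa using h⟩

/-- A geodesic arc in a small disc, parametrized by the unit interval, is slow. -/
theorem IsSolGeodesic.abs_velocity_le {A B P Q : ℝ → ℝ} (h : IsSolGeodesic A B P Q) {r : ℝ}
    (hr : r ≤ 1 / 10) (hA : ∀ t ∈ Set.Icc (0 : ℝ) 1, |A t| ≤ r)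
    (hB : ∀ t ∈ Set.Icc (0 : ℝ) 1, |B t| ≤ r) :
    ∀ t ∈ Set.Icc (0 : ℝ) 1, |P t| ≤ 7 * r ∧ |Q t| ≤ 5 * r := by
  have h01 : (0 : ℝ) ∈ Set.Icc (0 : ℝ) 1 := by simp
  have h11 : (1 : ℝ) ∈ Set.Icc (0 : ℝ) 1 := by simp
  have hr0 : 0 ≤ r := (abs_nonneg _).trans (hA 0 h01)
  have hlo : ∀ t ∈ Set.Icc (0 : ℝ) 1, 9 / 10 ≤ 1 + A t := fun t ht => by
    linarith [(abs_le.1 (hA t ht)).1]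
  have hhi : ∀ t ∈ Set.Icc (0 : ℝ) 1, 1 + A t ≤ 11 / 10 := fun t ht => by
    linarith [(abs_le.1 (hA t ht)).2]
  -- Clairaut's integral, conserved because the metric does not depend on `b`.
  have hL := eq_of_hasDerivWithinAt_zero (f := fun t => (1 + A t) ^ 4 * Q t) fun t ht => by
    have h1 := (((h.derivA t ht).const_add 1).pow 4).mul (h.derivQ t ht)
    refine h1.congr_deriv ?_
    have := hlo t ht
    have : 1 + A t ≠ 0 := by linarith
    simp
    field_simp
    ring
  -- Conservation of energy.
  have hE := eq_of_hasDerivWithinAt_zero (f := fun t => P t ^ 2 + (1 + A t) ^ 4 * Q t ^ 2)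
    fun t ht => by
    have h1 := ((h.derivP t ht).pow 2).add
      ((((h.derivA t ht).const_add 1).pow 4).mul ((h.derivQ t ht).pow 2))
    refine h1.congr_deriv ?_
    have := hlo t ht
    have : 1 + A t ≠ 0 := by linarith
    simp
    field_simp
    ring
  -- The mean value theorem gives one time at which the velocity is at most `2 r`; Clairaut's
  -- integral carries this bound to all times at the cost of the factor `(11 / 9)⁴`, and `2 (11 /
  -- 9)⁴ < 5`.
  have hQ : ∀ t ∈ Set.Icc (0 : ℝ) 1, |Q t| ≤ 5 * r := by
    obtain ⟨s, hs, hQs⟩ := exists_deriv_eq_sub h.derivB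
    have h1 : |Q s| ≤ 2 * r := by
      rw [hQs]
      exact (abs_sub _ _).trans (by linarith [hB 0 h01, hB 1 h11])
    intro t ht
    have h2 : (1 + A t) ^ 4 * Q t = (1 + A s) ^ 4 * Q s := (hL t ht).trans (hL s hs).symm
    have h3 : (1 + A t) ^ 4 * |Q t| = (1 + A s) ^ 4 * |Q s| := by
      have := congrArg abs h2
      rwa [abs_mul, abs_mul, abs_of_nonneg (show 0 ≤ (1 + A t) ^ 4 by positivity),
        abs_of_nonneg (show 0 ≤ (1 + A s) ^ 4 by positivity)] at this
    have h4 : (9 / 10 : ℝ) ^ 4 ≤ (1 + A t) ^ 4 := pow_le_pow_left₀ (by norm_num) (hlo t ht) 4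
    have h5 : (1 + A s) ^ 4 ≤ (11 / 10 : ℝ) ^ 4 :=
      pow_le_pow_left₀ (by linarith [hlo s hs]) (hhi s hs) 4
    have h6 : (9 / 10 : ℝ) ^ 4 * |Q t| ≤ (11 / 10 : ℝ) ^ 4 * (2 * r) :=
      calc (9 / 10 : ℝ) ^ 4 * |Q t| ≤ (1 + A t) ^ 4 * |Q t| := by gcongr
        _ = (1 + A s) ^ 4 * |Q s| := h3
        _ ≤ (11 / 10 : ℝ) ^ 4 * (2 * r) := by gcongr
    norm_num at h6
    linarith
  intro t ht
  refine ⟨?_, hQ t ht⟩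
  -- The same argument with the energy: `2² + (11 / 10)⁴ 5² < 7²`.
  obtain ⟨s, hs, hPs⟩ := exists_deriv_eq_sub h.derivA
  have h1 : |P s| ≤ 2 * r := by
    rw [hPs]
    exact (abs_sub _ _).trans (by linarith [hA 0 h01, hA 1 h11])
  have h2 : P t ^ 2 + (1 + A t) ^ 4 * Q t ^ 2 = P s ^ 2 + (1 + A s) ^ 4 * Q s ^ 2 :=
    (hE t ht).trans (hE s hs).symm
  have h5 : (1 + A s) ^ 4 ≤ (11 / 10 : ℝ) ^ 4 :=
    pow_le_pow_left₀ (by linarith [hlo s hs]) (hhi s hs) 4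
  have h6 : P s ^ 2 ≤ (2 * r) ^ 2 := sq_le_sq' (abs_le.1 h1).1 (abs_le.1 h1).2
  have h7 : Q s ^ 2 ≤ (5 * r) ^ 2 :=
    sq_le_sq' (abs_le.1 (hQ s hs)).1 (abs_le.1 (hQ s hs)).2
  have h8 : (1 + A s) ^ 4 * Q s ^ 2 ≤ (11 / 10 : ℝ) ^ 4 * (5 * r) ^ 2 := by gcongr
  have h9 : 0 ≤ (1 + A t) ^ 4 * Q t ^ 2 := by positivity
  refine abs_le_of_sq_le_sq ?_ (by positivity)
  norm_num at h8
  nlinarith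

/-- This is half the second derivative of `a² + b²` along a geodesic with velocity `(p, q)`. The
flat part is `p² + q²`; in this range the curvature terms are bounded below by `-q² / 2` and `-|p q|
/ 2`. -/
theorem norm_sq_second_deriv_nonneg {a b p q : ℝ} (ha : |a| ≤ 1 / 10) (hb : |b| ≤ 1 / 10) :
    0 ≤ p * p + a * (2 * (1 + a) ^ 3 * q ^ 2) + (q * q + b * -(4 * p * q / (1 + a))) := by
  obtain ⟨ha₁, ha₂⟩ := abs_le.1 ha
  have h1 : 0 < 1 + a := by linarith
  have h3 : (1 + a) ^ 3 ≤ (11 / 10 : ℝ) ^ 3 := pow_le_pow_left₀ h1.le (by linarith) 3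
  have h4 : 0 ≤ (1 + a) ^ 3 := by positivity
  have h5 : -(1 / 2) ≤ 2 * a * (1 + a) ^ 3 := by
    norm_num at h3
    nlinarith
  have h6 : |b * (4 / (1 + a))| ≤ 1 / 2 := by
    rw [abs_mul, abs_of_pos (by positivity : 0 < 4 / (1 + a))]
    have : 4 / (1 + a) ≤ 5 := by rw [div_le_iff₀ h1]; linarith
    calc |b| * (4 / (1 + a)) ≤ 1 / 10 * 5 := by gcongr
      _ = 1 / 2 := by norm_num
  set k := b * (4 / (1 + a)) with hk
  have e : p * p + a * (2 * (1 + a) ^ 3 * q ^ 2) + (q * q + b * -(4 * p * q / (1 + a))) =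
      p * p + q * q + (2 * a * (1 + a) ^ 3) * q ^ 2 - k * (p * q) := by
    rw [hk]; ring
  rw [e]
  obtain ⟨hk₁, hk₂⟩ := abs_le.1 h6
  nlinarith [mul_le_mul_of_nonneg_right h5 (sq_nonneg q), mul_nonneg (sub_nonneg.2 hk₁) (sq_nonneg (p - q)),
    mul_nonneg (sub_nonneg.2 hk₂) (sq_nonneg (p + q)), sq_nonneg (p - q), sq_nonneg (p + q), sq_nonneg p, sq_nonneg q]

/-- Small discs about the origin are geodesically convex. -/
theorem IsSolGeodesic.norm_sq_le {A B P Q : ℝ → ℝ} (h : IsSolGeodesic A B P Q)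
    (hA : ∀ t ∈ Set.Icc (0 : ℝ) 1, |A t| ≤ 1 / 10) (hB : ∀ t ∈ Set.Icc (0 : ℝ) 1, |B t| ≤ 1 / 10)
    {m : ℝ} (h0 : A 0 ^ 2 + B 0 ^ 2 ≤ m) (h1 : A 1 ^ 2 + B 1 ^ 2 ≤ m) :
    ∀ t ∈ Set.Icc (0 : ℝ) 1, A t ^ 2 + B t ^ 2 ≤ m := by
  have hsub : interior (Set.Icc (0 : ℝ) 1) ⊆ Set.Icc 0 1 := interior_subset
  have hconv : ConvexOn ℝ (Set.Icc (0 : ℝ) 1) (fun t => A t * A t + B t * B t) := by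
    refine convexOn_of_hasDerivWithinAt2_nonneg (convex_Icc 0 1)
      (f' := fun t => 2 * (A t * P t + B t * Q t))
      (f'' := fun t => 2 * (P t * P t + A t * (2 * (1 + A t) ^ 3 * Q t ^ 2)
        + (Q t * Q t + B t * -(4 * P t * Q t / (1 + A t))))) ?_ ?_ ?_ ?_
    · intro t ht
      exact ((h.derivA t ht).mul (h.derivA t ht)).continuousWithinAt.add
        ((h.derivB t ht).mul (h.derivB t ht)).continuousWithinAt
    · intro t ht
      have ht := hsub ht
      refine ((((h.derivA t ht).mul (h.derivA t ht)).add
        ((h.derivB t ht).mul (h.derivB t ht))).congr_deriv ?_).mono hsub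
      ring
    · intro t ht
      have ht := hsub ht
      exact ((((h.derivA t ht).mul (h.derivP t ht)).add
        ((h.derivB t ht).mul (h.derivQ t ht))).const_mul 2).mono hsub
    · intro t ht
      have ht := hsub ht
      exact mul_nonneg zero_le_two (norm_sq_second_deriv_nonneg (hA t ht) (hB t ht))
  intro t ht
  have h2 := hconv.le_max_of_mem_Icc (x := 0) (y := 1) (z := t) (by simp) (by simp) ht
  simp only [← pow_two] at h2
  exact h2.trans (max_le h0 h1)

end SolGeodesics

end Carleman

namespace Carleman

/-! ### Simplicity of a small disc of the Sol surface -/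

section SolDisc

/-- The metric `da² + (1 + r a)⁴ db²`. -/
def solDisc (r : ℝ) (x : R 2) : Matrix (Fin 2) (Fin 2) ℝ := !![1, 0; 0, (1 + r * x 0) ^ 4]

theorem pd_solDisc (r : ℝ) (i j l : Fin 2) (x : R 2) :
    pd i (fun y => solDisc r y j l) x =
      if i = 0 ∧ j = 1 ∧ l = 1 then 4 * r * (1 + r * x 0) ^ 3 else 0 := by
  have h : HasFDerivAt (fun y : R 2 => (1 + r * y 0) ^ 4) _ x :=
    ((((EuclideanSpace.proj 0 : R 2 →L[ℝ] ℝ).hasFDerivAt (x := x)).const_mul r).const_add 1).pow 4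
  fin_cases j <;> fin_cases l
  · simp [solDisc, pd]
  · simp [solDisc, pd]
  · simp [solDisc, pd]
  · have h2 : pd i (fun y => solDisc r y 1 1) x = _ := congrArg (fun L => L (e i)) h.fderiv
    refine h2.trans ?_
    fin_cases i <;> simp [e]
    ring

theorem christoffel_solDisc {r : ℝ} {x : R 2} (hx : 1 + r * x 0 ≠ 0) (k i j : Fin 2) :
    christoffel (solDisc r) k i j x =
      if k = 0 ∧ i = 1 ∧ j = 1 then -(2 * r * (1 + r * x 0) ^ 3)
      else if k = 1 ∧ i ≠ j then 2 * r / (1 + r * x 0) else 0 := by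
  have hinv : (solDisc r x)⁻¹ = !![1, 0; 0, ((1 + r * x 0) ^ 4)⁻¹] := by
    refine Matrix.inv_eq_right_inv ?_
    simp [solDisc, hx, Matrix.one_fin_two]
  unfold christoffel
  simp only [pd_solDisc, hinv, Fin.sum_univ_two]
  fin_cases k <;> fin_cases i <;> fin_cases j <;> simp <;> field_simp <;> ring

theorem sum_christoffel_solDisc_zero {r : ℝ} {x : R 2} (hx : 1 + r * x 0 ≠ 0) (v w : R 2) :
    ∑ i, ∑ j, christoffel (solDisc r) 0 i j x * v i * w j =
      -(2 * r * (1 + r * x 0) ^ 3) * v 1 * w 1 := by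
  simp [christoffel_solDisc hx, Fin.sum_univ_two]

theorem sum_christoffel_solDisc_one {r : ℝ} {x : R 2} (hx : 1 + r * x 0 ≠ 0) (v w : R 2) :
    ∑ i, ∑ j, christoffel (solDisc r) 1 i j x * v i * w j =
      2 * r / (1 + r * x 0) * (v 0 * w 1 + v 1 * w 0) := by
  simp [christoffel_solDisc hx, Fin.sum_univ_two]
  ring

theorem solDisc_posDef {r : ℝ} {x : R 2} (hx : 1 + r * x 0 ≠ 0) : (solDisc r x).PosDef := by
  have : solDisc r x = Matrix.diagonal ![1, (1 + r * x 0) ^ 4] := by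
    ext i j; fin_cases i <;> fin_cases j <;> simp [solDisc]
  rw [this, Matrix.posDef_diagonal_iff]
  intro i
  fin_cases i
  · simp
  · simp only [Fin.mk_one, Matrix.cons_val_one, Matrix.cons_val_fin_one]
    positivity

/-- The displacement in unit time due to the acceleration. -/
noncomputable def endL : CI × CI →L[ℝ] ℝ × ℝ :=
  ((ContinuousMap.evalCLM ℝ (⟨1, by simp⟩ : Set.Icc (0 : ℝ) 1)).comp
    ((primL.comp primL).comp (ContinuousLinearMap.fst ℝ CI CI))).prod
  ((ContinuousMap.evalCLM ℝ (⟨1, by simp⟩ : Set.Icc (0 : ℝ) 1)).comp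
    ((primL.comp primL).comp (ContinuousLinearMap.snd ℝ CI CI)))

theorem endL_apply (h : CI × CI) : endL h = (prim (primL h.1) 1, prim (primL h.2) 1) := rfl

/-- The witness is the acceleration of the arc. By the velocity bounds it is quadratic in `r`, and
for `r ≤ 1 / 100` it is at most `7 r`. This smallness brings the arc within reach of the uniqueness
part of the implicit function theorem. -/
theorem IsSolGeodesic.exists_geodEqn {A B P Q : ℝ → ℝ} (h : IsSolGeodesic A B P Q) {r : ℝ}
    (hr : r ≤ 1 / 100) (hA : ∀ t ∈ Set.Icc (0 : ℝ) 1, |A t| ≤ r)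
    (hB : ∀ t ∈ Set.Icc (0 : ℝ) 1, |B t| ≤ r) :
    ∃ a : CI × CI, ‖a‖ ≤ 7 * r ∧ geodEqn (((A 0, B 0), (P 0, Q 0)), a) = 0 ∧
      (A 1, B 1) = (A 0, B 0) + (P 0, Q 0) + endL a := by
  have h11 : (1 : ℝ) ∈ Set.Icc (0 : ℝ) 1 := by simp
  have hr0 : 0 ≤ r := (abs_nonneg _).trans (hA 1 h11)
  have hv := h.abs_velocity_le (by linarith) hA hB
  have hpos : ∀ t ∈ Set.Icc (0 : ℝ) 1, 9 / 10 ≤ 1 + A t := fun t ht => by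
    linarith [(abs_le.1 (hA t ht)).1]
  have cA : Continuous fun t : Set.Icc (0 : ℝ) 1 => A t := continuousOn_iff_continuous_domRestrict.1
    fun t ht => (h.derivA t ht).continuousWithinAt
  have cP : Continuous fun t : Set.Icc (0 : ℝ) 1 => P t := continuousOn_iff_continuous_domRestrict.1
    fun t ht => (h.derivP t ht).continuousWithinAt
  have cQ : Continuous fun t : Set.Icc (0 : ℝ) 1 => Q t := continuousOn_iff_continuous_domRestrict.1
    fun t ht => (h.derivQ t ht).continuousWithinAt
  let a₀ : CI := ⟨fun t => 2 * (1 + A t) ^ 3 * Q t ^ 2,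
    (continuous_const.mul ((continuous_const.add cA).pow 3)).mul (cQ.pow 2)⟩
  let a₁ : CI := ⟨fun t => -(4 * P t * Q t / (1 + A t)),
    (((continuous_const.mul cP).mul cQ).div (continuous_const.add cA)
      fun t => ne_of_gt (lt_of_lt_of_le (by norm_num) (hpos t t.2))).neg⟩
  have hP : ∀ t ∈ Set.Icc (0 : ℝ) 1, P t = P 0 + prim a₀ t := fun t ht =>
    eq_add_prim (h := a₀) h.derivP ht
  have hQ : ∀ t ∈ Set.Icc (0 : ℝ) 1, Q t = Q 0 + prim a₁ t := fun t ht =>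
    eq_add_prim (h := a₁) h.derivQ ht
  have hlin : ∀ {f g : ℝ → ℝ} {b : CI}, (∀ t ∈ Set.Icc (0 : ℝ) 1,
      HasDerivWithinAt f (g t) (Set.Icc 0 1) t) → (∀ t ∈ Set.Icc (0 : ℝ) 1, g t = g 0 + prim b t) →
      ∀ t ∈ Set.Icc (0 : ℝ) 1, f t = f 0 + g 0 * t + prim (primL b) t := by
    intro f g b hf hg t ht
    have := eq_add_prim (f := fun t => f t - g 0 * t) (h := primL b) (fun t ht => by
      have h1 := (hf t ht).sub ((hasDerivWithinAt_id t (Set.Icc (0 : ℝ) 1)).const_mul (g 0))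
      rw [hg t ht] at h1
      refine h1.congr_deriv ?_
      rw [primL_apply]; ring) ht
    simp only [mul_zero, sub_zero] at this
    linarith
  have hA' := hlin h.derivA hP
  have hB' := hlin h.derivB hQ
  refine ⟨(a₀, a₁), ?_, ?_, ?_⟩
  · rw [Prod.norm_def]
    refine max_le ((ContinuousMap.norm_le _ (by positivity)).2 fun t => ?_)
      ((ContinuousMap.norm_le _ (by positivity)).2 fun t => ?_)
    · obtain ⟨hp, hq⟩ := hv t t.2
      have h1 := hpos t t.2
      have h2 : 1 + A t ≤ 11 / 10 := by linarith [(abs_le.1 (hA t t.2)).2]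
      have h3 : (1 + A t) ^ 3 ≤ (11 / 10 : ℝ) ^ 3 := pow_le_pow_left₀ (by linarith) h2 3
      have h4 : Q t ^ 2 ≤ (5 * r) ^ 2 := sq_le_sq' (abs_le.1 hq).1 (abs_le.1 hq).2
      change |2 * (1 + A t) ^ 3 * Q t ^ 2| ≤ 7 * r
      rw [abs_of_nonneg (by positivity)]
      calc 2 * (1 + A t) ^ 3 * Q t ^ 2 ≤ 2 * (11 / 10 : ℝ) ^ 3 * (5 * r) ^ 2 := by gcongr
        _ ≤ 7 * r := by norm_num; nlinarith
    · obtain ⟨hp, hq⟩ := hv t t.2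
      have h1 := hpos t t.2
      change |-(4 * P t * Q t / (1 + A t))| ≤ 7 * r
      rw [abs_neg, abs_div, abs_mul, abs_mul, abs_of_pos (by linarith : 0 < 1 + A t),
        div_le_iff₀ (by linarith)]
      calc |(4 : ℝ)| * |P t| * |Q t| ≤ 4 * (7 * r) * (5 * r) := by
            rw [abs_of_pos (by norm_num : (0 : ℝ) < 4)]; gcongr
        _ ≤ 7 * r * (9 / 10) := by nlinarith
        _ ≤ 7 * r * (1 + A t) := by gcongr
  · refine Prod.ext ?_ ?_
    · ext t
      change 2 * (1 + A t) ^ 3 * Q t ^ 2 - 2 * (1 + (A 0 * 1 + P 0 * (t : ℝ) + prim (primL a₀) t)) ^ 3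
        * (Q 0 * 1 + prim a₁ t) ^ 2 = 0
      rw [hA' t t.2, hQ t t.2]
      ring
    · ext t
      change (1 + (A 0 * 1 + P 0 * (t : ℝ) + prim (primL a₀) t)) * -(4 * P t * Q t / (1 + A t))
        + 4 * (P 0 * 1 + prim a₀ t) * (Q 0 * 1 + prim a₁ t) = 0
      rw [mul_one, mul_one, mul_one, ← hA' t t.2, ← hQ t t.2, ← hP t t.2]
      have : 1 + A t ≠ 0 := by linarith [hpos t t.2]
      field_simp
      ring
  · rw [hA' 1 h11, hB' 1 h11, endL_apply]
    simp

/-- The converse, from solutions in `C([0,1])` to geodesics. The second component of `geodEqn` was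
cleared of its denominator, so `1 + a` has to be nonzero to recover the equation for the
acceleration. -/
theorem isSolGeodesic_of_geodEqn {x v : ℝ × ℝ} {a : CI × CI} (h : geodEqn ((x, v), a) = 0)
    (hne : ∀ t ∈ Set.Icc (0 : ℝ) 1, 1 + (x.1 + v.1 * t + prim (primL a.1) t) ≠ 0) :
    IsSolGeodesic (fun t => x.1 + v.1 * t + prim (primL a.1) t)
      (fun t => x.2 + v.2 * t + prim (primL a.2) t)
      (fun t => v.1 + prim a.1 t) (fun t => v.2 + prim a.2 t) := by
  have hpos : ∀ (c d : ℝ) (b : CI), ∀ t ∈ Set.Icc (0 : ℝ) 1,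
      HasDerivWithinAt (fun t => c + d * t + prim (primL b) t) (d + prim b t) (Set.Icc 0 1) t := by
    intro c d b t ht
    have h1 := ((((hasDerivAt_id t).const_mul d).const_add c).add
      (hasDerivAt_prim (primL b) t)).hasDerivWithinAt (s := Set.Icc 0 1)
    rw [Set.IccExtend_of_mem _ _ ht, primL_apply] at h1
    exact h1.congr_deriv (by simp)
  have hvel : ∀ (d : ℝ) (b : CI), ∀ t (ht : t ∈ Set.Icc (0 : ℝ) 1),
      HasDerivWithinAt (fun t => d + prim b t) (b ⟨t, ht⟩) (Set.Icc 0 1) t := by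
    intro d b t ht
    have h1 := ((hasDerivAt_prim b t).const_add d).hasDerivWithinAt (s := Set.Icc 0 1)
    rwa [Set.IccExtend_of_mem _ _ ht] at h1
  refine ⟨hpos _ _ _, hpos _ _ _, fun t ht => (hvel v.1 a.1 t ht).congr_deriv ?_,
    fun t ht => (hvel v.2 a.2 t ht).congr_deriv ?_⟩
  · have h1 := congrArg (fun b : CI => b ⟨t, ht⟩) (congrArg Prod.fst h)
    change a.1 ⟨t, ht⟩ - 2 * (1 + (x.1 * 1 + v.1 * t + prim (primL a.1) t)) ^ 3
        * (v.2 * 1 + prim a.2 t) ^ 2 = 0 at h1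
    linear_combination h1
  · have h1 := congrArg (fun b : CI => b ⟨t, ht⟩) (congrArg Prod.snd h)
    change (1 + (x.1 * 1 + v.1 * t + prim (primL a.1) t)) * a.2 ⟨t, ht⟩
        + 4 * (v.1 * 1 + prim a.1 t) * (v.2 * 1 + prim a.2 t) = 0 at h1
    have := hne t ht
    rw [mul_one, mul_one, mul_one] at h1
    field_simp
    linear_combination h1

theorem abs_apply_le_one {x : R 2} (hx : x ∈ closedBall (0 : R 2) 1) (k : Fin 2) : |x k| ≤ 1 :=
  (PiLp.norm_apply_le x k).trans (by simpa using hx)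

theorem one_add_mul_ne_zero {r : ℝ} (hr : 0 < r) (hr' : r ≤ 1 / 10) {x : R 2}
    (hx : x ∈ closedBall (0 : R 2) 1) : 1 + r * x 0 ≠ 0 := by
  have := (abs_le.1 (abs_apply_le_one hx 0)).1
  nlinarith

/-- Multiplication by `r` is a homothety of the unit disc with metric `solDisc r` onto the disc of
radius `r` in the surface `da² + (1 + a)⁴ db²`. All the estimates are made on the latter. -/
theorem IsGeodesicInBall.isSolGeodesic {r : ℝ} (hr : 0 < r) (hr' : r ≤ 1 / 10) {γ w : ℝ → R 2}
    (h : IsGeodesicInBall (solDisc r) γ w) :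
    IsSolGeodesic (fun t => r * γ t 0) (fun t => r * γ t 1) (fun t => r * w t 0)
      (fun t => r * w t 1) := by
  have hγ : ∀ k : Fin 2, ∀ t ∈ Set.Icc (0 : ℝ) 1,
      HasDerivWithinAt (fun t => r * γ t k) (r * w t k) (Set.Icc 0 1) t := fun k t ht =>
    ((EuclideanSpace.proj k : R 2 →L[ℝ] ℝ).hasFDerivAt.comp_hasDerivWithinAt t
      (h.velocity t ht)).const_mul r
  refine ⟨hγ 0, hγ 1, fun t ht => ((h.geodesic t ht 0).const_mul r).congr_deriv ?_,
    fun t ht => ((h.geodesic t ht 1).const_mul r).congr_deriv ?_⟩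
  · rw [sum_christoffel_solDisc_zero (one_add_mul_ne_zero hr hr' (h.mem t ht))]
    ring
  · have := one_add_mul_ne_zero hr hr' (h.mem t ht)
    rw [sum_christoffel_solDisc_one this]
    field_simp
    ring

theorem IsSolGeodesic.isGeodesicInBall {r : ℝ} (hr : 0 < r) (hr' : r ≤ 1 / 10)
    {A B P Q : ℝ → ℝ} (h : IsSolGeodesic A B P Q)
    (hm : ∀ t ∈ Set.Icc (0 : ℝ) 1, A t ^ 2 + B t ^ 2 ≤ r ^ 2) :
    IsGeodesicInBall (solDisc r) (fun t => !₂[r⁻¹ * A t, r⁻¹ * B t])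
      (fun t => !₂[r⁻¹ * P t, r⁻¹ * Q t]) := by
  have hmem : ∀ t ∈ Set.Icc (0 : ℝ) 1, !₂[r⁻¹ * A t, r⁻¹ * B t] ∈ closedBall (0 : R 2) 1 := by
    intro t ht
    rw [mem_closedBall_zero_iff, ← sq_le_one_iff₀ (norm_nonneg _), EuclideanSpace.real_norm_sq_eq,
      Fin.sum_univ_two]
    have h1 := hm t ht
    calc (r⁻¹ * A t) ^ 2 + (r⁻¹ * B t) ^ 2 = (A t ^ 2 + B t ^ 2) / r ^ 2 := by field_simp
      _ ≤ 1 := (div_le_one (by positivity)).2 h1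
  refine ⟨hmem, fun t ht => ?_, fun t ht k => ?_⟩
  · have e1 : ∀ a b : ℝ, !₂[a, b] = a • e 0 + b • (e 1 : R 2) := fun a b => by
      ext k; fin_cases k <;> simp [e]
    simp only [e1]
    exact (((h.derivA t ht).const_mul r⁻¹).smul_const _).add
      (((h.derivB t ht).const_mul r⁻¹).smul_const _)
  · have h1 := one_add_mul_ne_zero hr hr' (hmem t ht)
    have e1 : r * (!₂[r⁻¹ * A t, r⁻¹ * B t] : R 2) 0 = A t := by simp [hr.ne']
    rw [e1] at h1
    fin_cases k
    · refine ((h.derivP t ht).const_mul r⁻¹).congr_deriv ?_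
      have := sum_christoffel_solDisc_zero (one_add_mul_ne_zero hr hr' (hmem t ht))
        (!₂[r⁻¹ * P t, r⁻¹ * Q t]) (!₂[r⁻¹ * P t, r⁻¹ * Q t])
      refine Eq.trans ?_ (congrArg Neg.neg this).symm
      rw [e1]
      simp
      field_simp
    · refine ((h.derivQ t ht).const_mul r⁻¹).congr_deriv ?_
      have := sum_christoffel_solDisc_one (one_add_mul_ne_zero hr hr' (hmem t ht))
        (!₂[r⁻¹ * P t, r⁻¹ * Q t]) (!₂[r⁻¹ * P t, r⁻¹ * Q t])
      refine Eq.trans ?_ (congrArg Neg.neg this).symm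
      rw [e1]
      simp
      field_simp
      ring

/-- A sufficiently small disc of the surface `da² + (1 + a)⁴ db²` is simple. -/
theorem exists_isSimpleDisc_solDisc : ∃ r : ℝ, 0 < r ∧ r ≤ 1 / 100 ∧ IsSimpleDisc (solDisc r) := by
  -- `H` is the acceleration as a function of initial position and velocity. Only its smoothness and
  -- uniqueness are needed.
  obtain ⟨H, ρ₁, hρ₁, -, hHs, -, hHu⟩ :=
    exists_implicit_of_hasFDerivAt_snd contDiff_geodEqn geodEqn_zero hasFDerivAt_geodEqn
  -- `Λ` turns the data of two endpoints `x, y` into a position and a velocity: the arc with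
  -- acceleration `a` ends at `y` when its initial velocity is `y - x - endL a`. As `Λ` leaves the
  -- acceleration untouched, the linearization is again the projection, and `K` gives the
  -- acceleration in terms of the endpoints.
  let Λ : Data × (CI × CI) →L[ℝ] Data × (CI × CI) :=
    (((ContinuousLinearMap.fst ℝ _ _).comp (ContinuousLinearMap.fst ℝ _ _)).prod
      ((ContinuousLinearMap.snd ℝ _ _).comp (ContinuousLinearMap.fst ℝ _ _)
        - (ContinuousLinearMap.fst ℝ _ _).comp (ContinuousLinearMap.fst ℝ _ _)
        - endL.comp (ContinuousLinearMap.snd ℝ _ _))).prod (ContinuousLinearMap.snd ℝ _ _)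
  have hΛ : ∀ x y a, Λ ((x, y), a) = ((x, y - x - endL a), a) := fun _ _ _ => rfl
  obtain ⟨K, ρ₂, hρ₂, hK0, hKs, hKe, hKu⟩ :=
    exists_implicit_of_hasFDerivAt_snd (f := geodEqn ∘ Λ) (contDiff_geodEqn.comp Λ.contDiff)
      (by rw [Function.comp_apply, map_zero, geodEqn_zero])
      (by
        have h1 : HasFDerivAt geodEqn (ContinuousLinearMap.snd ℝ Data (CI × CI)) (Λ 0) := by
          rw [map_zero]; exact hasFDerivAt_geodEqn
        exact h1.comp 0 Λ.hasFDerivAt)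
  -- With accelerations below `1 / 100` and endpoints in the disc of radius `r ≤ 1 / 100`, the arc
  -- stays in the square `|a|, |b| ≤ 1 / 10` where the convexity estimate holds.
  have hKc : ∀ᶠ θ in nhds (0 : Data), ‖K θ‖ < 1 / 100 := by
    have h1 : ContinuousAt K 0 := hKs.continuousOn.continuousAt (ball_mem_nhds _ hρ₂)
    have h2 := h1.norm
    rw [ContinuousAt, hK0, norm_zero] at h2
    exact h2.eventually_lt_const (by norm_num)
  obtain ⟨ρ₃, hρ₃, hKb⟩ := Metric.eventually_nhds_iff_ball.1 hKc
  set ρ := min ρ₁ (min ρ₂ ρ₃) with hρ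
  have hρ0 : 0 < ρ := lt_min hρ₁ (lt_min hρ₂ hρ₃)
  have hρle₁ : ρ ≤ ρ₁ := min_le_left _ _
  have hρle₂ : ρ ≤ ρ₂ := (min_le_right _ _).trans (min_le_left _ _)
  have hρle₃ : ρ ≤ ρ₃ := (min_le_right _ _).trans (min_le_right _ _)
  -- Positions, velocities and accelerations of arcs in the disc are at most `7 r` in norm, and all
  -- have to lie in the ball of radius `ρ`.
  set r := min (1 / 100) (ρ / 8) with hr
  have hr0 : 0 < r := lt_min (by norm_num) (by positivity)
  have hr1 : r ≤ 1 / 100 := min_le_left _ _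
  have hrρ : 7 * r < ρ := by
    have : r ≤ ρ / 8 := min_le_right _ _
    linarith
  have hr10 : r ≤ 1 / 10 := by linarith
  let sc : R 2 → ℝ × ℝ := fun x => (r * x 0, r * x 1)
  have hsc : ContDiff ℝ ∞ sc := by fun_prop
  have hscle : ∀ x ∈ closedBall (0 : R 2) 1, ‖sc x‖ ≤ r := by
    intro x hx
    have hk : ∀ k, ‖r * x k‖ ≤ r := fun k => by
      rw [Real.norm_eq_abs, abs_mul, abs_of_pos hr0]
      exact mul_le_of_le_one_right hr0.le (abs_apply_le_one hx k)
    exact max_le (hk 0) (hk 1)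
  have hscinj : ∀ x y : R 2, sc x = sc y → x = y := by
    intro x y hxy
    simp only [sc, Prod.mk.injEq] at hxy
    ext k
    fin_cases k
    exacts [mul_left_cancel₀ hr0.ne' hxy.1, mul_left_cancel₀ hr0.ne' hxy.2]
  let us : ℝ × ℝ → R 2 := fun q => !₂[r⁻¹ * q.1, r⁻¹ * q.2]
  have hus : ContDiff ℝ ∞ us := by
    refine contDiff_euclidean.2 fun i => ?_
    fin_cases i <;> simp [us] <;> fun_prop
  have hscus : ∀ q, sc (us q) = q := fun q => by
    refine Prod.ext ?_ ?_ <;> simp [sc, us, hr0.ne']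
  have hball : ∀ {a b : ℝ × ℝ} {s : ℝ}, ‖a‖ < s → ‖b‖ < s → (a, b) ∈ ball (0 : Data) s := by
    intro a b s ha hb
    rw [mem_ball_zero_iff]
    exact max_lt ha hb
  -- a geodesic in the disc is determined by its initial velocity and by its endpoints
  have huniq : ∀ x ∈ closedBall (0 : R 2) 1, ∀ v y, ExpEq (solDisc r) x v y →
      y ∈ closedBall (0 : R 2) 1 ∧ ‖sc v‖ < ρ ∧
      sc y = sc x + sc v + endL (H (sc x, sc v)) ∧
      sc v = sc y - sc x - endL (K (sc x, sc y)) := by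
    rintro x hx v y ⟨γ, w, hγ, rfl, rfl, rfl⟩
    have hg := hγ.isSolGeodesic hr0 hr10
    have hb : ∀ k, ∀ t ∈ Set.Icc (0 : ℝ) 1, |r * γ t k| ≤ r := fun k t ht => by
      rw [abs_mul, abs_of_pos hr0]
      exact mul_le_of_le_one_right hr0.le (abs_apply_le_one (hγ.mem t ht) k)
    have hv := hg.abs_velocity_le hr10 (hb 0) (hb 1) 0 (by simp)
    obtain ⟨a, ha, he, hend⟩ := hg.exists_geodEqn hr1 (hb 0) (hb 1)
    change geodEqn ((sc (γ 0), sc (w 0)), a) = 0 at he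
    change sc (γ 1) = sc (γ 0) + sc (w 0) + endL a at hend
    have hm1 : γ 1 ∈ closedBall (0 : R 2) 1 := hγ.mem 1 (by simp)
    have hvn : ‖sc (w 0)‖ < ρ := by
      refine (max_le ?_ ?_ : ‖sc (w 0)‖ ≤ 7 * r).trans_lt hrρ
      · exact hv.1
      · exact hv.2.trans (by linarith)
    have hxn : ‖sc (γ 0)‖ < ρ := (hscle _ hx).trans_lt (by linarith)
    have hyn : ‖sc (γ 1)‖ < ρ := (hscle _ hm1).trans_lt (by linarith)
    have han : ‖a‖ < ρ := ha.trans_lt hrρ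
    have hH : H (sc (γ 0), sc (w 0)) = a :=
      hHu _ (hball (hxn.trans_le hρle₁) (hvn.trans_le hρle₁)) a
        (mem_ball_zero_iff.2 (han.trans_le hρle₁)) he
    have hK : K (sc (γ 0), sc (γ 1)) = a := by
      refine hKu _ (hball (hxn.trans_le hρle₂) (hyn.trans_le hρle₂)) a
        (mem_ball_zero_iff.2 (han.trans_le hρle₂)) ?_
      rw [Function.comp_apply, hΛ, hend]
      rwa [show sc (γ 0) + sc (w 0) + endL a - sc (γ 0) - endL a = sc (w 0) by abel]
    refine ⟨hm1, hvn, ?_, ?_⟩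
    · rw [hH, hend]
    · rw [hK, hend]; abel
  -- any two points of the disc are joined by a geodesic in the disc
  have hexist : ∀ x ∈ closedBall (0 : R 2) 1, ∀ y ∈ closedBall (0 : R 2) 1,
      ExpEq (solDisc r) x (us (sc y - sc x - endL (K (sc x, sc y)))) y := by
    intro x hx y hy
    have hxr := hscle x hx
    have hyr := hscle y hy
    have hxn : ‖sc x‖ < ρ := hxr.trans_lt (by linarith)
    have hyn : ‖sc y‖ < ρ := hyr.trans_lt (by linarith)
    set a := K (sc x, sc y) with ha
    have hae : geodEqn ((sc x, sc y - sc x - endL a), a) = 0 :=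
      hKe _ (hball (hxn.trans_le hρle₂) (hyn.trans_le hρle₂))
    have han : ‖a‖ < 1 / 100 := hKb _ (hball (hxn.trans_le hρle₃) (hyn.trans_le hρle₃))
    set v := sc y - sc x - endL a with hv
    have hpr : ∀ b : CI, ‖b‖ ≤ ‖a‖ → ∀ t ∈ Set.Icc (0 : ℝ) 1, |prim (primL b) t| ≤ 1 / 100 :=
      fun b hb t ht => ((abs_prim_le _ ht).trans (norm_primL_le b)).trans (hb.trans han.le)
    have hsmall : ∀ (c d : ℝ) (b : CI), ‖b‖ ≤ ‖a‖ → |c| ≤ r → |d| ≤ r → ∀ t ∈ Set.Icc (0 : ℝ) 1,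
        |c + (d - c - prim (primL b) 1) * t + prim (primL b) t| ≤ 1 / 10 := by
      intro c d b hb hc hd t ht
      have h1 := hpr b hb t ht
      have h2 := hpr b hb 1 (by simp)
      have h3 : |d - c - prim (primL b) 1| ≤ 3 / 100 := by
        refine (abs_sub _ _).trans ?_
        linarith [abs_sub d c]
      have h4 : |(d - c - prim (primL b) 1) * t| ≤ 3 / 100 := by
        rw [abs_mul, abs_of_nonneg ht.1]
        exact (mul_le_of_le_one_right (abs_nonneg _) ht.2).trans h3
      refine (abs_add_le _ _).trans ?_
      linarith [abs_add_le c ((d - c - prim (primL b) 1) * t)]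
    have hA := hsmall (r * x 0) (r * y 0) a.1 (norm_fst_le a)
      ((norm_fst_le (sc x)).trans hxr) ((norm_fst_le (sc y)).trans hyr)
    have hB := hsmall (r * x 1) (r * y 1) a.2 (norm_snd_le a)
      ((norm_snd_le (sc x)).trans hxr) ((norm_snd_le (sc y)).trans hyr)
    have hg := isSolGeodesic_of_geodEqn hae fun t ht => by
      have := (abs_le.1 (hA t ht)).1
      change 1 + (r * x 0 + (r * y 0 - r * x 0 - prim (primL a.1) 1) * t + prim (primL a.1) t) ≠ 0
      linarith
    have hsq : ∀ z ∈ closedBall (0 : R 2) 1, (r * z 0) ^ 2 + (r * z 1) ^ 2 ≤ r ^ 2 := by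
      intro z hz
      rw [mem_closedBall_zero_iff, ← sq_le_one_iff₀ (norm_nonneg _),
        EuclideanSpace.real_norm_sq_eq, Fin.sum_univ_two] at hz
      nlinarith [sq_nonneg r]
    have e0 : ∀ (c d : ℝ) (b : CI),
        c + (d - c - prim (primL b) 1) * 0 + prim (primL b) 0 = c := fun c d b => by
      rw [prim_zero]; ring
    have e1 : ∀ (c d : ℝ) (b : CI),
        c + (d - c - prim (primL b) 1) * 1 + prim (primL b) 1 = d := fun c d b => by ring
    -- So far the arc is only known to lie in the larger square; convexity of `a² + b²` returns it
    -- to the disc containing its endpoints.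
    have hm := hg.norm_sq_le hA hB (m := r ^ 2)
      (by
        refine le_of_eq_of_le ?_ (hsq x hx)
        exact congrArg₂ (fun p q : ℝ => p ^ 2 + q ^ 2) (e0 _ _ _) (e0 _ _ _))
      (by
        refine le_of_eq_of_le ?_ (hsq y hy)
        exact congrArg₂ (fun p q : ℝ => p ^ 2 + q ^ 2) (e1 _ _ _) (e1 _ _ _))
    refine ⟨_, _, hg.isGeodesicInBall hr0 hr10 hm, hscinj _ _ ?_, ?_, hscinj _ _ ?_⟩
    · exact (hscus _).trans (congrArg₂ Prod.mk (e0 _ _ _) (e0 _ _ _))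
    · simp only [prim_zero, add_zero, us]
    · exact (hscus _).trans (congrArg₂ Prod.mk (e1 _ _ _) (e1 _ _ _))
  refine ⟨r, hr0, hr1, ?_, ?_, ?_⟩
  · refine ⟨{x | 1 + r * x 0 ≠ 0}, isOpen_ne_fun (by fun_prop) continuous_const,
      fun x hx => one_add_mul_ne_zero hr0 hr10 hx, fun i j => ?_, fun x hx => solDisc_posDef hx⟩
    fin_cases i <;> fin_cases j <;> simp [solDisc] <;> fun_prop
  · intro x v hx hv0 _
    have hxb : x ∈ closedBall (0 : R 2) 1 := by simp [hx]
    have hne := one_add_mul_ne_zero hr0 hr10 hxb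
    have hx0 := abs_apply_le_one hxb 0
    have hx1 := abs_apply_le_one hxb 1
    have hv2 : 0 < ‖v‖ ^ 2 := by positivity
    rw [EuclideanSpace.real_norm_sq_eq, Fin.sum_univ_two] at hv2
    have hlo : 9 / 10 ≤ 1 + r * x 0 := by nlinarith [(abs_le.1 hx0).1]
    have hhi : 1 + r * x 0 ≤ 11 / 10 := by nlinarith [(abs_le.1 hx0).2]
    have h3 : (1 + r * x 0) ^ 3 ≤ (11 / 10 : ℝ) ^ 3 := pow_le_pow_left₀ (by linarith) hhi 3
    have h4 : |x 0 * (2 * r * (1 + r * x 0) ^ 3)| ≤ 1 / 10 := by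
      rw [abs_mul, abs_of_nonneg (by positivity : 0 ≤ 2 * r * (1 + r * x 0) ^ 3)]
      calc |x 0| * (2 * r * (1 + r * x 0) ^ 3) ≤ 1 * (2 * (1 / 100) * (11 / 10 : ℝ) ^ 3) := by
            gcongr
        _ ≤ 1 / 10 := by norm_num
    have h5 : |x 1 * (2 * r / (1 + r * x 0))| ≤ 1 / 10 := by
      rw [abs_mul, abs_of_nonneg (by positivity : 0 ≤ 2 * r / (1 + r * x 0))]
      calc |x 1| * (2 * r / (1 + r * x 0)) ≤ 1 * (2 * (1 / 100) / (9 / 10)) := by gcongr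
        _ ≤ 1 / 10 := by norm_num
    have e1 : ∑ i, ∑ j, ((if i = j then 1 else 0)
        - ∑ k, x k * christoffel (solDisc r) k i j x) * v i * v j =
        v 0 ^ 2 + v 1 ^ 2 + x 0 * (2 * r * (1 + r * x 0) ^ 3) * v 1 ^ 2
          - 2 * (x 1 * (2 * r / (1 + r * x 0))) * (v 0 * v 1) := by
      simp only [christoffel_solDisc hne, Fin.sum_univ_two]
      simp
      ring
    rw [e1]
    set m := x 0 * (2 * r * (1 + r * x 0) ^ 3)
    set k := x 1 * (2 * r / (1 + r * x 0))
    obtain ⟨hm₁, hm₂⟩ := abs_le.1 h4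
    obtain ⟨hk₁, hk₂⟩ := abs_le.1 h5
    nlinarith [mul_nonneg (sub_nonneg.2 hm₁) (sq_nonneg (v 1)),
      mul_nonneg (sub_nonneg.2 hk₁) (sq_nonneg (v 0 - v 1)),
      mul_nonneg (sub_nonneg.2 hk₂) (sq_nonneg (v 0 + v 1)), sq_nonneg (v 0 - v 1),
      sq_nonneg (v 0 + v 1)]
  · intro x hx
    have hxn : ‖sc x‖ < ρ := (hscle _ hx).trans_lt (by linarith)
    -- The exponential map and its inverse are the two displacement formulas, with the acceleration
    -- supplied by `H` and by `K`. They are mutually inverse because a geodesic arc in the disc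
    -- satisfies both formulas.
    refine ⟨fun v => us (sc x + sc v + endL (H (sc x, sc v))),
      fun y => us (sc y - sc x - endL (K (sc x, sc y))), ?_, ⟨?_, ?_⟩, ?_, ?_, ?_⟩
    · rintro v ⟨y, hy⟩
      have := (huniq x hx v y hy).2.2.1
      have hy' : us (sc x + sc v + endL (H (sc x, sc v))) = y := hscinj _ _ (by rw [hscus, this])
      simp only [hy']; exact hy
    · rintro v ⟨y, hy⟩
      obtain ⟨-, -, h1, h2⟩ := huniq x hx v y hy
      refine hscinj _ _ ?_
      simp only [hscus]
      rw [← h1, ← h2]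
    · intro y hy
      obtain ⟨-, -, h1, -⟩ := huniq x hx _ y (hexist x hx y hy)
      refine hscinj _ _ ?_
      rw [hscus, ← h1]
    · intro y hy
      exact ⟨y, hexist x hx y hy⟩
    · have h1 : ContDiffOn ℝ ∞ (fun v => H (sc x, sc v)) (expDomain (solDisc r) x) :=
        hHs.comp (by fun_prop) fun v ⟨y, hy⟩ =>
          hball (hxn.trans_le hρle₁) ((huniq x hx v y hy).2.1.trans_le hρle₁)
      exact hus.comp_contDiffOn ((contDiffOn_const.add hsc.contDiffOn).add
        (endL.contDiff.comp_contDiffOn h1))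
    · have h1 : ContDiffOn ℝ ∞ (fun y => K (sc x, sc y)) (closedBall 0 1) :=
        hKs.comp (by fun_prop) fun y hy =>
          hball (hxn.trans_le hρle₂) (((hscle _ hy).trans_lt (by linarith)).trans_le hρle₂)
      exact hus.comp_contDiffOn ((hsc.contDiffOn.sub contDiffOn_const).sub
        (endL.contDiff.comp_contDiffOn h1))

end SolDisc

end Carleman

namespace Carleman

/-! ### Sol -/

/-- Factor `e^{2z} dx² + e^{-2z} dy² + dz² = e^{2z} (dx² + e^{-4z} dy² + e^{-2z} dz²)`; with `1 + a
= e^{-z}` the bracket is `dx² + da² + (1 + a)⁴ dy²`. The coordinates are centred at `p` by measuring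
`z` from `p 2` and rescaling `x` and `y` by `e^{p 2}` and `e^{-p 2}`. Division by `r` makes the
small disc the unit disc. -/
theorem sol_locallyAdmissible : LocallyAdmissible (𝓡 3) solMetric := by
  obtain ⟨r, hr, -, hG⟩ := exists_isSimpleDisc_solDisc
  intro p
  have hr0 : r ≠ 0 := hr.ne'
  let τ : R 3 → ℝ := fun x => Real.exp (p 2) / r * x 0
  let σ : R 3 → R 2 := fun x =>
    !₂[(Real.exp (-(x 2 - p 2)) - 1) / r, (x 1 - p 1) * Real.exp (-p 2) / r]
  let c : R 3 → ℝ := fun x => r ^ 2 * Real.exp (2 * (x 2 - p 2))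
  have hτ : ContDiff ℝ ∞ τ := by simp only [τ]; fun_prop
  have hσ : ContDiff ℝ ∞ σ := contDiff_euclidean.2 fun i => by
    fin_cases i <;> simp [σ] <;> fun_prop
  have hc : ContDiff ℝ ∞ c := by simp only [c]; fun_prop
  have hx : ∀ (k : Fin 3) (x : R 3), HasFDerivAt (fun y : R 3 => y k)
      (EuclideanSpace.proj k : R 3 →L[ℝ] ℝ) x := fun k x =>
    (EuclideanSpace.proj k : R 3 →L[ℝ] ℝ).hasFDerivAt
  have dτ : ∀ x v, fderiv ℝ τ x v = Real.exp (p 2) / r * v 0 := fun x v => by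
    rw [((hx 0 x).const_mul (Real.exp (p 2) / r)).fderiv]; simp
  have dσ : ∀ x v i, fderiv ℝ σ x v i = fderiv ℝ (fun y => σ y i) x v := fun x v i => by
    have := ((EuclideanSpace.proj i : R 2 →L[ℝ] ℝ).hasFDerivAt.comp x
      (hσ.differentiable (by simp) x).hasFDerivAt).fderiv
    exact (congrArg (fun L : R 3 →L[ℝ] ℝ => L v) this).symm
  have dσ0 : ∀ x v, fderiv ℝ σ x v 0 = -(Real.exp (-(x 2 - p 2)) / r * v 2) := fun x v => by
    have h := ((((hx 2 x).sub_const (p 2)).fun_neg.exp.sub_const 1).mul_const r⁻¹).fderiv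
    rw [dσ]
    refine (congrArg (fun L : R 3 →L[ℝ] ℝ => L v) h).trans ?_
    simp; ring
  have dσ1 : ∀ x v, fderiv ℝ σ x v 1 = Real.exp (-p 2) / r * v 1 := fun x v => by
    have h := ((((hx 1 x).sub_const (p 1)).mul_const (Real.exp (-p 2))).mul_const r⁻¹).fderiv
    rw [dσ]
    refine (congrArg (fun L : R 3 →L[ℝ] ℝ => L v) h).trans ?_
    simp; ring
  refine ⟨σ ⁻¹' ball 0 1, isOpen_ball.preimage hσ.continuous, ?_, solDisc r, τ, σ, c, hG,
    hτ.contMDiff.contMDiffOn, hσ.contMDiff.contMDiffOn, hc.contMDiff.contMDiffOn,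
    fun x h => h, ?_, fun x _ => by positivity, ?_⟩
  · have : σ p = 0 := by ext i; fin_cases i <;> simp [σ]
    simp [this]
  · intro x _ y _ hxy
    obtain ⟨h1, h2⟩ := Prod.mk.inj hxy
    have h3 := congrArg (fun w : R 2 => w 0) h2
    have h4 := congrArg (fun w : R 2 => w 1) h2
    simp only [σ, τ] at h1 h3 h4
    ext i
    fin_cases i
    · exact mul_left_cancel₀ (by positivity) h1
    · simpa [hr0] using h4
    · simpa [hr0] using h3
  · intro x _ v w
    rw [mfderiv_eq_fderiv, mfderiv_eq_fderiv]
    revert v w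
    change ∀ v w : R 3, solMetric x v w = c x * (fderiv ℝ τ x v * fderiv ℝ τ x w
      + ∑ i, ∑ j, solDisc r (σ x) i j * fderiv ℝ σ x v i * fderiv ℝ σ x w j)
    intro v w
    have e1 : 1 + r * σ x 0 = Real.exp (-(x 2 - p 2)) := by
      simp only [σ]; simp; field_simp; ring
    simp only [Fin.sum_univ_two, solDisc, e1, dτ, dσ0, dσ1, c, solMetric]
    simp only [Matrix.of_apply, Matrix.cons_val', Matrix.cons_val_zero, Matrix.cons_val_one,
      Matrix.cons_val_fin_one]
    have a1 : Real.exp (2 * x 2) = Real.exp (2 * (x 2 - p 2)) * Real.exp (p 2) ^ 2 := by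
      rw [← Real.exp_nat_mul, ← Real.exp_add]; congr 1; push_cast; ring
    have a2 : Real.exp (2 * (x 2 - p 2)) * Real.exp (-(x 2 - p 2)) ^ 2 = 1 := by
      rw [← Real.exp_nat_mul, ← Real.exp_add, ← Real.exp_zero]; congr 1; push_cast; ring
    have a3 : Real.exp (-(2 * x 2)) = Real.exp (2 * (x 2 - p 2)) *
        Real.exp (-(x 2 - p 2)) ^ 4 * Real.exp (-p 2) ^ 2 := by
      rw [← Real.exp_nat_mul, ← Real.exp_nat_mul, ← Real.exp_add, ← Real.exp_add]
      congr 1; push_cast; ring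
    rw [a1, a3]
    field_simp
    linear_combination (-(v 2 * w 2)) * a2

theorem sol_locallyAdmitsLCW : LocallyAdmitsLCW (stdBasis 3) (𝓡 3) solMetric :=
  sol_locallyAdmissible.locallyAdmitsLCW (by simp) fun x v hv => by
    have h : ∃ k, (show R 3 from v) k ≠ 0 := by
      by_contra! h
      exact hv (PiLp.ext h)
    change Real.exp (2 * x 2) * ((show R 3 from v) 0 * (show R 3 from v) 0)
      + Real.exp (-(2 * x 2)) * ((show R 3 from v) 1 * (show R 3 from v) 1)
      + (show R 3 from v) 2 * (show R 3 from v) 2 ≠ 0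
    generalize (show R 3 from v) = v at h ⊢
    have h1 := Real.exp_pos (2 * x 2)
    have h2 := Real.exp_pos (-(2 * x 2))
    obtain ⟨k, hk⟩ := h
    have h3 := mul_self_pos.2 hk
    have n0 := mul_nonneg h1.le (mul_self_nonneg (v 0))
    have n1 := mul_nonneg h2.le (mul_self_nonneg (v 1))
    have n2 := mul_self_nonneg (v 2)
    fin_cases k
    · have := mul_pos h1 h3
      simp only [Fin.zero_eta] at this
      exact ne_of_gt (by linarith)
    · have := mul_pos h2 h3
      simp only [Fin.mk_one] at this
      exact ne_of_gt (by linarith)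
    · simp only [Fin.reduceFinMk] at h3
      exact ne_of_gt (by linarith)

end Carleman

namespace Carleman

/-! ### Left-invariant coframes -/

/-- `F` is the matrix of an orthonormal coframe of the metric `G`, and the structure constants of
the dual frame `E` are given by `[E_c, E_d] = ∑ k, (e_c × e_d)_k ∑ a, L k a • E_a`. -/
structure IsCoframe (G F : R 3 → Matrix (Fin 3) (Fin 3) ℝ) (L : Matrix (Fin 3) (Fin 3) ℝ) :
    Prop where
  smooth : ∀ a i, ContDiff ℝ ∞ fun x => F x a i
  det_ne_zero : ∀ x, (F x).det ≠ 0
  metric : ∀ x, G x = (F x)ᵀ * F x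
  structure_eq : ∀ x a i j, pd i (fun y => F y a j) x - pd j (fun y => F y a i) x =
    -∑ k, L k a * crossProduct (fun c => F x c i) (fun c => F x c j) k

/-- The derivative of `f` along the `c`-th field of the frame dual to `F`. -/
noncomputable def lie (F : R 3 → Matrix (Fin 3) (Fin 3) ℝ) (c : Fin 3) (f : R 3 → ℝ) (x : R 3) : ℝ :=
  ∑ i, (F x)⁻¹ i c * pd i f x

variable {G F : R 3 → Matrix (Fin 3) (Fin 3) ℝ} {L : Matrix (Fin 3) (Fin 3) ℝ}

theorem lie_eq_fderiv (c : Fin 3) (f : R 3 → ℝ) (x : R 3) :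
    lie F c f x = fderiv ℝ f x (∑ i, (F x)⁻¹ i c • e i) := by
  simp [lie, pd]

theorem lie_congr {c : Fin 3} {f g : R 3 → ℝ} {x : R 3} (h : f =ᶠ[nhds x] g) :
    lie F c f x = lie F c g x := by
  rw [lie_eq_fderiv, lie_eq_fderiv, h.fderiv_eq]

theorem pd_pd_comm {n : ℕ} {f : R n → ℝ} {x : R n} (hf : ContDiffAt ℝ ∞ f x) (i j : Fin n) :
    pd i (pd j f) x = pd j (pd i f) x := by
  have hd : DifferentiableAt ℝ (fderiv ℝ f) x :=
    (hf.fderiv_right (m := 1) (by exact WithTop.coe_le_coe.2 le_top)).differentiableAt (by simp)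
  have h : ∀ i j, pd i (pd j f) x = fderiv ℝ (fderiv ℝ f) x (e i) (e j) := fun i j => by
    have := (hd.hasFDerivAt.clm_apply (hasFDerivAt_const (e j) x)).fderiv
    refine (congrArg (fun L : R n →L[ℝ] ℝ => L (e i)) this).trans ?_
    simp
  rw [h, h]
  exact (hf.isSymmSndFDerivAt (by simp; exact WithTop.coe_le_coe.2 le_top)).eq (e i) (e j)

theorem contDiffOn_pd {n : ℕ} {U : Set (R n)} (hU : IsOpen U) {f : R n → ℝ}
    (hf : ContDiffOn ℝ ∞ f U) (i : Fin n) : ContDiffOn ℝ ∞ (pd i f) U :=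
  (hf.fderiv_of_isOpen hU (m := ∞) (by simp)).clm_apply contDiffOn_const

namespace IsCoframe

theorem inv_mul (h : IsCoframe G F L) (x : R 3) : (F x)⁻¹ * F x = 1 :=
  Matrix.nonsing_inv_mul _ (isUnit_iff_ne_zero.2 (h.det_ne_zero x))

theorem mul_inv (h : IsCoframe G F L) (x : R 3) : F x * (F x)⁻¹ = 1 :=
  Matrix.mul_nonsing_inv _ (isUnit_iff_ne_zero.2 (h.det_ne_zero x))

theorem contDiff_inv (h : IsCoframe G F L) (i a : Fin 3) : ContDiff ℝ ∞ fun x => (F x)⁻¹ i a := by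
  have hd : ContDiff ℝ ∞ fun x => (F x).det := by
    simp only [Matrix.det_fin_three]
    have := h.smooth
    fun_prop
  simp only [Matrix.inv_def, Matrix.smul_apply, smul_eq_mul, Ring.inverse_eq_inv']
  refine (hd.inv h.det_ne_zero).mul ?_
  simp only [Matrix.adjugate_fin_three]
  have := h.smooth
  fin_cases i <;> fin_cases a <;> simp <;> fun_prop

theorem contDiffOn_lie (h : IsCoframe G F L) {U : Set (R 3)} (hU : IsOpen U) {f : R 3 → ℝ}
    (hf : ContDiffOn ℝ ∞ f U) (c : Fin 3) : ContDiffOn ℝ ∞ (lie F c f) U :=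
  ContDiffOn.sum fun i _ => (h.contDiff_inv i c).contDiffOn.mul (contDiffOn_pd hU hf i)

theorem pd_eq (h : IsCoframe G F L) (f : R 3 → ℝ) (x : R 3) (i : Fin 3) :
    pd i f x = ∑ a, F x a i * lie F a f x := by
  have : (fun j => pd j f x) = (fun j => pd j f x) ᵥ* ((F x)⁻¹ * F x) := by simp [h.inv_mul]
  rw [← Matrix.vecMul_vecMul] at this
  refine (congrFun this i).trans ?_
  simp only [Matrix.vecMul, dotProduct, lie]
  exact Finset.sum_congr rfl fun a _ => by
    rw [mul_comm]; congr 1; exact Finset.sum_congr rfl fun _ _ => mul_comm _ _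

theorem structure_contract (h : IsCoframe G F L) (x : R 3) (a : Fin 3) (p q : Fin 3 → ℝ) :
    ∑ i, ∑ j, p i * q j * (pd i (fun y => F y a j) x - pd j (fun y => F y a i) x) =
      -∑ k, L k a * crossProduct (F x *ᵥ p) (F x *ᵥ q) k := by
  simp only [h.structure_eq, cross_apply, Matrix.mulVec, dotProduct, Fin.sum_univ_three]
  simp
  ring

/-- Expand `df = ∑ (E_a f) ω^a` and use that partial derivatives commute: the commutator of the
frame fields on `f` comes from the structure equation alone. Every integrability condition below is
an instance, applied in turn to `φ`, `log |dφ|` and the components of their differentials. -/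
theorem lie_lie_sub (h : IsCoframe G F L) {f : R 3 → ℝ} {U : Set (R 3)} (hU : IsOpen U)
    (hf : ContDiffOn ℝ ∞ f U) {x : R 3} (hx : x ∈ U) (c d : Fin 3) :
    lie F c (lie F d f) x - lie F d (lie F c f) x =
      ∑ k, crossProduct (Pi.single c 1) (Pi.single d 1) k * ∑ a, L k a * lie F a f x := by
  have hfx := hf.contDiffAt (hU.mem_nhds hx)
  have dl : ∀ a, DifferentiableAt ℝ (lie F a f) x := fun a =>
    ((h.contDiffOn_lie hU hf a).contDiffAt (hU.mem_nhds hx)).differentiableAt (by simp)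
  have dF : ∀ a i, DifferentiableAt ℝ (fun y => F y a i) x := fun a i =>
    (h.smooth a i).differentiable (by simp) x
  have hB : ∀ i j, pd i (pd j f) x =
      ∑ a, (F x a j * pd i (lie F a f) x + lie F a f x * pd i (fun y => F y a j) x) := by
    intro i j
    have e1 : pd j f = fun y => ∑ a, F y a j * lie F a f y := funext fun y => h.pd_eq f y j
    rw [e1]
    have := (HasFDerivAt.fun_sum (u := Finset.univ) fun a _ =>
      ((dF a j).hasFDerivAt.fun_mul (dl a).hasFDerivAt)).fderiv
    refine (congrArg (fun L : R 3 →L[ℝ] ℝ => L (e i)) this).trans ?_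
    simp [pd, _root_.sum_apply]
  set p : Fin 3 → ℝ := fun i => (F x)⁻¹ i c with hp
  set q : Fin 3 → ℝ := fun i => (F x)⁻¹ i d with hq
  have ep : F x *ᵥ p = Pi.single c 1 := by
    have : p = (F x)⁻¹ *ᵥ Pi.single c 1 := by ext; simp [hp]
    rw [this, Matrix.mulVec_mulVec, h.mul_inv, Matrix.one_mulVec]
  have eq : F x *ᵥ q = Pi.single d 1 := by
    have : q = (F x)⁻¹ *ᵥ Pi.single d 1 := by ext; simp [hq]
    rw [this, Matrix.mulVec_mulVec, h.mul_inv, Matrix.one_mulVec]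
  have hS := fun a => h.structure_contract x a p q
  rw [ep, eq] at hS
  have t1 : ∑ i, ∑ j, p i * q j * (∑ a, F x a j * pd i (lie F a f) x) = lie F c (lie F d f) x := by
    have : ∀ i, ∑ j, p i * q j * (∑ a, F x a j * pd i (lie F a f) x) =
        p i * ∑ a, (F x *ᵥ q) a * pd i (lie F a f) x := fun i => by
      simp only [Matrix.mulVec, dotProduct, Finset.mul_sum, Finset.sum_mul]
      rw [Finset.sum_comm]
      exact Finset.sum_congr rfl fun _ _ => Finset.sum_congr rfl fun _ _ => by ring
    simp only [this, eq, Pi.single_apply]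
    simp [lie, hp]
  have t2 : ∑ i, ∑ j, p i * q j * (∑ a, F x a i * pd j (lie F a f) x) = lie F d (lie F c f) x := by
    rw [Finset.sum_comm]
    have : ∀ j, ∑ i, p i * q j * (∑ a, F x a i * pd j (lie F a f) x) =
        q j * ∑ a, (F x *ᵥ p) a * pd j (lie F a f) x := fun i => by
      simp only [Matrix.mulVec, dotProduct, Finset.mul_sum, Finset.sum_mul]
      rw [Finset.sum_comm]
      exact Finset.sum_congr rfl fun _ _ => Finset.sum_congr rfl fun _ _ => by ring
    simp only [this, ep, Pi.single_apply]
    simp [lie, hq]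
  have t3 : ∑ i, ∑ j, p i * q j * (pd i (pd j f) x - pd j (pd i f) x) = 0 :=
    Finset.sum_eq_zero fun i _ => Finset.sum_eq_zero fun j _ => by rw [pd_pd_comm hfx i j]; ring
  have t4 : ∑ i, ∑ j, p i * q j * (pd i (pd j f) x - pd j (pd i f) x) =
      lie F c (lie F d f) x - lie F d (lie F c f) x + ∑ a, lie F a f x *
        ∑ i, ∑ j, p i * q j * (pd i (fun y => F y a j) x - pd j (fun y => F y a i) x) := by
    rw [← t1, ← t2]
    simp only [hB, Fin.sum_univ_three]
    ring
  rw [t3] at t4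
  simp only [hS] at t4
  simp only [Fin.sum_univ_three] at t4 ⊢
  linear_combination -t4

end IsCoframe

end Carleman

namespace Carleman

/-! ### The bracket condition in a frame -/

theorem extChartAt_symm_eq_id (p : R 3) : ((extChartAt (𝓡 3) p).symm : R 3 → R 3) = id := by
  rw [extChartAt_model_space_eq_id]
  rfl

theorem chartGram_eq_coeffs (g : MetricField (𝓡 3) (R 3)) (p : R 3) :
    chartGram (stdBasis 3) (𝓡 3) g p = coeffs g := by
  have h : ∀ f : R 3 → R 3, f = id → ∀ u (v w : R 3),
      g (f u) (mfderiv (𝓡 3) (𝓡 3) f u v) (mfderiv (𝓡 3) (𝓡 3) f u w) = g u v w := by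
    rintro _ rfl u v w
    rw [mfderiv_id]
    rfl
  ext u i j
  refine (h _ (extChartAt_symm_eq_id p) u _ _).trans ?_
  simp [coeffs, stdBasis, e]

theorem symbol_eq_coordSymbol_coeffs (g : MetricField (𝓡 3) (R 3)) (φ : R 3 → ℝ) (p : R 3) :
    symbol (stdBasis 3) (𝓡 3) g φ p = coordSymbol (stdBasis 3) (coeffs g) φ := by
  rw [symbol_eq_coordSymbol, chartGram_eq_coeffs, extChartAt_symm_eq_id]
  rfl

theorem fderiv_stdBasis (f : R 3 → ℝ) (x : R 3) (i : Fin 3) :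
    fderiv ℝ f x (stdBasis 3 i) = pd i f x := by
  simp [pd, e]

variable {G F : R 3 → Matrix (Fin 3) (Fin 3) ℝ} {L : Matrix (Fin 3) (Fin 3) ℝ}

/-- The algebra behind the bracket in a frame: `D` holds the derivatives of the coframe, `Θ` those
of the components of `dφ`, and `Z = p + i q`. The derivatives of the coframe survive only
antisymmetrized, as `dω(p, q)`, and so can be removed by the structure equations. -/
theorem im_bracket_identity (D : Fin 3 → Fin 3 → Fin 3 → ℝ) (Θ : Fin 3 → Fin 3 → ℝ)
    (Fm : Matrix (Fin 3) (Fin 3) ℝ) (p q : Fin 3 → ℝ) :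
    (∑ k, (starRingEnd ℂ) ((p k : ℂ) + Complex.I * q k) *
      (-(∑ i, ∑ j, ((∑ a, (D k a i * Fm a j + Fm a i * D k a j) : ℝ) : ℂ) *
          ((p i : ℂ) + Complex.I * q i) * ((p j : ℂ) + Complex.I * q j))
        + 2 * Complex.I * ∑ j, ((p j : ℂ) + Complex.I * q j) *
          ((∑ a, (D k a j * (Fm *ᵥ q) a + Fm a j * Θ k a) : ℝ) : ℂ))).im =
      2 * (∑ a, ∑ k, ((Fm *ᵥ p) a * p k + (Fm *ᵥ q) a * q k) * Θ k a
        - ∑ a, (Fm *ᵥ p) a * ∑ i, ∑ j, p i * q j * (D i a j - D j a i)) := by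
  have hP : ∀ k, -(∑ i, ∑ j, ((∑ a, (D k a i * Fm a j + Fm a i * D k a j) : ℝ) : ℂ) *
          ((p i : ℂ) + Complex.I * q i) * ((p j : ℂ) + Complex.I * q j))
        + 2 * Complex.I * ∑ j, ((p j : ℂ) + Complex.I * q j) *
          ((∑ a, (D k a j * (Fm *ᵥ q) a + Fm a j * Θ k a) : ℝ) : ℂ) =
      ((-2 * ∑ a, ((Fm *ᵥ p) a * ∑ i, D k a i * p i + (Fm *ᵥ q) a * Θ k a) : ℝ) : ℂ) +
        Complex.I * ((2 * ∑ a, ((Fm *ᵥ p) a * Θ k a - (Fm *ᵥ p) a * ∑ i, D k a i * q i) : ℝ) : ℂ) := by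
    intro k
    simp only [Matrix.mulVec, dotProduct, Fin.sum_univ_three]
    push_cast
    ring_nf
    simp only [Complex.I_sq]
    ring
  simp only [hP]
  have him : ∀ a b c d : ℝ, ((starRingEnd ℂ) ((a : ℂ) + Complex.I * b) *
      ((c : ℂ) + Complex.I * d)).im = a * d - b * c := by
    intro a b c d
    simp
    ring
  rw [Complex.im_sum]
  simp only [him]
  simp only [Matrix.mulVec, dotProduct, Fin.sum_univ_three]
  ring

/-- The bracket condition at a point, in terms of the frame dual to `F`. -/
theorem IsCoframe.bracket_condition {g : MetricField (𝓡 3) (R 3)} (h : IsCoframe (coeffs g) F L)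
    {U : Set (R 3)} (hU : IsOpen U) {φ : R 3 → ℝ} (hφ : IsLCWOn (stdBasis 3) (𝓡 3) g U φ)
    {x : R 3} (hx : x ∈ U) {η : Fin 3 → ℝ} (h0 : ∑ a, η a * lie F a φ x = 0)
    (h1 : ∑ a, η a * η a = ∑ a, lie F a φ x * lie F a φ x) :
    ∑ a, ∑ c, (η a * η c + lie F a φ x * lie F c φ x) * lie F c (lie F a φ) x
      + ∑ a, η a * ∑ k, L k a * crossProduct η (fun b => lie F b φ x) k = 0 := by
  have hs : ContDiffOn ℝ ∞ φ U := hφ.smooth.contDiffOn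
  have hA : ∀ y i j, coeffs g y i j = ∑ a, F y a i * F y a j := fun y i j => by
    rw [h.metric]; simp [Matrix.mul_apply]
  have dF : ∀ a i, DifferentiableAt ℝ (fun y => F y a i) x := fun a i =>
    (h.smooth a i).differentiable (by simp) x
  have dl : ∀ a, DifferentiableAt ℝ (lie F a φ) x := fun a =>
    ((h.contDiffOn_lie hU hs a).contDiffAt (hU.mem_nhds hx)).differentiableAt (by simp)
  set D : Fin 3 → Fin 3 → Fin 3 → ℝ := fun k a i => pd k (fun y => F y a i) x with hD
  have hdA : ∀ i j, HasFDerivAt (fun y => coeffs g y i j) (∑ a, (F x a i •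
      fderiv ℝ (fun y => F y a j) x + F x a j • fderiv ℝ (fun y => F y a i) x)) x := fun i j => by
    simp only [hA]
    exact HasFDerivAt.fun_sum fun a _ => (dF a i).hasFDerivAt.fun_mul (dF a j).hasFDerivAt
  have hpA : ∀ k i j, fderiv ℝ (fun y => coeffs g y i j) x (stdBasis 3 k) =
      ∑ a, (D k a i * F x a j + F x a i * D k a j) := fun k i j => by
    rw [fderiv_stdBasis, pd, (hdA i j).fderiv]
    simp only [_root_.sum_apply, _root_.add_apply, _root_.smul_apply, smul_eq_mul, hD, pd]
    exact Finset.sum_congr rfl fun a _ => by ring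
  set θ : Fin 3 → ℝ := fun a => lie F a φ x with hθ
  set Θ : Fin 3 → Fin 3 → ℝ := fun k a => pd k (lie F a φ) x with hΘ
  set p : Fin 3 → ℝ := (F x)⁻¹ *ᵥ η with hp
  set q : Fin 3 → ℝ := (F x)⁻¹ *ᵥ θ with hq
  have ep : F x *ᵥ p = η := by rw [hp, Matrix.mulVec_mulVec, h.mul_inv, Matrix.one_mulVec]
  have eq : F x *ᵥ q = θ := by rw [hq, Matrix.mulVec_mulVec, h.mul_inv, Matrix.one_mulVec]
  have hfun : ∀ j, (fun y => fderiv ℝ φ y (stdBasis 3 j)) =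
      fun y => ∑ a, F y a j * lie F a φ y := fun j => funext fun y => by
    rw [fderiv_stdBasis, h.pd_eq]
  have hdψ : ∀ j, HasFDerivAt (fun y => fderiv ℝ φ y (stdBasis 3 j)) (∑ a, (F x a j •
      fderiv ℝ (lie F a φ) x + lie F a φ x • fderiv ℝ (fun y => F y a j) x)) x := fun j => by
    rw [hfun]
    exact HasFDerivAt.fun_sum fun a _ => (dF a j).hasFDerivAt.fun_mul (dl a).hasFDerivAt
  have hpψ : ∀ k j, fderiv ℝ (fun y => fderiv ℝ φ y (stdBasis 3 j)) x (stdBasis 3 k) =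
      ∑ a, (D k a j * (F x *ᵥ q) a + F x a j * Θ k a) := fun k j => by
    rw [fderiv_stdBasis, pd, (hdψ j).fderiv]
    simp only [_root_.sum_apply, _root_.add_apply, _root_.smul_apply, smul_eq_mul, hD, pd, eq]
    exact Finset.sum_congr rfl fun a _ => by simp only [hθ, hΘ, pd]; ring
  have hGdet : (coeffs g x).det ≠ 0 := by
    rw [h.metric, Matrix.det_mul, Matrix.det_transpose]
    exact mul_ne_zero (h.det_ne_zero x) (h.det_ne_zero x)
  have hGinv : (coeffs g x)⁻¹ = (F x)⁻¹ * ((F x)⁻¹)ᵀ := by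
    rw [h.metric, Matrix.mul_inv_rev, Matrix.transpose_nonsing_inv]
  -- the covector with frame components `η`
  set ξ : Fin 3 → ℝ := fun i => ∑ a, η a * F x a i with hξ
  have hζ : ∀ j, (ξ j : ℂ) + Complex.I * fderiv ℝ φ x (stdBasis 3 j) =
      ∑ a, ((η a : ℂ) + Complex.I * θ a) * F x a j := fun j => by
    rw [congrFun (hfun j) x]
    simp only [hξ, hθ]
    push_cast
    rw [Finset.mul_sum, ← Finset.sum_add_distrib]
    exact Finset.sum_congr rfl fun a _ => by ring
  have hZ : ∀ i, (p i : ℂ) + Complex.I * q i = ∑ j, (((coeffs g x)⁻¹ i j : ℝ) : ℂ) *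
      ((ξ j : ℂ) + Complex.I * fderiv ℝ φ x (stdBasis 3 j)) := fun i => by
    have e1 : ∀ a, ∑ j, (coeffs g x)⁻¹ i j * F x a j = (F x)⁻¹ i a := fun a => by
      have : (coeffs g x)⁻¹ * (F x)ᵀ = (F x)⁻¹ := by
        rw [hGinv, Matrix.mul_assoc, ← Matrix.transpose_mul, h.mul_inv]; simp
      exact congrFun (congrFun this i) a
    have e2 : ∑ j, (((coeffs g x)⁻¹ i j : ℝ) : ℂ) *
        (∑ a, ((η a : ℂ) + Complex.I * θ a) * F x a j) =
        ∑ a, ((η a : ℂ) + Complex.I * θ a) * ((∑ j, (coeffs g x)⁻¹ i j * F x a j : ℝ) : ℂ) := by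
      push_cast
      simp only [Finset.mul_sum]
      rw [Finset.sum_comm]
      exact Finset.sum_congr rfl fun _ _ => Finset.sum_congr rfl fun _ _ => by ring
    simp only [hζ, e2, e1, hp, hq, Matrix.mulVec, dotProduct]
    push_cast
    rw [Finset.mul_sum, ← Finset.sum_add_distrib]
    exact Finset.sum_congr rfl fun a _ => by ring
  have hsym : coordSymbol (stdBasis 3) (coeffs g) φ x ξ = 0 := by
    have e1 : coordSymbol (stdBasis 3) (coeffs g) φ x ξ = ∑ i, ((p i : ℂ) + Complex.I * q i) *
        ((ξ i : ℂ) + Complex.I * fderiv ℝ φ x (stdBasis 3 i)) := by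
      unfold coordSymbol
      rw [Finset.sum_comm]
      refine Finset.sum_congr rfl fun i _ => ?_
      have hsy : ∀ j, (coeffs g x)⁻¹ j i = (coeffs g x)⁻¹ i j := fun j => by
        have : ((coeffs g x)⁻¹)ᵀ = (coeffs g x)⁻¹ := by
          rw [hGinv, Matrix.transpose_mul, Matrix.transpose_transpose]
        exact congrFun (congrFun this i) j
      rw [hZ, Finset.sum_mul]
      exact Finset.sum_congr rfl fun j _ => by rw [hsy]
    have e2 : ∀ a, ∑ i, ((p i : ℂ) + Complex.I * q i) * (F x a i : ℂ) =
        (η a : ℂ) + Complex.I * θ a := fun a => by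
      rw [← congrFun ep a, ← congrFun eq a]
      simp only [Matrix.mulVec, dotProduct]
      push_cast
      rw [Finset.mul_sum, ← Finset.sum_add_distrib]
      exact Finset.sum_congr rfl fun a _ => by ring
    -- In an orthonormal frame the symbol is `|η|² - |θ|² + 2 i ⟨η, θ⟩`, so the two hypotheses on
    -- `η` say exactly that it vanishes.
    have e3 : coordSymbol (stdBasis 3) (coeffs g) φ x ξ =
        ∑ a, ((η a : ℂ) + Complex.I * θ a) * ((η a : ℂ) + Complex.I * θ a) := by
      rw [e1]
      simp only [hζ, Finset.mul_sum]
      rw [Finset.sum_comm]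
      refine Finset.sum_congr rfl fun a _ => ?_
      refine Eq.trans ?_ (congrArg (· * ((η a : ℂ) + Complex.I * θ a)) (e2 a))
      simp only [Finset.sum_mul]
      exact Finset.sum_congr rfl fun i _ => by ring
    rw [e3]
    have f1 : ((∑ a, η a * η a - ∑ a, θ a * θ a : ℝ) : ℂ) + 2 * Complex.I *
        ((∑ a, η a * θ a : ℝ) : ℂ) = 0 := by
      rw [show ∑ a, η a * η a - ∑ a, θ a * θ a = 0 from sub_eq_zero.2 h1,
        show ∑ a, η a * θ a = 0 from h0]
      simp
    rw [← f1]
    simp only [Fin.sum_univ_three]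
    push_cast
    ring_nf
    simp only [Complex.I_sq]
    ring
  have hb := hφ.bracket_eq_zero x hx ξ
  rw [symbol_eq_coordSymbol_coeffs] at hb
  have hxx : extChartAt (𝓡 3) x x = x := by rw [extChartAt_model_space_eq_id]; rfl
  rw [hxx] at hb
  have hb' := (poissonBracket_coordSymbol (fun i j => (hdA i j).differentiableAt)
    (by rw [h.metric]; exact (Matrix.isSymm_transpose_mul_self _)) hGdet
    (fun i => (hdψ i).differentiableAt) ξ (fun i => (p i : ℂ) + Complex.I * q i) _ hZ
    (fun k => rfl)).symm.trans (hb hsym)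
  have hb2 := (mul_eq_zero.1 hb').resolve_left (by simp)
  have hb3 := Complex.ofReal_eq_zero.1 hb2
  simp only [hpA, hpψ] at hb3
  rw [im_bracket_identity D Θ (F x) p q, ep, eq] at hb3
  have hS := fun a => h.structure_contract x a p q
  rw [ep, eq] at hS
  have hT : ∑ a, ∑ k, (η a * p k + θ a * q k) * Θ k a =
      ∑ a, ∑ c, (η a * η c + θ a * θ c) * lie F c (lie F a φ) x := by
    refine Finset.sum_congr rfl fun a _ => ?_
    simp only [hp, hq, Matrix.mulVec, dotProduct, hΘ, lie, Fin.sum_univ_three]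
    ring
  rw [hT] at hb3
  simp only [hD] at hb3
  simp only [hS] at hb3
  simp only [mul_neg, Finset.sum_neg_distrib] at hb3
  have := (mul_eq_zero.1 hb3).resolve_left two_ne_zero
  rw [sub_neg_eq_add] at this
  exact this

end Carleman

namespace Carleman

/-! ### The curvature of a left-invariant metric in an orthonormal frame -/

/-- The matrix of `w ↦ v × w`. -/
def skew (v : Fin 3 → ℝ) : Matrix (Fin 3) (Fin 3) ℝ :=
  !![0, -v 2, v 1; v 2, 0, -v 0; -v 1, v 0, 0]

/-- The matrix `½ (tr L) 1 - L`, in terms of which `∇_c E_b = M_c × E_b`. -/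
noncomputable def milnor (L : Matrix (Fin 3) (Fin 3) ℝ) : Matrix (Fin 3) (Fin 3) ℝ :=
  (L.trace / 2) • 1 - L

/-- The connection coefficients, `∇_c E_b = ∑ a, conn L c a b • E_a`. -/
noncomputable def conn (L : Matrix (Fin 3) (Fin 3) ℝ) (c : Fin 3) : Matrix (Fin 3) (Fin 3) ℝ :=
  skew (milnor L c)

/-- The curvature operator: `R (E_c, E_d) = skew (curvatureOp L (e_c × e_d))`. -/
noncomputable def curvatureOp (L : Matrix (Fin 3) (Fin 3) ℝ) : Matrix (Fin 3) (Fin 3) ℝ :=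
  (milnor L).adjugate - milnor L * L

/-- The components of the Ricci tensor in the frame. -/
noncomputable def frameRicci (L : Matrix (Fin 3) (Fin 3) ℝ) : Matrix (Fin 3) (Fin 3) ℝ :=
  curvatureOp L - (curvatureOp L).trace • 1

/-- The components of the Schouten tensor in the frame. -/
noncomputable def frameSchouten (L : Matrix (Fin 3) (Fin 3) ℝ) : Matrix (Fin 3) (Fin 3) ℝ :=
  frameRicci L - ((frameRicci L).trace / 4) • 1

/-- The components of the covariant derivative `∇_c S` of the Schouten tensor in the frame. -/
noncomputable def frameNablaSchouten (L : Matrix (Fin 3) (Fin 3) ℝ) (c : Fin 3) :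
    Matrix (Fin 3) (Fin 3) ℝ :=
  conn L c * frameSchouten L - frameSchouten L * conn L c

/-- The components of the Cotton-York tensor in the frame. -/
noncomputable def frameCottonYork (L : Matrix (Fin 3) (Fin 3) ℝ) : Matrix (Fin 3) (Fin 3) ℝ :=
  Matrix.of ![frameNablaSchouten L 1 2 - frameNablaSchouten L 2 1,
    frameNablaSchouten L 2 0 - frameNablaSchouten L 0 2,
    frameNablaSchouten L 0 1 - frameNablaSchouten L 1 0]

section Explicit

variable (l₁ l₂ l₃ m : ℝ)

/-- The structure constants of the algebras considered. -/
abbrev structureMatrix : Matrix (Fin 3) (Fin 3) ℝ := !![l₁, 0, m; 0, l₂, 0; m, 0, l₃]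

theorem milnor_structureMatrix : milnor (structureMatrix l₁ l₂ l₃ m) =
    !![(l₂ + l₃ - l₁) / 2, 0, -m; 0, (l₁ + l₃ - l₂) / 2, 0; -m, 0, (l₁ + l₂ - l₃) / 2] := by
  ext i j
  fin_cases i <;> fin_cases j <;> simp [milnor, Matrix.trace_fin_three] <;> ring

theorem conn_structureMatrix : conn (structureMatrix l₁ l₂ l₃ m) =
    ![!![0, m, 0; -m, 0, -((l₂ + l₃ - l₁) / 2); 0, (l₂ + l₃ - l₁) / 2, 0],
      !![0, 0, (l₁ + l₃ - l₂) / 2; 0, 0, 0; -((l₁ + l₃ - l₂) / 2), 0, 0],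
      !![0, -((l₁ + l₂ - l₃) / 2), 0; (l₁ + l₂ - l₃) / 2, 0, m; 0, -m, 0]] := by
  ext c i j
  fin_cases c <;> fin_cases i <;> fin_cases j <;> simp [conn, milnor_structureMatrix, skew]

theorem curvatureOp_structureMatrix : curvatureOp (structureMatrix l₁ l₂ l₃ m) =
    !![(l₁ + l₃ - l₂) * (l₁ + l₂ - l₃) / 4 - (l₂ + l₃ - l₁) * l₁ / 2 + m ^ 2, 0,
        (l₁ + l₃ - l₂) * m / 2 + l₃ * m - (l₂ + l₃ - l₁) * m / 2;
      0, (l₂ + l₃ - l₁) * (l₁ + l₂ - l₃) / 4 - m ^ 2 - (l₁ + l₃ - l₂) * l₂ / 2, 0;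
      (l₁ + l₃ - l₂) * m / 2 + l₁ * m - (l₁ + l₂ - l₃) * m / 2, 0,
        (l₂ + l₃ - l₁) * (l₁ + l₃ - l₂) / 4 - (l₁ + l₂ - l₃) * l₃ / 2 + m ^ 2] := by
  ext i j
  fin_cases i <;> fin_cases j <;>
    simp [curvatureOp, milnor_structureMatrix, Matrix.adjugate_fin_three] <;> ring

end Explicit

section Pointwise

variable {θ α : Fin 3 → ℝ}

/-- The hypothesis concerns only vectors orthogonal to `θ`. Applying it to `(θ · u) θ - |θ|² u`
gives a quadratic identity in an arbitrary `u`, which is then polarized on the standard basis. -/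
theorem symm_eq_of_quadratic {h : Fin 3 → Fin 3 → ℝ} (hθ : ∑ a, θ a * θ a ≠ 0)
    (hs : ∀ i j, h i j = h j i) (hq : ∀ w : Fin 3 → ℝ, ∑ a, w a * θ a = 0 →
      (∑ a, θ a * θ a) * ∑ a, ∑ c, w a * w c * h c a +
        (∑ a, w a * w a) * ∑ a, ∑ c, θ a * θ c * h c a = 0) (c a : Fin 3) :
    (∑ a, θ a * θ a) * h c a = θ c * ∑ b, θ b * h a b + θ a * ∑ b, θ b * h c b
      - (∑ a, ∑ c, θ a * θ c * h c a) * (1 : Matrix (Fin 3) (Fin 3) ℝ) c a := by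
  have key : ∀ u : Fin 3 → ℝ, (∑ a, θ a * θ a) * ∑ a, ∑ c, u a * u c * h c a
      - 2 * (∑ a, θ a * u a) * ∑ a, ∑ c, θ a * u c * h c a
      + (∑ a, u a * u a) * ∑ a, ∑ c, θ a * θ c * h c a = 0 := fun u => by
    have h1 := hq (fun a => θ a * ∑ b, θ b * u b - (∑ b, θ b * θ b) * u a) (by
      simp only [Fin.sum_univ_three]; ring)
    refine (mul_eq_zero.1 (Eq.trans ?_ h1)).resolve_left (pow_ne_zero 2 hθ)
    simp only [Fin.sum_univ_three, hs 1 0, hs 2 0, hs 2 1]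
    ring
  have h1 := key (Pi.single c 1)
  have h2 := key (Pi.single a 1)
  have h3 := key (Pi.single c 1 + Pi.single a 1)
  have e10 := hs 1 0
  have e20 := hs 2 0
  have e21 := hs 2 1
  fin_cases c <;> fin_cases a <;>
    simp [Fin.sum_univ_three, e10, e20, e21] at h1 h2 h3 ⊢ <;> linarith

/-- The solution of the linear system expressing the integrability of the equation for `dφ`. -/
theorem eq_of_trace_form {T : Fin 3 → Fin 3 → ℝ} (hs : ∀ i j, T i j = T j i)
    (h : ∀ c d a, T c a * θ d - T d a * θ c
      - (∑ b, T c b * θ b) * (1 : Matrix (Fin 3) (Fin 3) ℝ) d a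
      + (∑ b, T d b * θ b) * (1 : Matrix (Fin 3) (Fin 3) ℝ) c a = 0) (c a : Fin 3) :
    (∑ b, θ b * θ b) * T c a = (∑ b, T b b) *
      ((∑ b, θ b * θ b) * (1 : Matrix (Fin 3) (Fin 3) ℝ) c a - 2 * θ c * θ a) := by
  have e10 := hs 1 0
  have e20 := hs 2 0
  have e21 := hs 2 1
  -- Contracting `d` with `a` gives `T θ = -(tr T) θ`. Contracting `d` with `θ` afterwards yields
  -- the claim.
  have h1 : ∀ c, ∑ b, T c b * θ b = -(∑ b, T b b) * θ c := fun c => by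
    have t0 := h c 0 0
    have t1 := h c 1 1
    have t2 := h c 2 2
    fin_cases c <;> simp [Fin.sum_univ_three, Matrix.one_apply, e10, e20, e21] at t0 t1 t2 ⊢ <;>
      linarith
  simp only [h1] at h
  have t0 := h c 0 a
  have t1 := h c 1 a
  have t2 := h c 2 a
  have hc := h1 a
  simp only [Fin.sum_univ_three] at t0 t1 t2 hc ⊢
  have f : T 0 a * θ 0 + T 1 a * θ 1 + T 2 a * θ 2 = T a 0 * θ 0 + T a 1 * θ 1 + T a 2 * θ 2 := by
    rw [hs 0 a, hs 1 a, hs 2 a]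
  have g : θ 0 * (1 : Matrix (Fin 3) (Fin 3) ℝ) 0 a + θ 1 * (1 : Matrix (Fin 3) (Fin 3) ℝ) 1 a
      + θ 2 * (1 : Matrix (Fin 3) (Fin 3) ℝ) 2 a = θ a := by
    fin_cases a <;> simp [Matrix.one_apply]
  linear_combination θ 0 * t0 + θ 1 * t1 + θ 2 * t2 + θ c * f + θ c * hc -
    (T 0 0 + T 1 1 + T 2 2) * θ c * g

end Pointwise

end Carleman

namespace Carleman

/-! ### The equations satisfied by a limiting Carleman weight -/

section Pointwise

variable {θ α : Fin 3 → ℝ} {l₁ l₂ l₃ m : ℝ}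

/-- The derivatives of the components `θ` of `dφ` in the frame: the Hessian of `φ` is
`α θ + θ α - ⟨α, θ⟩ g`. -/
noncomputable def hessForm (L : Matrix (Fin 3) (Fin 3) ℝ) (α θ : Fin 3 → ℝ) (c a : Fin 3) : ℝ :=
  α c * θ a + α a * θ c - (∑ b, α b * θ b) * (1 : Matrix (Fin 3) (Fin 3) ℝ) c a
    + ∑ b, conn L c b a * θ b

/-- Subtracting the connection term from `Θ` gives the Hessian `h`, which is symmetric because the
connection has no torsion. The bracket condition becomes `h(η, η) + h(θ, θ) = 0` for `η` orthogonal
to `θ` and of the same length, and this determines `h` from `h(θ, ·) = |θ|² α`. -/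
theorem eq_hessForm {Θ : Fin 3 → Fin 3 → ℝ} (hθ : ∑ a, θ a * θ a ≠ 0)
    (htor : ∀ c b, Θ c b - Θ b c = ∑ k, crossProduct (Pi.single c 1) (Pi.single b 1) k *
      ∑ a, structureMatrix l₁ l₂ l₃ m k a * θ a)
    (hcond : ∀ η : Fin 3 → ℝ, ∑ a, η a * θ a = 0 → ∑ a, η a * η a = ∑ a, θ a * θ a →
      ∑ a, ∑ c, (η a * η c + θ a * θ c) * Θ c a
        + ∑ a, η a * ∑ k, structureMatrix l₁ l₂ l₃ m k a * crossProduct η θ k = 0)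
    (hα : ∀ c, (∑ a, θ a * θ a) * α c = ∑ a, θ a * Θ c a) (c a : Fin 3) :
    Θ c a = hessForm (structureMatrix l₁ l₂ l₃ m) α θ c a := by
  set h : Fin 3 → Fin 3 → ℝ := fun c a =>
    Θ c a - ∑ b, conn (structureMatrix l₁ l₂ l₃ m) c b a * θ b with hh
  have hs : ∀ i j, h i j = h j i := fun i j => by
    have t10 := htor 1 0
    have t20 := htor 2 0
    have t21 := htor 2 1
    fin_cases i <;> fin_cases j <;>
      simp [hh, conn_structureMatrix, Fin.sum_univ_three, cross_apply] at t10 t20 t21 ⊢ <;>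
      linarith
  have hw : ∀ w : Fin 3 → ℝ, ∑ a, ∑ c, w a * w c * h c a = ∑ a, ∑ c, w a * w c * Θ c a +
      ∑ a, w a * ∑ k, structureMatrix l₁ l₂ l₃ m k a * crossProduct w θ k := fun w => by
    simp [hh, conn_structureMatrix, Fin.sum_univ_three, cross_apply]
    ring
  have hwθ : ∑ a, ∑ c, θ a * θ c * h c a = ∑ a, ∑ c, θ a * θ c * Θ c a := by
    rw [hw]; simp
  have hρ : 0 < ∑ a, θ a * θ a :=
    lt_of_le_of_ne (Finset.sum_nonneg fun a _ => mul_self_nonneg _) hθ.symm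
  have hq : ∀ w : Fin 3 → ℝ, ∑ a, w a * θ a = 0 →
      (∑ a, θ a * θ a) * ∑ a, ∑ c, w a * w c * h c a +
        (∑ a, w a * w a) * ∑ a, ∑ c, θ a * θ c * h c a = 0 := fun w h0 => by
    rcases (Finset.sum_nonneg fun a (_ : a ∈ Finset.univ) => mul_self_nonneg (w a)).eq_or_lt with
      hw0 | hw0
    · have : w = 0 := funext fun a => mul_self_eq_zero.1
        ((Finset.sum_eq_zero_iff_of_nonneg fun a _ => mul_self_nonneg (w a)).1 hw0.symm a
          (Finset.mem_univ a))
      simp [this]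
    -- The bracket condition is available only for covectors of the length of `θ`, so `w` is
    -- rescaled to that length.
    · set s := √((∑ a, θ a * θ a) / ∑ a, w a * w a) with hsdef
      have hs2 : s * s * ∑ a, w a * w a = ∑ a, θ a * θ a := by
        rw [hsdef, Real.mul_self_sqrt (by positivity), div_mul_cancel₀ _ hw0.ne']
      have h1 := hcond (fun a => s * w a) (by
        have : ∑ a, s * w a * θ a = s * ∑ a, w a * θ a := by
          rw [Finset.mul_sum]; exact Finset.sum_congr rfl fun _ _ => by ring
        rw [this, h0, mul_zero]) (by
        rw [← hs2, Finset.mul_sum]; exact Finset.sum_congr rfl fun _ _ => by ring)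
      have h2 := hw w
      have h3 : ∑ a, ∑ c, (s * w a * (s * w c) + θ a * θ c) * Θ c a
        + ∑ a, s * w a * ∑ k, structureMatrix l₁ l₂ l₃ m k a *
          crossProduct (fun a => s * w a) θ k = s * s * (∑ a, ∑ c, w a * w c * h c a) +
          ∑ a, ∑ c, θ a * θ c * h c a := by
        rw [hwθ, h2]
        simp only [Fin.sum_univ_three, cross_apply]
        simp
        ring
      rw [h3] at h1
      linear_combination (∑ a, w a * w a) * h1 - (∑ a, ∑ c, w a * w c * h c a) * hs2
  have key := symm_eq_of_quadratic hθ hs hq c a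
  have hα' : ∀ c, ∑ b, θ b * h c b = (∑ a, θ a * θ a) * α c := fun c => by
    rw [hα]
    fin_cases c <;> simp [hh, conn_structureMatrix, Fin.sum_univ_three] <;> ring
  have e1 : ∑ a, ∑ c, θ a * θ c * h c a = (∑ a, θ a * θ a) * ∑ b, α b * θ b := by
    have : ∑ a, ∑ c, θ a * θ c * h c a = ∑ c, θ c * ∑ a, θ a * h c a := by
      rw [Finset.sum_comm]
      simp only [Finset.mul_sum]
      exact Finset.sum_congr rfl fun _ _ => Finset.sum_congr rfl fun _ _ => by ring
    rw [this]
    simp only [hα', Finset.mul_sum]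
    exact Finset.sum_congr rfl fun _ _ => by ring
  rw [hα', hα', e1] at key
  have e2 : h c a = Θ c a - ∑ b, conn (structureMatrix l₁ l₂ l₃ m) c b a * θ b := rfl
  have := mul_left_cancel₀ hθ (key.trans (show _ = (∑ a, θ a * θ a) * (α c * θ a + α a * θ c
    - (∑ b, α b * θ b) * (1 : Matrix (Fin 3) (Fin 3) ℝ) c a) by ring))
  rw [hessForm, ← this, e2]
  ring

/-- The components of `∇α - S - α α + ½ |α|² g`. -/
noncomputable def traceForm (L : Matrix (Fin 3) (Fin 3) ℝ) (α : Fin 3 → ℝ)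
    (A : Fin 3 → Fin 3 → ℝ) (c a : Fin 3) : ℝ :=
  A c a - ∑ b, conn L c b a * α b - frameSchouten L c a - α c * α a
    + (∑ b, α b * α b) / 2 * (1 : Matrix (Fin 3) (Fin 3) ℝ) c a

/-- The derivative along `E_c` of `hessForm L α θ d a`, if `A` and `hessForm L α θ` are the
derivatives of `α` and `θ`. -/
noncomputable def hessFormDeriv (L : Matrix (Fin 3) (Fin 3) ℝ) (α θ : Fin 3 → ℝ)
    (A : Fin 3 → Fin 3 → ℝ) (c d a : Fin 3) : ℝ :=
  A c d * θ a + α d * hessForm L α θ c a + (A c a * θ d + α a * hessForm L α θ c d)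
    - (∑ b, (A c b * θ b + α b * hessForm L α θ c b)) * (1 : Matrix (Fin 3) (Fin 3) ℝ) d a
    + ∑ b, conn L d b a * hessForm L α θ c b

theorem frameSchouten_structureMatrix : frameSchouten (structureMatrix l₁ l₂ l₃ m) =
    !![-l₁ * l₃ / 4 - l₁ * l₂ / 4 + 5 * l₁ ^ 2 / 8 + 3 * l₃ * l₂ / 4 - 3 * l₃ ^ 2 / 8
          - 3 * l₂ ^ 2 / 8 + m ^ 2 / 2, 0, l₁ * m + l₃ * m - l₂ * m;
      0, -l₂ * l₃ / 4 - l₂ * l₁ / 4 + 5 * l₂ ^ 2 / 8 + 3 * l₃ * l₁ / 4 - 3 * l₃ ^ 2 / 8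
          - 3 * l₁ ^ 2 / 8 - 3 * m ^ 2 / 2, 0;
      l₁ * m + l₃ * m - l₂ * m, 0, -l₁ * l₃ / 4 + 3 * l₁ * l₂ / 4 - 3 * l₁ ^ 2 / 8 - l₃ * l₂ / 4
          + 5 * l₃ ^ 2 / 8 - 3 * l₂ ^ 2 / 8 + m ^ 2 / 2] := by
  ext i j
  fin_cases i <;> fin_cases j <;>
    simp [frameSchouten, frameRicci, curvatureOp_structureMatrix, Matrix.trace_fin_three] <;> ring

/-- This reduces an identity antisymmetric in `c, d` to the three cyclic pairs, so that the
polynomial verification below runs over nine cases. -/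
theorem eq_zero_of_antisymm {Z : Fin 3 → Fin 3 → Fin 3 → ℝ} (hs : ∀ c d a, Z c d a = -Z d c a)
    (h : ∀ c d, (c = 1 ∧ d = 2 ∨ c = 2 ∧ d = 0 ∨ c = 0 ∧ d = 1) → ∀ a, Z c d a = 0)
    (c d a : Fin 3) : Z c d a = 0 := by
  have h0 := h 1 2 (by simp) a
  have h1 := h 2 0 (by simp) a
  have h2 := h 0 1 (by simp) a
  have s0 := hs 2 1 a
  have s1 := hs 0 2 a
  have s2 := hs 1 0 a
  fin_cases c <;> fin_cases d <;> simp only [Fin.zero_eta, Fin.mk_one, Fin.reduceFinMk] <;>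
    linarith [hs 0 0 a, hs 1 1 a, hs 2 2 a]

-- This is the integrability condition for the equation of `dφ`. Geometrically `traceForm` is minus
-- the Schouten tensor of `|dφ|² g`; that metric has the parallel unit covector `dφ`, and the
-- Schouten tensor of a product of a line and a surface is a multiple of `|θ|² g - 2 θ θ`.
set_option maxHeartbeats 1000000 in
theorem traceForm_eq {A : Fin 3 → Fin 3 → ℝ}
    (htor : ∀ c b, A c b - A b c = ∑ k, crossProduct (Pi.single c 1) (Pi.single b 1) k *
      ∑ a, structureMatrix l₁ l₂ l₃ m k a * α a)
    (hcomm : ∀ c d a, hessFormDeriv (structureMatrix l₁ l₂ l₃ m) α θ A c d a -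
      hessFormDeriv (structureMatrix l₁ l₂ l₃ m) α θ A d c a =
        ∑ k, crossProduct (Pi.single c 1) (Pi.single d 1) k *
      ∑ b, structureMatrix l₁ l₂ l₃ m k b * hessForm (structureMatrix l₁ l₂ l₃ m) α θ b a)
    (c a : Fin 3) :
    (∑ b, θ b * θ b) * traceForm (structureMatrix l₁ l₂ l₃ m) α A c a =
      (∑ b, traceForm (structureMatrix l₁ l₂ l₃ m) α A b b) *
      ((∑ b, θ b * θ b) * (1 : Matrix (Fin 3) (Fin 3) ℝ) c a - 2 * θ c * θ a) := by
  refine eq_of_trace_form (fun i j => ?_)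
    (eq_zero_of_antisymm (fun c d a => by ring) fun c d hcd a => ?_) c a
  · have t10 := htor 1 0
    have t20 := htor 2 0
    have t21 := htor 2 1
    fin_cases i <;> fin_cases j <;>
      simp [traceForm, conn_structureMatrix, frameSchouten_structureMatrix, Fin.sum_univ_three,
        cross_apply] at t10 t20 t21 ⊢ <;>
      linarith
  -- The system to be solved is the commutator of derivatives on `θ a`, corrected by `θ a` times the
  -- condition that `α` is closed.
  · have key : traceForm (structureMatrix l₁ l₂ l₃ m) α A c a * θ d
        - traceForm (structureMatrix l₁ l₂ l₃ m) α A d a * θ c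
        - (∑ b, traceForm (structureMatrix l₁ l₂ l₃ m) α A c b * θ b) *
          (1 : Matrix (Fin 3) (Fin 3) ℝ) d a
        + (∑ b, traceForm (structureMatrix l₁ l₂ l₃ m) α A d b * θ b) *
          (1 : Matrix (Fin 3) (Fin 3) ℝ) c a =
        (hessFormDeriv (structureMatrix l₁ l₂ l₃ m) α θ A c d a -
          hessFormDeriv (structureMatrix l₁ l₂ l₃ m) α θ A d c a -
          ∑ k, crossProduct (Pi.single c 1) (Pi.single d 1) k *
            ∑ b, structureMatrix l₁ l₂ l₃ m k b * hessForm (structureMatrix l₁ l₂ l₃ m) α θ b a) -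
        θ a * (A c d - A d c - ∑ k, crossProduct (Pi.single c 1) (Pi.single d 1) k *
          ∑ a, structureMatrix l₁ l₂ l₃ m k a * α a) := by
      simp only [traceForm, hessFormDeriv, hessForm, conn_structureMatrix,
        frameSchouten_structureMatrix, Fin.sum_univ_three, cross_apply]
      rcases hcd with ⟨rfl, rfl⟩ | ⟨rfl, rfl⟩ | ⟨rfl, rfl⟩ <;> fin_cases a <;>
        simp [Matrix.one_apply] <;> ring
    rw [key, sub_eq_zero.2 (hcomm c d a), sub_eq_zero.2 (htor c d)]
    ring

/-- The derivatives of the components `α` in the frame: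
`∇α = S + α α - ½ |α|² g + μ (|θ|² g - 2 θ θ)`. -/
noncomputable def alphaForm (L : Matrix (Fin 3) (Fin 3) ℝ) (α θ : Fin 3 → ℝ) (μ : ℝ)
    (c a : Fin 3) : ℝ :=
  ∑ b, conn L c b a * α b + frameSchouten L c a + α c * α a
    - (∑ b, α b * α b) / 2 * (1 : Matrix (Fin 3) (Fin 3) ℝ) c a
    + μ * ((∑ b, θ b * θ b) * (1 : Matrix (Fin 3) (Fin 3) ℝ) c a - 2 * θ c * θ a)

/-- The derivative along `E_c` of `alphaForm L α θ μ d a`, if `alphaForm L α θ μ`, `hessForm L α θ`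
and `ν` are the derivatives of `α`, `θ` and `μ`. -/
noncomputable def alphaFormDeriv (L : Matrix (Fin 3) (Fin 3) ℝ) (α θ : Fin 3 → ℝ) (μ : ℝ)
    (ν : Fin 3 → ℝ) (c d a : Fin 3) : ℝ :=
  ∑ b, conn L d b a * alphaForm L α θ μ c b
    + (alphaForm L α θ μ c d * α a + α d * alphaForm L α θ μ c a)
    - (∑ b, α b * alphaForm L α θ μ c b) * (1 : Matrix (Fin 3) (Fin 3) ℝ) d a
    + ν c * ((∑ b, θ b * θ b) * (1 : Matrix (Fin 3) (Fin 3) ℝ) d a - 2 * θ d * θ a)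
    + μ * (2 * (∑ b, θ b * hessForm L α θ c b) * (1 : Matrix (Fin 3) (Fin 3) ℝ) d a
      - 2 * (hessForm L α θ c d * θ a + θ d * hessForm L α θ c a))

-- This is the integrability condition for the equation of `α`. All terms cancel except the Cotton
-- tensor and the derivative `ν` of `μ`, so the Cotton tensor is `ν` antisymmetrized against `|θ|² g
-- - 2 θ θ`. Its dual, symmetric because `CY` is, is then minus the sum of `(θ × ν) θ` and its
-- transpose, which has rank at most two.
set_option maxHeartbeats 2000000 in
theorem det_frameCottonYork_eq_zero {μ : ℝ} {ν : Fin 3 → ℝ}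
    (hcomm : ∀ c d a, alphaFormDeriv (structureMatrix l₁ l₂ l₃ m) α θ μ ν c d a -
      alphaFormDeriv (structureMatrix l₁ l₂ l₃ m) α θ μ ν d c a =
        ∑ k, crossProduct (Pi.single c 1) (Pi.single d 1) k *
      ∑ b, structureMatrix l₁ l₂ l₃ m k b * alphaForm (structureMatrix l₁ l₂ l₃ m) α θ μ b a) :
    (frameCottonYork (structureMatrix l₁ l₂ l₃ m)).det = 0 := by
  have key : ∀ c d, (c = 1 ∧ d = 2 ∨ c = 2 ∧ d = 0 ∨ c = 0 ∧ d = 1) → ∀ a,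
      frameNablaSchouten (structureMatrix l₁ l₂ l₃ m) c d a -
      frameNablaSchouten (structureMatrix l₁ l₂ l₃ m) d c a =
      ν d * ((∑ b, θ b * θ b) * (1 : Matrix (Fin 3) (Fin 3) ℝ) c a - 2 * θ c * θ a) -
      ν c * ((∑ b, θ b * θ b) * (1 : Matrix (Fin 3) (Fin 3) ℝ) d a - 2 * θ d * θ a) := by
    intro c d hcd a
    have : alphaFormDeriv (structureMatrix l₁ l₂ l₃ m) α θ μ ν c d a -
        alphaFormDeriv (structureMatrix l₁ l₂ l₃ m) α θ μ ν d c a -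
        ∑ k, crossProduct (Pi.single c 1) (Pi.single d 1) k *
        ∑ b, structureMatrix l₁ l₂ l₃ m k b * alphaForm (structureMatrix l₁ l₂ l₃ m) α θ μ b a =
        ν c * ((∑ b, θ b * θ b) * (1 : Matrix (Fin 3) (Fin 3) ℝ) d a - 2 * θ d * θ a) -
        ν d * ((∑ b, θ b * θ b) * (1 : Matrix (Fin 3) (Fin 3) ℝ) c a - 2 * θ c * θ a)
        + (frameNablaSchouten (structureMatrix l₁ l₂ l₃ m) c d a -
          frameNablaSchouten (structureMatrix l₁ l₂ l₃ m) d c a) := by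
      simp only [alphaFormDeriv, alphaForm, hessForm, frameNablaSchouten, conn_structureMatrix,
        frameSchouten_structureMatrix, Fin.sum_univ_three, cross_apply, Matrix.sub_apply,
        Matrix.mul_apply]
      rcases hcd with ⟨rfl, rfl⟩ | ⟨rfl, rfl⟩ | ⟨rfl, rfl⟩ <;> fin_cases a <;>
        simp [Matrix.one_apply] <;> ring
    rw [sub_eq_zero.2 (hcomm c d a)] at this
    linarith
  set K := frameCottonYork (structureMatrix l₁ l₂ l₃ m) with hK
  have hs : K.IsSymm := by
    ext i j
    fin_cases i <;> fin_cases j <;>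
      simp [hK, frameCottonYork, frameNablaSchouten, conn_structureMatrix,
        frameSchouten_structureMatrix] <;> ring
  have k0 : ∀ b, K 0 b = _ := key 1 2 (by simp)
  have k1 : ∀ b, K 1 b = _ := key 2 0 (by simp)
  have k2 : ∀ b, K 2 b = _ := key 0 1 (by simp)
  -- Replacing the off-diagonal entries by their averages removes the antisymmetric part `|θ|² ν`,
  -- after which the determinant vanishes identically in `θ` and `ν`.
  have s01 : K 0 1 = (K 0 1 + K 1 0) / 2 := by rw [hs.apply 0 1]; ring
  have s02 : K 0 2 = (K 0 2 + K 2 0) / 2 := by rw [hs.apply 0 2]; ring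
  have s12 : K 1 2 = (K 1 2 + K 2 1) / 2 := by rw [hs.apply 1 2]; ring
  rw [Matrix.det_fin_three, hs.apply 0 1, hs.apply 0 2, hs.apply 1 2, s01, s02, s12]
  simp only [k0, k1, k2, Fin.sum_univ_three]
  simp
  ring

end Pointwise

end Carleman

namespace Carleman

/-! ### Nonexistence of weights from an invertible Cotton-York tensor -/

section Derivatives

variable {L : Matrix (Fin 3) (Fin 3) ℝ} {α θ : Fin 3 → R 3 → ℝ} {μ : R 3 → ℝ} {x v : R 3}

theorem fderiv_hessForm (hα : ∀ b, DifferentiableAt ℝ (α b) x)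
    (hθ : ∀ b, DifferentiableAt ℝ (θ b) x) {c : Fin 3}
    (he : ∀ a, fderiv ℝ (θ a) x v = hessForm L (fun b => α b x) (fun b => θ b x) c a)
    (d a : Fin 3) :
    fderiv ℝ (fun y => hessForm L (fun b => α b y) (fun b => θ b y) d a) x v =
      hessFormDeriv L (fun b => α b x) (fun b => θ b x) (fun _ b => fderiv ℝ (α b) x v) c d a := by
  have dα := fun b => (hα b).hasFDerivAt
  have dθ := fun b => (hθ b).hasFDerivAt
  have h := ((((dα d).fun_mul (dθ a)).fun_add ((dα a).fun_mul (dθ d))).fun_sub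
    ((HasFDerivAt.fun_sum (u := Finset.univ) fun b _ => (dα b).fun_mul (dθ b)).mul_const
      ((1 : Matrix (Fin 3) (Fin 3) ℝ) d a))).fun_add
    (HasFDerivAt.fun_sum (u := Finset.univ) fun b _ => (dθ b).const_mul (conn L d b a))
  refine (congrArg (fun T : R 3 →L[ℝ] ℝ => T v) h.fderiv).trans ?_
  simp only [_root_.add_apply, _root_.sub_apply, _root_.smul_apply, smul_eq_mul,
    he, hessFormDeriv, Fin.sum_univ_three]
  ring

theorem fderiv_alphaForm (hα : ∀ b, DifferentiableAt ℝ (α b) x)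
    (hθ : ∀ b, DifferentiableAt ℝ (θ b) x) (hμ : DifferentiableAt ℝ μ x) {c : Fin 3}
    (he : ∀ a, fderiv ℝ (θ a) x v = hessForm L (fun b => α b x) (fun b => θ b x) c a)
    (he' : ∀ a, fderiv ℝ (α a) x v = alphaForm L (fun b => α b x) (fun b => θ b x) (μ x) c a)
    (d a : Fin 3) :
    fderiv ℝ (fun y => alphaForm L (fun b => α b y) (fun b => θ b y) (μ y) d a) x v =
      alphaFormDeriv L (fun b => α b x) (fun b => θ b x) (μ x) (fun _ => fderiv ℝ μ x v) c d a := by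
  have dα := fun b => (hα b).hasFDerivAt
  have dθ := fun b => (hθ b).hasFDerivAt
  have h := (((((HasFDerivAt.fun_sum (u := Finset.univ) fun b _ =>
    (dα b).const_mul (conn L d b a)).add_const (frameSchouten L d a)).fun_add
    ((dα d).fun_mul (dα a))).fun_sub
    (((HasFDerivAt.fun_sum (u := Finset.univ) fun b _ => (dα b).fun_mul (dα b)).mul_const
      ((2 : ℝ)⁻¹)).mul_const ((1 : Matrix (Fin 3) (Fin 3) ℝ) d a)))).fun_add
    (hμ.hasFDerivAt.fun_mul (((HasFDerivAt.fun_sum (u := Finset.univ) fun b _ =>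
      (dθ b).fun_mul (dθ b)).mul_const ((1 : Matrix (Fin 3) (Fin 3) ℝ) d a)).fun_sub
      (((dθ d).const_mul 2).fun_mul (dθ a))))
  refine (congrArg (fun T : R 3 →L[ℝ] ℝ => T v) h.fderiv).trans ?_
  simp only [_root_.add_apply, _root_.sub_apply, _root_.smul_apply, smul_eq_mul,
    he, he', alphaFormDeriv, Fin.sum_univ_three]
  ring

end Derivatives

variable {F : R 3 → Matrix (Fin 3) (Fin 3) ℝ} {l₁ l₂ l₃ m : ℝ}

/-- If the Cotton-York tensor of a left-invariant metric is invertible then no open set carries a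
limiting Carleman weight. -/
theorem IsCoframe.nowhereAdmitsLCW {g : MetricField (𝓡 3) (R 3)}
    (h : IsCoframe (coeffs g) F (structureMatrix l₁ l₂ l₃ m))
    (hdet : (frameCottonYork (structureMatrix l₁ l₂ l₃ m)).det ≠ 0) :
    NowhereAdmitsLCW (stdBasis 3) (𝓡 3) g := by
  rintro U hU ⟨x₀, hx₀⟩ ⟨φ, hφ⟩
  set L := structureMatrix l₁ l₂ l₃ m with hL
  have sφ : ContDiffOn ℝ ∞ φ U := hφ.smooth.contDiffOn
  set θ : Fin 3 → R 3 → ℝ := fun a => lie F a φ with hθ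
  have sθ : ∀ a, ContDiffOn ℝ ∞ (θ a) U := fun a => h.contDiffOn_lie hU sφ a
  have hρ : ∀ x ∈ U, ∑ a, θ a x * θ a x ≠ 0 := fun x hx h0 => by
    have h1 : ∀ a, θ a x = 0 := fun a => mul_self_eq_zero.1
      ((Finset.sum_eq_zero_iff_of_nonneg fun a _ => mul_self_nonneg (θ a x)).1 h0 a
        (Finset.mem_univ a))
    have h2 : fderiv ℝ φ x = 0 := by
      refine ContinuousLinearMap.coe_injective ((stdBasis 3).ext fun i => ?_)
      refine (fderiv_stdBasis φ x i).trans ?_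
      rw [h.pd_eq]
      exact Finset.sum_eq_zero fun a _ => by rw [show lie F a φ x = 0 from h1 a, mul_zero]
    exact hφ.diff_ne_zero x hx (by rw [mfderiv_eq_fderiv]; exact h2)
  have dif : ∀ {f : R 3 → ℝ}, ContDiffOn ℝ ∞ f U → ∀ x ∈ U, DifferentiableAt ℝ f x :=
    fun hf x hx => (hf.contDiffAt (hU.mem_nhds hx)).differentiableAt (by simp)
  have sρ : ContDiffOn ℝ ∞ (fun x => ∑ a, θ a x * θ a x) U :=
    ContDiffOn.sum fun a _ => (sθ a).mul (sθ a)
  -- `f = log |dφ|` is the exponent of the conformal factor that makes `dφ` parallel, and `α` is its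
  -- differential in the frame. Obtaining `α` from a function is what gives its commutator relation.
  set f : R 3 → ℝ := fun x => 1 / 2 * Real.log (∑ a, θ a x * θ a x) with hf
  have sf : ContDiffOn ℝ ∞ f U := contDiffOn_const.mul (sρ.log hρ)
  set α : Fin 3 → R 3 → ℝ := fun a => lie F a f with hα
  have sα : ∀ a, ContDiffOn ℝ ∞ (α a) U := fun a => h.contDiffOn_lie hU sf a
  have eα : ∀ x ∈ U, ∀ c, (∑ a, θ a x * θ a x) * α c x = ∑ a, θ a x * lie F c (θ a) x := by
    intro x hx c
    have h1 := (((HasFDerivAt.fun_sum (u := Finset.univ) fun a _ =>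
      (dif (sθ a) x hx).hasFDerivAt.fun_mul (dif (sθ a) x hx).hasFDerivAt).log
        (hρ x hx)).const_mul (1 / 2)).fderiv
    rw [hα]
    simp only [lie_eq_fderiv]
    rw [hf, h1]
    simp only [_root_.add_apply, _root_.smul_apply, _root_.sum_apply, smul_eq_mul]
    rw [← mul_assoc, mul_comm _ (1 / 2 : ℝ), mul_assoc, mul_inv_cancel_left₀ (hρ x hx),
      Finset.mul_sum]
    exact Finset.sum_congr rfl fun a _ => by ring
  have eθ : ∀ x ∈ U, ∀ c a, lie F c (θ a) x =
      hessForm L (fun b => α b x) (fun b => θ b x) c a := fun x hx c a =>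
    eq_hessForm (θ := fun b => θ b x) (α := fun b => α b x) (Θ := fun c a => lie F c (θ a) x)
      (hρ x hx) (fun c b => h.lie_lie_sub hU sφ hx c b)
      (fun η h0 h1 => h.bracket_condition hU hφ hx h0 h1) (eα x hx) c a
  set A : R 3 → Fin 3 → Fin 3 → ℝ := fun x c b => lie F c (α b) x with hA
  -- The equation for `dφ` holds on the open set `U`, so it may be differentiated once more.
  have hcθ : ∀ x ∈ U, ∀ c d a, lie F c (lie F d (θ a)) x =
      hessFormDeriv L (fun b => α b x) (fun b => θ b x) (A x) c d a := fun x hx c d a => by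
    have h1 : lie F d (θ a) =ᶠ[nhds x]
        fun y => hessForm L (fun b => α b y) (fun b => θ b y) d a :=
      Filter.eventuallyEq_of_mem (hU.mem_nhds hx) fun y hy => eθ y hy d a
    rw [lie_congr h1, lie_eq_fderiv, fderiv_hessForm (c := c) (fun b => dif (sα b) x hx)
      (fun b => dif (sθ b) x hx) (fun a => by rw [← lie_eq_fderiv]; exact eθ x hx c a)]
    simp only [hessFormDeriv, hA, ← lie_eq_fderiv]
  have hT : ∀ x ∈ U, ∀ c a, (∑ b, θ b x * θ b x) * traceForm L (fun b => α b x) (A x) c a =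
      (∑ b, traceForm L (fun b => α b x) (A x) b b) *
      ((∑ b, θ b x * θ b x) * (1 : Matrix (Fin 3) (Fin 3) ℝ) c a - 2 * θ c x * θ a x) :=
    fun x hx c a => traceForm_eq (θ := fun b => θ b x)
      (fun c b => h.lie_lie_sub hU sf hx c b)
      (fun c d a => by
        rw [← hcθ x hx, ← hcθ x hx, h.lie_lie_sub hU (sθ a) hx]
        simp only [eθ x hx]
        rfl) c a
  -- The one function that the integrability condition leaves free in `∇α`. Geometrically it is
  -- `-1/2` times the Gauss curvature of the surface factor.
  set μ : R 3 → ℝ := fun x =>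
    (∑ b, traceForm L (fun b => α b x) (A x) b b) / ∑ b, θ b x * θ b x with hμ
  have sμ : ContDiffOn ℝ ∞ μ U := by
    refine ContDiffOn.div (ContDiffOn.sum fun b _ => ?_) sρ hρ
    have sA : ∀ c b, ContDiffOn ℝ ∞ (fun x => A x c b) U := fun c b => h.contDiffOn_lie hU (sα b) c
    unfold traceForm
    exact ((((sA b b).sub (ContDiffOn.sum fun c _ => contDiffOn_const.mul (sα c))).sub
      contDiffOn_const).sub ((sα b).mul (sα b))).add (((ContDiffOn.sum fun c _ =>
        (sα c).mul (sα c)).div_const 2).mul contDiffOn_const)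
  have eα' : ∀ x ∈ U, ∀ c a, lie F c (α a) x =
      alphaForm L (fun b => α b x) (fun b => θ b x) (μ x) c a := fun x hx c a => by
    have h1 := hT x hx c a
    have h2 : traceForm L (fun b => α b x) (A x) c a = μ x *
        ((∑ b, θ b x * θ b x) * (1 : Matrix (Fin 3) (Fin 3) ℝ) c a - 2 * θ c x * θ a x) := by
      rw [hμ]
      beta_reduce
      rw [div_mul_eq_mul_div, eq_div_iff (hρ x hx)]
      linear_combination h1
    rw [traceForm] at h2
    rw [alphaForm, ← h2]
    simp only [hA]
    ring
  refine hdet (det_frameCottonYork_eq_zero (α := fun b => α b x₀) (θ := fun b => θ b x₀)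
    (μ := μ x₀) (ν := fun c => lie F c μ x₀) fun c d a => ?_)
  have hcα : ∀ c d a, lie F c (lie F d (α a)) x₀ =
      alphaFormDeriv L (fun b => α b x₀) (fun b => θ b x₀) (μ x₀) (fun c => lie F c μ x₀) c d a :=
    fun c d a => by
      have h1 : lie F d (α a) =ᶠ[nhds x₀]
          fun y => alphaForm L (fun b => α b y) (fun b => θ b y) (μ y) d a :=
        Filter.eventuallyEq_of_mem (hU.mem_nhds hx₀) fun y hy => eα' y hy d a
      rw [lie_congr h1, lie_eq_fderiv, fderiv_alphaForm (c := c) (fun b => dif (sα b) x₀ hx₀)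
        (fun b => dif (sθ b) x₀ hx₀) (dif sμ x₀ hx₀)
        (fun a => by rw [← lie_eq_fderiv]; exact eθ x₀ hx₀ c a)
        (fun a => by rw [← lie_eq_fderiv]; exact eα' x₀ hx₀ c a)]
      simp only [alphaFormDeriv, ← lie_eq_fderiv]
  rw [← hcα, ← hcα, h.lie_lie_sub hU (sα a) hx₀]
  simp only [eα' x₀ hx₀]
  rfl

end Carleman

namespace Carleman

/-! ### Left-invariant coframes of `Nil` and of the universal cover of `SL(2, ℝ)` -/

theorem pd_const {n : ℕ} (i : Fin n) (c : ℝ) (x : R n) : pd i (fun _ => c) x = 0 := by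
  simp [pd]

theorem pd_coord {n : ℕ} (i k : Fin n) (x : R n) :
    pd i (fun y => y k) x = if k = i then 1 else 0 := by
  have h : HasFDerivAt (fun y : R n => y k) (EuclideanSpace.proj k : R n →L[ℝ] ℝ) x :=
    (EuclideanSpace.proj k : R n →L[ℝ] ℝ).hasFDerivAt
  rw [pd, h.fderiv]
  simp [e]

theorem pd_add {n : ℕ} {f g : R n → ℝ} {x : R n} (hf : DifferentiableAt ℝ f x)
    (hg : DifferentiableAt ℝ g x) (i : Fin n) :
    pd i (fun y => f y + g y) x = pd i f x + pd i g x := by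
  rw [pd, (hf.hasFDerivAt.fun_add hg.hasFDerivAt).fderiv]; rfl

theorem pd_mul {n : ℕ} {f g : R n → ℝ} {x : R n} (hf : DifferentiableAt ℝ f x)
    (hg : DifferentiableAt ℝ g x) (i : Fin n) :
    pd i (fun y => f y * g y) x = f x * pd i g x + g x * pd i f x := by
  rw [pd, (hf.hasFDerivAt.fun_mul hg.hasFDerivAt).fderiv]; rfl

theorem pd_exp {n : ℕ} {f : R n → ℝ} {x : R n} (hf : DifferentiableAt ℝ f x) (i : Fin n) :
    pd i (fun y => Real.exp (f y)) x = Real.exp (f x) * pd i f x := by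
  rw [pd, hf.hasFDerivAt.exp.fderiv]; rfl

theorem pd_neg {n : ℕ} (f : R n → ℝ) (x : R n) (i : Fin n) :
    pd i (fun y => -f y) x = -pd i f x := by
  rw [pd, fderiv_fun_neg]; rfl

theorem coeffs_eq_of_coframe {g : MetricField (𝓡 3) (R 3)} {x : R 3}
    {Fx : Matrix (Fin 3) (Fin 3) ℝ}
    (h : ∀ i j, g x (e i) (e j) = ∑ a, Fx a i * Fx a j) : coeffs g x = Fxᵀ * Fx := by
  ext i j
  simp [coeffs, h, Matrix.mul_apply]

/-- The left-invariant coframe `dx, dy, dz - x dy` of `Nil`. -/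
def nilFrame (x : R 3) : Matrix (Fin 3) (Fin 3) ℝ := !![1, 0, 0; 0, 1, 0; 0, -x 0, 1]

theorem isCoframe_nil : IsCoframe (coeffs nilMetric) nilFrame (structureMatrix 0 0 1 0) where
  smooth a i := by fin_cases a <;> fin_cases i <;> simp [nilFrame] <;> fun_prop
  det_ne_zero x := by simp [nilFrame, Matrix.det_fin_three]
  metric x := coeffs_eq_of_coframe fun i j => by
    fin_cases i <;> fin_cases j <;> simp [nilMetric, nilFrame, Fin.sum_univ_three, e]
  structure_eq x a i j := by
    fin_cases a <;> fin_cases i <;> fin_cases j <;>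
      simp [nilFrame, pd_const, pd_coord, pd_neg, Fin.sum_univ_three, cross_apply]

/-- The matrix of the left-invariant coframe on the universal cover of `SL(2, ℝ)`. -/
noncomputable def slFrame (x : R 3) : Matrix (Fin 3) (Fin 3) ℝ :=
  !![Real.exp (x 1), 0, 0; 2 * x 2 * Real.exp (x 1), 1, 0;
    (x 2 ^ 2 - 1) * Real.exp (x 1) + Real.exp (-x 1), x 2, 1]

theorem slCoframe_e (x : R 3) (a i : Fin 3) : slCoframe x (e i) a = slFrame x a i := by
  fin_cases a <;> fin_cases i <;> simp [slCoframe, slFrame, e]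

theorem contDiff_slFrame (a i : Fin 3) : ContDiff ℝ ∞ fun x => slFrame x a i := by
  fin_cases a <;> fin_cases i <;> simp [slFrame] <;> fun_prop

theorem pd_slFrame (x : R 3) (k a i : Fin 3) : pd k (fun y => slFrame y a i) x =
    ![0, !![Real.exp (x 1), 0, 0; 2 * x 2 * Real.exp (x 1), 0, 0;
        (x 2 ^ 2 - 1) * Real.exp (x 1) - Real.exp (-x 1), 0, 0],
      !![0, 0, 0; 2 * Real.exp (x 1), 0, 0; 2 * x 2 * Real.exp (x 1), 1, 0]] k a i := by
  have d : ∀ k, DifferentiableAt ℝ (fun y : R 3 => y k) x := fun k => by fun_prop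
  have h0 : pd k (fun y => Real.exp (y 1)) x = Real.exp (x 1) * if 1 = k then 1 else 0 := by
    rw [pd_exp (d 1), pd_coord]
  have h1 : pd k (fun y => 2 * y 2 * Real.exp (y 1)) x =
      2 * x 2 * (Real.exp (x 1) * if 1 = k then 1 else 0) +
        Real.exp (x 1) * (2 * if 2 = k then 1 else 0) := by
    rw [pd_mul (by fun_prop) (by fun_prop), h0, pd_mul (by fun_prop) (d 2), pd_coord, pd_const]
    ring
  have h2 : pd k (fun y => (y 2 ^ 2 - 1) * Real.exp (y 1) + Real.exp (-y 1)) x =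
      (x 2 ^ 2 - 1) * (Real.exp (x 1) * if 1 = k then 1 else 0) +
        Real.exp (x 1) * (2 * x 2 * if 2 = k then 1 else 0) -
          Real.exp (-x 1) * if 1 = k then 1 else 0 := by
    have e2 : (fun y : R 3 => (y 2 ^ 2 - 1) * Real.exp (y 1) + Real.exp (-y 1)) =
        fun y => (y 2 * y 2 + -1) * Real.exp (y 1) + Real.exp (-y 1) := by
      funext y; ring
    rw [e2, pd_add (by fun_prop) (by fun_prop), pd_mul (by fun_prop) (by fun_prop), h0,
      pd_exp (by fun_prop), pd_neg, pd_coord, pd_add (by fun_prop) (by fun_prop),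
      pd_mul (d 2) (d 2), pd_coord, pd_const]
    ring
  fin_cases a <;> fin_cases i <;> simp [slFrame, pd_const, pd_coord, h0, h1, h2] <;>
    fin_cases k <;> simp <;> ring

/-- The structure matrix records `[sl₂, sl₃] = sl₃`, `[sl₃, sl₁] = -2 sl₂` and `[sl₁, sl₂] = sl₁ - 2
sl₃`. -/
theorem slFrame_structure (x : R 3) (a i j : Fin 3) :
    pd i (fun y => slFrame y a j) x - pd j (fun y => slFrame y a i) x =
      -∑ k, structureMatrix 0 (-2) (-2) 1 k a *
        crossProduct (fun c => slFrame x c i) (fun c => slFrame x c j) k := by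
  have hexp : Real.exp (x 1) * Real.exp (-x 1) = 1 := by rw [← Real.exp_add]; simp
  simp only [pd_slFrame]
  fin_cases a <;> fin_cases i <;> fin_cases j <;>
    simp [slFrame, Fin.sum_univ_three, cross_apply] <;> ring

theorem isCoframe_sl : IsCoframe (coeffs slMetric) slFrame (structureMatrix 0 (-2) (-2) 1) where
  smooth := contDiff_slFrame
  det_ne_zero x := by simp [slFrame, Matrix.det_fin_three]
  metric x := coeffs_eq_of_coframe fun i j => by
    simp [slMetric, slCoframe_e, Fin.sum_univ_three]
  structure_eq := slFrame_structure

/-- The left-invariant coframe dual to `sl₁ / (2 k), sl₂, sl₃ - sl₁ / 2`. -/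
noncomputable def slFiberFrame (k : ℝ) (x : R 3) : Matrix (Fin 3) (Fin 3) ℝ :=
  Matrix.of ![fun i => k * (2 * slFrame x 0 i + slFrame x 2 i), slFrame x 1, slFrame x 2]

/-- Put `u = sl₁ / (2 k)`, `v = sl₂`, `w = sl₃ - sl₁ / 2`. Then `[v, w] = k u`, `[w, u] = -v / k`
and `[u, v] = -w / k`, so the structure matrix is diagonal, with two equal entries that reflect the
rotational symmetry. -/
theorem isCoframe_slFiber {k : ℝ} (hk : k ≠ 0) : IsCoframe (coeffs (slMetricOfFiber (k ^ 2)))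
    (slFiberFrame k) (structureMatrix k (-1 / k) (-1 / k) 0) where
  smooth a i := by
    have := contDiff_slFrame
    fin_cases a <;> simp [slFiberFrame] <;> fun_prop
  det_ne_zero x := by
    have : (slFiberFrame k x).det = k * (2 * Real.exp (x 1)) := by
      simp [slFiberFrame, slFrame, Matrix.det_fin_three]; ring
    rw [this]
    positivity
  metric x := coeffs_eq_of_coframe fun i j => by
    simp [slMetricOfFiber, slCoframe_e, Fin.sum_univ_three, slFiberFrame]
    ring
  structure_eq x a i j := by
    have d : ∀ a i, DifferentiableAt ℝ (fun y => slFrame y a i) x := fun a i =>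
      (contDiff_slFrame a i).differentiable (by simp) x
    have h0 : ∀ i j, pd i (fun y => k * (2 * slFrame y 0 j + slFrame y 2 j)) x =
        k * (2 * pd i (fun y => slFrame y 0 j) x + pd i (fun y => slFrame y 2 j) x) := fun i j => by
      rw [pd_mul (by fun_prop) (((d 0 j).const_mul 2).fun_add (d 2 j)),
        pd_add ((d 0 j).const_mul 2) (d 2 j), pd_mul (by fun_prop) (d 0 j), pd_const, pd_const]
      ring
    have s := slFrame_structure x
    have s0 := s 0 i j
    have s1 := s 1 i j
    have s2 := s 2 i j
    simp [Fin.sum_univ_three, cross_apply] at s0 s1 s2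
    fin_cases a <;> simp [slFiberFrame, Fin.sum_univ_three, cross_apply, h0]
    · linear_combination 2 * k * s0 + k * s2
    · field_simp
      linear_combination s1
    · field_simp
      linear_combination s2

theorem det_frameCottonYork_nil : (frameCottonYork (structureMatrix 0 0 1 0)).det ≠ 0 := by
  simp [frameCottonYork, frameNablaSchouten, conn_structureMatrix, frameSchouten_structureMatrix,
    Matrix.det_fin_three]
  norm_num

theorem det_frameCottonYork_sl : (frameCottonYork (structureMatrix 0 (-2) (-2) 1)).det ≠ 0 := by
  simp [frameCottonYork, frameNablaSchouten, conn_structureMatrix, frameSchouten_structureMatrix,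
    Matrix.det_fin_three]
  norm_num

/-- Invertible unless `l = 0` or `l = q`. For the metrics on the cover of `SL(2, ℝ)` the numbers `l
= k` and `q = -1 / k` have opposite signs, so neither occurs. -/
theorem frameCottonYork_diagonal (l q : ℝ) : frameCottonYork (structureMatrix l q q 0) =
    !![-(l ^ 2 * (l - q)), 0, 0; 0, l ^ 2 * (l - q) / 2, 0; 0, 0, l ^ 2 * (l - q) / 2] := by
  ext i j
  fin_cases i <;> fin_cases j <;>
    simp [frameCottonYork, frameNablaSchouten, conn_structureMatrix,
      frameSchouten_structureMatrix] <;> ring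

theorem det_frameCottonYork_slFiber {k : ℝ} (hk : 0 < k) :
    (frameCottonYork (structureMatrix k (-1 / k) (-1 / k) 0)).det ≠ 0 := by
  have h : 0 < k ^ 2 * (k - -1 / k) := by
    have : 0 < 1 / k := by positivity
    rw [neg_div, sub_neg_eq_add]
    positivity
  rw [frameCottonYork_diagonal]
  generalize k ^ 2 * (k - -1 / k) = a at h
  simp [Matrix.det_fin_three, h.ne']

end Carleman

namespace Carleman

/-! ### The Cotton-York tensor of a left-invariant metric -/

section Algebra

variable {l₁ l₂ l₃ m : ℝ}

/-- The connection `∇_p q = (M p) × q` has no torsion; this fixes `M = ½ (tr L) 1 - L`. -/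
theorem torsion_identity (p q : Fin 3 → ℝ) (a : Fin 3) :
    crossProduct (milnor (structureMatrix l₁ l₂ l₃ m) *ᵥ p) q a
      - crossProduct (milnor (structureMatrix l₁ l₂ l₃ m) *ᵥ q) p a =
      ∑ k, structureMatrix l₁ l₂ l₃ m k a * crossProduct p q k := by
  simp only [milnor_structureMatrix, cross_apply, Fin.sum_univ_three, Matrix.mulVec, dotProduct]
  fin_cases a <;> simp <;> ring

/-- The commutator of `(M p) ×` and `(M q) ×` is the cross product with `M p × M q`, which is
`adj(M) (p × q)` for symmetric `M`. The derivatives of the coframe contribute `M dω`, that is `-M L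
(p × q)`. The other derivative terms cancel. -/
theorem curvature_identity {p q r dij dji dil djl : Fin 3 → ℝ}
    (h : ∀ a, dij a - dji a = -∑ k, structureMatrix l₁ l₂ l₃ m k a * crossProduct p q k)
    (a : Fin 3) :
    let M := milnor (structureMatrix l₁ l₂ l₃ m)
    crossProduct (M *ᵥ p) (djl + crossProduct (M *ᵥ q) r) a
      + (crossProduct (M *ᵥ dij) r a + crossProduct (M *ᵥ q) dil a)
      - crossProduct (M *ᵥ q) (dil + crossProduct (M *ᵥ p) r) a
      - (crossProduct (M *ᵥ dji) r a + crossProduct (M *ᵥ p) djl a) =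
    crossProduct (curvatureOp (structureMatrix l₁ l₂ l₃ m) *ᵥ crossProduct p q) r a := by
  have h' : dij = fun a => dji a - ∑ k, structureMatrix l₁ l₂ l₃ m k a * crossProduct p q k :=
    funext fun a => by linarith [h a]
  subst h'
  simp only [milnor_structureMatrix, curvatureOp_structureMatrix, cross_apply, Fin.sum_univ_three,
    Matrix.mulVec, dotProduct]
  fin_cases a <;> simp <;> ring

/-- Tracing over the coordinate index is tracing over the frame, since `X` is inverse to `F`. The
trace of `P (e_c × q) × r` over `c` is the form of `P - (tr P) 1`. -/
theorem ricci_identity (P : Matrix (Fin 3) (Fin 3) ℝ) {F X : Matrix (Fin 3) (Fin 3) ℝ}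
    (h : F * X = 1) (q r : Fin 3 → ℝ) :
    ∑ i, ∑ a, X i a * crossProduct (P *ᵥ crossProduct (fun c => F c i) q) r a =
      q ⬝ᵥ ((P - P.trace • 1) *ᵥ r) := by
  have h1 : ∀ c a, F c 0 * X 0 a + F c 1 * X 1 a + F c 2 * X 2 a =
      (1 : Matrix (Fin 3) (Fin 3) ℝ) c a := fun c a => by
    rw [← h, Matrix.mul_apply, Fin.sum_univ_three]
  have h2 : ∑ i, ∑ a, X i a * crossProduct (P *ᵥ crossProduct (fun c => F c i) q) r a =
      ∑ c, ∑ a, (F c 0 * X 0 a + F c 1 * X 1 a + F c 2 * X 2 a) *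
        crossProduct (P *ᵥ crossProduct (Pi.single c 1) q) r a := by
    simp only [cross_apply, Fin.sum_univ_three, Matrix.mulVec, dotProduct]
    simp
    ring
  rw [h2]
  simp only [h1]
  simp [cross_apply, Fin.sum_univ_three, Matrix.mulVec, dotProduct, Matrix.trace_fin_three,
    Matrix.one_apply]
  ring

/-- The cross products of the columns of `F` are the columns of its cofactor matrix; contraction
with `Fᵀ F` turns them into `det F` times the columns of `F`. -/
theorem cottonYork_identity (F : Matrix (Fin 3) (Fin 3) ℝ) (v : Fin 3 → ℝ) (j : Fin 3) :
    (Fᵀ * F) j 0 * (v ⬝ᵥ crossProduct (fun c => F c 1) (fun c => F c 2))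
      + (Fᵀ * F) j 1 * (v ⬝ᵥ crossProduct (fun c => F c 2) (fun c => F c 0))
      + (Fᵀ * F) j 2 * (v ⬝ᵥ crossProduct (fun c => F c 0) (fun c => F c 1)) =
    F.det * (v ⬝ᵥ fun c => F c j) := by
  simp only [Matrix.mul_apply, Matrix.transpose_apply, cross_apply, Fin.sum_univ_three, dotProduct,
    Matrix.det_fin_three]
  fin_cases j <;> simp <;> ring

/-- The difference is antisymmetric in `p` and `q`, so it depends on `p × q` only; on pairs of frame
vectors it is the definition of `frameCottonYork`. -/
theorem nabla_identity {L : Matrix (Fin 3) (Fin 3) ℝ} (hL : (milnor L).IsSymm) (p q r : Fin 3 → ℝ) :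
    (-(crossProduct (milnor L *ᵥ p) q ⬝ᵥ (frameSchouten L *ᵥ r))
      - q ⬝ᵥ (frameSchouten L *ᵥ crossProduct (milnor L *ᵥ p) r)) -
    (-(crossProduct (milnor L *ᵥ q) p ⬝ᵥ (frameSchouten L *ᵥ r))
      - p ⬝ᵥ (frameSchouten L *ᵥ crossProduct (milnor L *ᵥ q) r)) =
    (r ᵥ* (frameCottonYork L)ᵀ) ⬝ᵥ crossProduct p q := by
  have h10 := hL.apply 0 1
  have h20 := hL.apply 0 2
  have h21 := hL.apply 1 2
  unfold frameCottonYork frameNablaSchouten conn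
  generalize milnor L = M at *
  generalize frameSchouten L = S
  simp only [cross_apply, Fin.sum_univ_three, Matrix.mulVec, Matrix.vecMul, dotProduct, skew,
    Matrix.transpose_apply, Matrix.of_apply]
  simp [Matrix.mul_apply, Matrix.vecMul, dotProduct, Fin.sum_univ_three, h10, h20, h21]
  ring

end Algebra

variable {G F : R 3 → Matrix (Fin 3) (Fin 3) ℝ} {l₁ l₂ l₃ m : ℝ}

/-- The vector of the frame components of `∇_i ∂_j`. -/
noncomputable def coframeConn (F : R 3 → Matrix (Fin 3) (Fin 3) ℝ)
    (L : Matrix (Fin 3) (Fin 3) ℝ) (i j : Fin 3) (x : R 3) : Fin 3 → ℝ :=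
  (fun a => pd i (fun y => F y a j) x) +
    crossProduct (milnor L *ᵥ fun c => F x c i) (fun c => F x c j)

namespace IsCoframe

theorem coframeConn_comm (h : IsCoframe G F (structureMatrix l₁ l₂ l₃ m)) (i j : Fin 3) (x : R 3) :
    coframeConn F (structureMatrix l₁ l₂ l₃ m) i j x =
      coframeConn F (structureMatrix l₁ l₂ l₃ m) j i x := by
  funext a
  have h1 := h.structure_eq x a i j
  have h2 := torsion_identity (l₁ := l₁) (l₂ := l₂) (l₃ := l₃) (m := m)
    (fun c => F x c i) (fun c => F x c j) a
  simp only [coframeConn, Pi.add_apply]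
  linarith

theorem differentiableAt (h : IsCoframe G F (structureMatrix l₁ l₂ l₃ m)) (x : R 3) (a i : Fin 3) :
    DifferentiableAt ℝ (fun y => F y a i) x :=
  (h.smooth a i).differentiable (by simp) x

theorem metric_inv (h : IsCoframe G F (structureMatrix l₁ l₂ l₃ m)) (x : R 3) :
    (G x)⁻¹ = (F x)⁻¹ * ((F x)⁻¹)ᵀ := by
  rw [h.metric, Matrix.mul_inv_rev, Matrix.transpose_nonsing_inv]

/-- Compatibility with the metric: the cross product with `M p` is skew, so its contributions cancel
between the two terms. -/
theorem pd_metric (h : IsCoframe G F (structureMatrix l₁ l₂ l₃ m)) (k i j : Fin 3) (x : R 3) :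
    pd k (fun y => G y i j) x = ∑ a, (F x a i * coframeConn F (structureMatrix l₁ l₂ l₃ m) k j x a +
      F x a j * coframeConn F (structureMatrix l₁ l₂ l₃ m) k i x a) := by
  have hG : (fun y => G y i j) = fun y => ∑ a, F y a i * F y a j := funext fun y => by
    rw [h.metric]; simp [Matrix.mul_apply]
  have := (HasFDerivAt.fun_sum (u := Finset.univ) fun a _ =>
    (h.differentiableAt x a i).hasFDerivAt.fun_mul (h.differentiableAt x a j).hasFDerivAt).fderiv
  rw [hG]
  refine (congrArg (fun T : R 3 →L[ℝ] ℝ => T (e k)) this).trans ?_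
  simp only [_root_.add_apply, _root_.smul_apply, smul_eq_mul, coframeConn, pd,
    Pi.add_apply, cross_apply, Fin.sum_univ_three]
  simp
  ring

/-- The Koszul formula: without torsion and with metric compatibility, the three derivatives of the
metric combine into twice the frame components of `∇_i ∂_j`. -/
theorem christoffel_eq (h : IsCoframe G F (structureMatrix l₁ l₂ l₃ m)) (k i j : Fin 3) (x : R 3) :
    christoffel G k i j x =
      ∑ a, (F x)⁻¹ k a * coframeConn F (structureMatrix l₁ l₂ l₃ m) i j x a := by
  have h1 : ∀ l, pd i (fun y => G y j l) x + pd j (fun y => G y i l) x - pd l (fun y => G y i j) x =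
      2 * ∑ a, F x a l * coframeConn F (structureMatrix l₁ l₂ l₃ m) i j x a := fun l => by
    rw [h.pd_metric, h.pd_metric, h.pd_metric, h.coframeConn_comm l i, h.coframeConn_comm l j,
      h.coframeConn_comm j i]
    simp only [Fin.sum_univ_three]
    ring
  have h2 : ∀ a, ∑ l, (G x)⁻¹ k l * F x a l = (F x)⁻¹ k a := fun a => by
    have : (G x)⁻¹ * (F x)ᵀ = (F x)⁻¹ := by
      rw [h.metric_inv, Matrix.mul_assoc, ← Matrix.transpose_mul, h.mul_inv]; simp
    exact congrFun (congrFun this k) a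
  simp only [christoffel, h1, ← h2]
  simp only [Fin.sum_univ_three]
  ring

theorem sum_mul_christoffel (h : IsCoframe G F (structureMatrix l₁ l₂ l₃ m)) (a i j : Fin 3)
    (x : R 3) : ∑ k, F x a k * christoffel G k i j x =
      coframeConn F (structureMatrix l₁ l₂ l₃ m) i j x a := by
  have : (F x *ᵥ ((F x)⁻¹ *ᵥ coframeConn F (structureMatrix l₁ l₂ l₃ m) i j x)) a =
      coframeConn F (structureMatrix l₁ l₂ l₃ m) i j x a := by
    rw [Matrix.mulVec_mulVec, h.mul_inv, Matrix.one_mulVec]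
  rw [← this]
  simp only [h.christoffel_eq]
  rfl

/-- Written with Christoffel symbols so that the quadratic terms in the Ricci tensor cancel against
the derivative of `F⁻¹`. -/
theorem pd_inv (h : IsCoframe G F (structureMatrix l₁ l₂ l₃ m)) (i k a : Fin 3) (x : R 3) :
    pd i (fun y => (F y)⁻¹ k a) x = -∑ n, ((christoffel G k i n x) -
      ∑ b, (F x)⁻¹ k b * crossProduct (milnor (structureMatrix l₁ l₂ l₃ m) *ᵥ fun c => F x c i)
        (fun c => F x c n) b) * (F x)⁻¹ n a := by
  rw [pd, fderiv_matrix_inv (h.differentiableAt x) (h.det_ne_zero x), Finset.sum_comm]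
  congr 1
  refine Finset.sum_congr rfl fun n _ => ?_
  rw [h.christoffel_eq, ← Finset.sum_sub_distrib, Finset.sum_mul]
  refine Finset.sum_congr rfl fun b _ => ?_
  simp only [coframeConn, Pi.add_apply, pd]
  ring

theorem differentiableAt_coframeConn (h : IsCoframe G F (structureMatrix l₁ l₂ l₃ m))
    (j l a : Fin 3) (x : R 3) :
    DifferentiableAt ℝ (fun y => coframeConn F (structureMatrix l₁ l₂ l₃ m) j l y a) x := by
  have d := h.differentiableAt x
  have d2 : DifferentiableAt ℝ (pd j (fun y => F y a l)) x :=
    ((contDiffOn_pd isOpen_univ (h.smooth a l).contDiffOn j).contDiffAt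
      Filter.univ_mem).differentiableAt (by simp)
  simp only [coframeConn, Pi.add_apply, cross_apply, Matrix.mulVec, dotProduct, Fin.sum_univ_three]
  refine d2.add ?_
  fin_cases a <;> simp <;> fun_prop

theorem pd_coframeConn (h : IsCoframe G F (structureMatrix l₁ l₂ l₃ m)) (i j l a : Fin 3)
    (x : R 3) : pd i (fun y => coframeConn F (structureMatrix l₁ l₂ l₃ m) j l y a) x =
      pd i (pd j (fun y => F y a l)) x +
      (crossProduct (milnor (structureMatrix l₁ l₂ l₃ m) *ᵥ fun c => pd i (fun y => F y c j) x)
        (fun c => F x c l) a +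
      crossProduct (milnor (structureMatrix l₁ l₂ l₃ m) *ᵥ fun c => F x c j)
        (fun c => pd i (fun y => F y c l) x) a) := by
  have d := h.differentiableAt x
  have d2 : DifferentiableAt ℝ (pd j (fun y => F y a l)) x :=
    ((contDiffOn_pd isOpen_univ (h.smooth a l).contDiffOn j).contDiffAt
      Filter.univ_mem).differentiableAt (by simp)
  set M := milnor (structureMatrix l₁ l₂ l₃ m) with hM
  have dM : ∀ b, HasFDerivAt (fun y => M b 0 * F y 0 j + M b 1 * F y 1 j + M b 2 * F y 2 j)
      (M b 0 • fderiv ℝ (fun y => F y 0 j) x + M b 1 • fderiv ℝ (fun y => F y 1 j) x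
        + M b 2 • fderiv ℝ (fun y => F y 2 j) x) x := fun b =>
    (((d 0 j).hasFDerivAt.const_mul _).fun_add ((d 1 j).hasFDerivAt.const_mul _)).fun_add
      ((d 2 j).hasFDerivAt.const_mul _)
  have dc : ∀ b c, HasFDerivAt (fun y => (M b 0 * F y 0 j + M b 1 * F y 1 j + M b 2 * F y 2 j) *
      F y c l - (M c 0 * F y 0 j + M c 1 * F y 1 j + M c 2 * F y 2 j) * F y b l) _ x := fun b c =>
    ((dM b).fun_mul (d c l).hasFDerivAt).fun_sub ((dM c).fun_mul (d b l).hasFDerivAt)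
  simp only [coframeConn, Pi.add_apply, cross_apply, Matrix.mulVec, dotProduct, Fin.sum_univ_three]
  fin_cases a
  · have := (d2.hasFDerivAt.fun_add (dc 1 2)).fderiv
    refine (congrArg (fun T : R 3 →L[ℝ] ℝ => T (e i)) this).trans ?_
    simp [pd]
    ring
  · have := (d2.hasFDerivAt.fun_add (dc 2 0)).fderiv
    refine (congrArg (fun T : R 3 →L[ℝ] ℝ => T (e i)) this).trans ?_
    simp [pd]
    ring
  · have := (d2.hasFDerivAt.fun_add (dc 0 1)).fderiv
    refine (congrArg (fun T : R 3 →L[ℝ] ℝ => T (e i)) this).trans ?_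
    simp [pd]
    ring

theorem pd_christoffel (h : IsCoframe G F (structureMatrix l₁ l₂ l₃ m)) (i k j l : Fin 3)
    (x : R 3) : pd i (christoffel G k j l) x = -∑ n, christoffel G k i n x * christoffel G n j l x +
      ∑ a, (F x)⁻¹ k a * (crossProduct (milnor (structureMatrix l₁ l₂ l₃ m) *ᵥ fun c => F x c i)
        (coframeConn F (structureMatrix l₁ l₂ l₃ m) j l x) a +
        pd i (fun y => coframeConn F (structureMatrix l₁ l₂ l₃ m) j l y a) x) := by
  have hc : christoffel G k j l =
      fun y => ∑ a, (F y)⁻¹ k a * coframeConn F (structureMatrix l₁ l₂ l₃ m) j l y a :=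
    funext fun y => h.christoffel_eq k j l y
  have dX : ∀ a, DifferentiableAt ℝ (fun y => (F y)⁻¹ k a) x := fun a =>
    (h.contDiff_inv k a).differentiable (by simp) x
  have h1 : pd i (christoffel G k j l) x = ∑ a, ((F x)⁻¹ k a *
      pd i (fun y => coframeConn F (structureMatrix l₁ l₂ l₃ m) j l y a) x +
      coframeConn F (structureMatrix l₁ l₂ l₃ m) j l x a * pd i (fun y => (F y)⁻¹ k a) x) := by
    rw [hc]
    have := (HasFDerivAt.fun_sum (u := Finset.univ) fun a _ => (dX a).hasFDerivAt.fun_mul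
      (h.differentiableAt_coframeConn j l a x).hasFDerivAt).fderiv
    refine (congrArg (fun T : R 3 →L[ℝ] ℝ => T (e i)) this).trans ?_
    simp only [_root_.sum_apply, _root_.add_apply, _root_.smul_apply, smul_eq_mul, pd]
  have h2 : ∀ n, ∑ a, coframeConn F (structureMatrix l₁ l₂ l₃ m) j l x a * (F x)⁻¹ n a =
      christoffel G n j l x := fun n => by
    rw [h.christoffel_eq]; exact Finset.sum_congr rfl fun _ _ => mul_comm _ _
  have h3 := fun a => h.sum_mul_christoffel a j l x
  rw [h1]
  simp only [h.pd_inv]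
  have h4 : ∑ a, (F x)⁻¹ k a * crossProduct (milnor (structureMatrix l₁ l₂ l₃ m) *ᵥ
      fun c => F x c i) (coframeConn F (structureMatrix l₁ l₂ l₃ m) j l x) a =
      ∑ n, (∑ b, (F x)⁻¹ k b * crossProduct (milnor (structureMatrix l₁ l₂ l₃ m) *ᵥ
        fun c => F x c i) (fun c => F x c n) b) * christoffel G n j l x := by
    simp only [cross_apply, ← h3, Fin.sum_univ_three]
    simp
    ring
  simp only [mul_add, Finset.sum_add_distrib, h4]
  simp only [← h2, Fin.sum_univ_three]
  ring

end IsCoframe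

end Carleman

/-! ### Ricci, Schouten and Cotton-York tensors through the frame -/

namespace Carleman

variable {G F : R 3 → Matrix (Fin 3) (Fin 3) ℝ} {l₁ l₂ l₃ m : ℝ}

theorem sum_leviCivita (T : Fin 3 → Fin 3 → Fin 3 → ℝ) :
    ∑ k, ∑ l, ∑ n, T k l n * leviCivita k l n =
      T 0 1 2 - T 1 0 2 + (T 1 2 0 - T 2 1 0) + (T 2 0 1 - T 0 2 1) := by
  simp [Fin.sum_univ_three, leviCivita, Matrix.det_fin_three]
  ring

namespace IsCoframe

/-- The products of Christoffel symbols cancel by `pd_christoffel` and the second derivatives of the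
coframe by their symmetry. What is left is the curvature operator, traced by `ricci_identity`. -/
theorem ricci_eq (h : IsCoframe G F (structureMatrix l₁ l₂ l₃ m)) (j k : Fin 3) (x : R 3) :
    ricci G j k x = ((F x)ᵀ * frameRicci (structureMatrix l₁ l₂ l₃ m) * F x) j k := by
  set L := structureMatrix l₁ l₂ l₃ m with hL
  have h1 : ∀ i, pd i (christoffel G i j k) x - pd j (christoffel G i i k) x
      + ∑ n, (christoffel G i i n x * christoffel G n j k x
        - christoffel G i j n x * christoffel G n i k x) =
      ∑ a, (F x)⁻¹ i a * crossProduct (curvatureOp L *ᵥ crossProduct (fun c => F x c i)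
        (fun c => F x c j)) (fun c => F x c k) a := fun i => by
    have h2 := fun a => curvature_identity (p := fun c => F x c i) (q := fun c => F x c j)
      (r := fun c => F x c k) (dil := fun a => pd i (fun y => F y a k) x)
      (djl := fun a => pd j (fun y => F y a k) x) (h := fun a => h.structure_eq x a i j) a
    refine Eq.trans ?_ (Finset.sum_congr rfl fun a _ => congrArg ((F x)⁻¹ i a * ·) (h2 a))
    rw [h.pd_christoffel, h.pd_christoffel, Finset.sum_sub_distrib]
    have h3 : ∀ a, pd i (pd j fun y => F y a k) x = pd j (pd i fun y => F y a k) x := fun a =>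
      pd_pd_comm (h.smooth a k).contDiffAt i j
    simp only [h.pd_coframeConn, h3]
    simp only [mul_add, mul_sub, Finset.sum_add_distrib, Finset.sum_sub_distrib, coframeConn]
    ring
  simp only [ricci, h1]
  rw [ricci_identity _ (h.mul_inv x)]
  simp only [frameRicci, Matrix.mul_apply, Matrix.mulVec, dotProduct, Matrix.transpose_apply,
    Fin.sum_univ_three]
  ring

theorem scalarCurv_eq (h : IsCoframe G F (structureMatrix l₁ l₂ l₃ m)) (x : R 3) :
    scalarCurv G x = (frameRicci (structureMatrix l₁ l₂ l₃ m)).trace := by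
  set r := frameRicci (structureMatrix l₁ l₂ l₃ m) with hr
  have h1 : scalarCurv G x = ((G x)⁻¹ * ((F x)ᵀ * r * F x)ᵀ).trace := by
    simp only [scalarCurv, h.ricci_eq, Matrix.trace, Matrix.diag_apply, Matrix.transpose_apply,
      Matrix.mul_apply (M := (G x)⁻¹)]
    rfl
  rw [h1, h.metric_inv, Matrix.transpose_mul, Matrix.transpose_mul, Matrix.transpose_transpose,
    Matrix.mul_assoc, ← Matrix.mul_assoc ((F x)⁻¹)ᵀ, ← Matrix.transpose_mul, h.mul_inv,
    Matrix.transpose_one, Matrix.one_mul, Matrix.trace_mul_comm, Matrix.mul_assoc, h.mul_inv,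
    Matrix.mul_one, Matrix.trace_transpose]

theorem schouten_eq (h : IsCoframe G F (structureMatrix l₁ l₂ l₃ m)) (j k : Fin 3) (x : R 3) :
    schouten G j k x = (fun c => F x c j) ⬝ᵥ
      (frameSchouten (structureMatrix l₁ l₂ l₃ m) *ᵥ fun c => F x c k) := by
  rw [schouten, h.ricci_eq, h.scalarCurv_eq, h.metric]
  simp only [frameSchouten, Matrix.mul_apply, Matrix.mulVec, dotProduct, Matrix.transpose_apply,
    Matrix.sub_apply, Matrix.smul_apply, Fin.sum_univ_three]
  simp
  ring

/-- The frame components of the Schouten tensor are constant, so only the connection acts, once on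
each argument; the derivatives of the coframe cancel against those inside `coframeConn`. -/
theorem nablaSchouten_eq (h : IsCoframe G F (structureMatrix l₁ l₂ l₃ m)) (k l i : Fin 3)
    (x : R 3) : nablaSchouten G k l i x =
      -(crossProduct (milnor (structureMatrix l₁ l₂ l₃ m) *ᵥ fun c => F x c k) (fun c => F x c l)
        ⬝ᵥ (frameSchouten (structureMatrix l₁ l₂ l₃ m) *ᵥ fun c => F x c i))
      - (fun c => F x c l) ⬝ᵥ (frameSchouten (structureMatrix l₁ l₂ l₃ m) *ᵥ
        crossProduct (milnor (structureMatrix l₁ l₂ l₃ m) *ᵥ fun c => F x c k)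
          (fun c => F x c i)) := by
  set S := frameSchouten (structureMatrix l₁ l₂ l₃ m) with hS
  have d := h.differentiableAt x
  have hf : schouten G l i = fun y => ∑ a, ∑ b, S a b * (F y a l * F y b i) := funext fun y => by
    rw [h.schouten_eq]
    simp only [Matrix.mulVec, dotProduct, Fin.sum_univ_three]
    ring
  have h1 : pd k (schouten G l i) x = ∑ a, ∑ b, S a b * (F x a l * pd k (fun y => F y b i) x
      + F x b i * pd k (fun y => F y a l) x) := by
    rw [hf]
    have := (HasFDerivAt.fun_sum (u := Finset.univ) fun a _ =>
      HasFDerivAt.fun_sum (u := Finset.univ) fun b _ =>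
        ((d a l).hasFDerivAt.fun_mul (d b i).hasFDerivAt).const_mul (S a b)).fderiv
    refine (congrArg (fun T : R 3 →L[ℝ] ℝ => T (e k)) this).trans ?_
    simp only [_root_.sum_apply, _root_.add_apply, _root_.smul_apply, smul_eq_mul, pd]
  have h2 : ∑ n, christoffel G n k l x * schouten G n i x =
      coframeConn F (structureMatrix l₁ l₂ l₃ m) k l x ⬝ᵥ (S *ᵥ fun c => F x c i) := by
    simp only [h.schouten_eq, dotProduct, ← h.sum_mul_christoffel, Fin.sum_univ_three]
    ring
  have h3 : ∑ n, christoffel G n k i x * schouten G l n x =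
      (fun c => F x c l) ⬝ᵥ (S *ᵥ coframeConn F (structureMatrix l₁ l₂ l₃ m) k i x) := by
    simp only [h.schouten_eq, dotProduct, Matrix.mulVec, ← h.sum_mul_christoffel,
      Fin.sum_univ_three]
    ring
  rw [nablaSchouten, h1, h2, h3]
  simp only [coframeConn, dotProduct, Matrix.mulVec, Fin.sum_univ_three, Pi.add_apply]
  ring

/-- The scalar in front is the sign of `det F`, that is, the orientation of the frame; for
invertibility it only has to be nonzero. -/
theorem cottonYork_eq (h : IsCoframe G F (structureMatrix l₁ l₂ l₃ m)) (x : R 3) :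
    cottonYork G x = ((F x).det / √(G x).det) •
      ((F x)ᵀ * (frameCottonYork (structureMatrix l₁ l₂ l₃ m))ᵀ * F x) := by
  set L := structureMatrix l₁ l₂ l₃ m with hL
  have hM : (milnor L).IsSymm := by
    rw [hL, milnor_structureMatrix]
    ext i j
    fin_cases i <;> fin_cases j <;> simp
  set s := √(G x).det with hs
  ext i j
  have hT : ∀ k l, nablaSchouten G k l i x - nablaSchouten G l k i x =
      ((fun c => F x c i) ᵥ* (frameCottonYork L)ᵀ) ⬝ᵥ
        crossProduct (fun c => F x c k) (fun c => F x c l) := fun k l => by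
    rw [h.nablaSchouten_eq, h.nablaSchouten_eq]
    exact nabla_identity hM _ _ _
  have h1 : ∑ k, ∑ l, ∑ n, G x j n * (nablaSchouten G k l i x - nablaSchouten G l k i x) *
      (leviCivita k l n / s) = ∑ k, ∑ l, ∑ n, (G x j n *
        (nablaSchouten G k l i x - nablaSchouten G l k i x) / s) * leviCivita k l n :=
    Finset.sum_congr rfl fun k _ => Finset.sum_congr rfl fun l _ =>
      Finset.sum_congr rfl fun n _ => by ring
  have h2 := cottonYork_identity (F x) ((fun c => F x c i) ᵥ* (frameCottonYork L)ᵀ) j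
  rw [← h.metric] at h2
  simp only [cottonYork, Matrix.of_apply]
  rw [h1, sum_leviCivita]
  have h3 : ((F x).det / s) * (((fun c => F x c i) ᵥ* (frameCottonYork L)ᵀ) ⬝ᵥ fun c => F x c j) =
      (((F x).det / s) • ((F x)ᵀ * (frameCottonYork L)ᵀ * F x)) i j := by
    simp only [Matrix.smul_apply, smul_eq_mul, Matrix.mul_apply, dotProduct, Matrix.vecMul,
      Matrix.transpose_apply]
  rw [← hT, ← hT, ← hT] at h2
  rw [← h3]
  linear_combination h2 / s

theorem det_cottonYork_ne_zero (h : IsCoframe G F (structureMatrix l₁ l₂ l₃ m))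
    (hK : (frameCottonYork (structureMatrix l₁ l₂ l₃ m)).det ≠ 0) (x : R 3) :
    (cottonYork G x).det ≠ 0 := by
  have hF := h.det_ne_zero x
  have hG : √(G x).det ≠ 0 := by
    rw [h.metric, Matrix.det_mul, Matrix.det_transpose, Real.sqrt_mul_self_eq_abs]
    exact abs_ne_zero.2 hF
  rw [h.cottonYork_eq, Matrix.det_smul, Matrix.det_mul, Matrix.det_mul, Matrix.det_transpose,
    Matrix.det_transpose]
  exact mul_ne_zero (pow_ne_zero _ (div_ne_zero hF hG)) (mul_ne_zero (mul_ne_zero hF hK) hF)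

end IsCoframe

end Carleman

theorem theorem1p7 :
    -- the spherical, Euclidean and hyperbolic geometries
    (Carleman.LocallyAdmitsLCW (Carleman.stdBasis 3) (𝓡 3) (Carleman.sphereMetric 3) ∧
      Carleman.LocallyAdmissible (𝓡 3) (Carleman.sphereMetric 3)) ∧
    (Carleman.LocallyAdmitsLCW (Carleman.stdBasis 3) (𝓡 3) (Carleman.euclideanMetric 3) ∧
      Carleman.LocallyAdmissible (𝓡 3) (Carleman.euclideanMetric 3)) ∧
    (Carleman.LocallyAdmitsLCW (Carleman.stdBasis 3) (𝓡 3) (Carleman.hyperbolicMetric 2) ∧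
      Carleman.LocallyAdmissible (𝓡 3) (Carleman.hyperbolicMetric 2)) ∧
    -- the two product geometries
    (Carleman.LocallyAdmitsLCW (Carleman.prodBasis 2) ((𝓡 2).prod 𝓘(ℝ, ℝ))
        (Carleman.prodLine (Carleman.sphereMetric 2)) ∧
      Carleman.LocallyAdmissible ((𝓡 2).prod 𝓘(ℝ, ℝ))
        (Carleman.prodLine (Carleman.sphereMetric 2))) ∧
    (Carleman.LocallyAdmitsLCW (Carleman.prodBasis 2) ((𝓡 2).prod 𝓘(ℝ, ℝ))
        (Carleman.prodLine (Carleman.hyperbolicMetric 1)) ∧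
      Carleman.LocallyAdmissible ((𝓡 2).prod 𝓘(ℝ, ℝ))
        (Carleman.prodLine (Carleman.hyperbolicMetric 1))) ∧
    -- Sol
    (Carleman.LocallyAdmitsLCW (Carleman.stdBasis 3) (𝓡 3) Carleman.solMetric ∧
      Carleman.LocallyAdmissible (𝓡 3) Carleman.solMetric) ∧
    -- Nil
    ((∀ x, (Carleman.cottonYork (Carleman.coeffs Carleman.nilMetric) x).det ≠ 0) ∧
      Carleman.NowhereAdmitsLCW (Carleman.stdBasis 3) (𝓡 3) Carleman.nilMetric) ∧
    -- the universal cover of SL(2, ℝ), with each of the metrics considered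
    ((∀ x, (Carleman.cottonYork (Carleman.coeffs Carleman.slMetric) x).det ≠ 0) ∧
      Carleman.NowhereAdmitsLCW (Carleman.stdBasis 3) (𝓡 3) Carleman.slMetric) ∧
    (∀ c : ℝ, 0 < c →
      (∀ x, (Carleman.cottonYork (Carleman.coeffs (Carleman.slMetricOfFiber c)) x).det ≠ 0) ∧
      Carleman.NowhereAdmitsLCW (Carleman.stdBasis 3) (𝓡 3) (Carleman.slMetricOfFiber c)) := by
  refine ⟨⟨Carleman.sphere_locallyAdmitsLCW, Carleman.sphere_locallyAdmissible⟩,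
    ⟨Carleman.euclidean_locallyAdmitsLCW, Carleman.euclidean_locallyAdmissible⟩,
    ⟨Carleman.hyperbolic_locallyAdmitsLCW, Carleman.hyperbolic_locallyAdmissible⟩,
    ⟨Carleman.prodSphere_locallyAdmitsLCW, Carleman.prodSphere_locallyAdmissible⟩,
    ⟨Carleman.prodHyperbolic_locallyAdmitsLCW, Carleman.prodHyperbolic_locallyAdmissible⟩,
    ⟨Carleman.sol_locallyAdmitsLCW, Carleman.sol_locallyAdmissible⟩,
    ⟨Carleman.isCoframe_nil.det_cottonYork_ne_zero Carleman.det_frameCottonYork_nil,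
      Carleman.isCoframe_nil.nowhereAdmitsLCW Carleman.det_frameCottonYork_nil⟩,
    ⟨Carleman.isCoframe_sl.det_cottonYork_ne_zero Carleman.det_frameCottonYork_sl,
      Carleman.isCoframe_sl.nowhereAdmitsLCW Carleman.det_frameCottonYork_sl⟩, fun c hc => ?_⟩
  -- The orthonormal coframe involves the length of the fibre vector, so the squared length `c` is
  -- written as `(√c)²`.
  have hk := Real.sqrt_pos.2 hc
  have h := Carleman.isCoframe_slFiber hk.ne'
  rw [Real.sq_sqrt hc.le] at h
  exact ⟨h.det_cottonYork_ne_zero (Carleman.det_frameCottonYork_slFiber hk),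
    h.nowhereAdmitsLCW (Carleman.det_frameCottonYork_slFiber hk)⟩
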